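/- Let $\tau\in\mathbb C$, $\mathrm{im}\,\tau>0$, $q=e^{2\pi i\tau}$, $\Lambda_\tau=2\pi i\,\mathbb Z+2\pi i\tau\,\mathbb Z$, $(q)_\infty=\prod_{k\ge1}(1-q^k)$. Let $\theta(z)=\vartheta(z)/\vartheta'(0)$ with $\vartheta(z)=\sum_{m\in\mathbb Z}(-1)^{m+1/2}q^{\frac12(m+\frac12)^2}e^{(m+\frac12)z}$ be the odd Jacobi theta function normalized by $\theta'(0)=1$. For $n\ge 1$ let $$T_n(z_1,\dots,z_n;q)=\theta(z_1+\cdots+z_n)\,(q)_\infty\,F_n,\qquad F_n=\sum_{\lambda}q^{|\lambda|}\prod_{i=1}^n\ \sum_{k\ge1}e^{z_i(\lambda_k-k+\frac12)},$$ where $\lambda=(\lambda_1\ge\lambda_2\ge\cdots\ge 0)$ runs over all partitions (that is, $F_n=\mathrm{Tr}(q^H\prod_i\mathcal E_0(z_i))$ is the trace over the charge zero part of the semi-infinite wedge); the series converges for $\mathrm{re}\,z_i>0$, $\mathrm{re}(z_1+\cdots+z_n)<2\pi\,\mathrm{im}\,\tau$, and $T_n$ is continued meromorphically in $(\tau,z)$.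 Put $\mathbb G_a=\frac12(a-1)!\sum_{\lambda\in\Lambda_\tau\setminus0}\lambda^{-a}$ for even $a\ge2$ (Eisenstein summation: first along $2\pi i\mathbb Z$, then along $2\pi i\tau\mathbb Z$), $\mathbb G_a=0$ for odd $a$, $\mathcal E^*_a(z)=(\ln\theta)^{(a)}(z)+2\mathbb G_a$ for $a\ge1$, and $\mathbf A(z)=\mathrm{im}(z/2\pi i)/\mathrm{im}\,\tau$. Let $\mathbf B_m(x_1,\dots,x_m)=m!\,[t^m]\exp(\sum_{k\ge1}x_kt^k/k!)$ be the complete Bell polynomials. For a finite set $S$ write $z_S=\sum_{i\in S}z_i$ and let $\Pi_S$ be the set of partitions $\pi=\{\pi_k\}$ of $S$ into nonempty blocks (for $S=\emptyset$ there is one, the empty partition, with product $1$). An elliptic and modular completion of $T_n$ is a function $\widehat T_n(\tau,z)$, defined off the divisors $z_S\in\Lambda_\tau$, $\emptyset\ne S\subsetneq[n]$, such that * $\widehat T_n$ is a polynomial in $\mathbf A(z_1),\dots,\mathbf A(z_n)$ whose coefficients are meromorphic functions of $(\tau,z)\in\mathbb H\times\mathbb C^n$ with poles at most along these divisors, and whose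 constant coefficient is $T_n$; * $\widehat T_n(\tau,z+\lambda)=\widehat T_n(\tau,z)$ for all $\lambda\in\Lambda_\tau^n$; * $\widehat T_n\big(\frac{a\tau+b}{c\tau+d},\frac{z}{c\tau+d}\big)=(c\tau+d)^{n-1}\,\widehat T_n(\tau,z)$ for all $\begin{pmatrix}a&b\\c&d\end{pmatrix}\in SL_2(\mathbb Z)$. Then for every $n\ge1$: 1. $T_n=\sum_{j\in[n]}\sum_{\pi\in\Pi_{[n]\setminus\{j\}}}\prod_k\frac1{|\pi_k|}\mathbf B_{|\pi_k|}(\mathcal E_1^*,\mathcal E_2^*,\dots)(z_{\pi_k})$ on the domain of convergence above. 2. $T_n$ has exactly one elliptic and modular completion $\widehat T_n$, and it is obtained from this formula by replacing $\mathcal E_1^*$ with $\mathcal E_1^*+\mathbf A$ throughout: $$\widehat T_n=\sum_{j\in[n]}\sum_{\pi\in\Pi_{[n]\setminus\{j\}}}\prod_k\frac1{|\pi_k|}\mathbf B_{|\pi_k|}(\mathcal E_1^*+\mathbf A,\mathcal E_2^*,\mathcal E^*_3,\dots)(z_{\pi_k}).$$ 3. Explicitly, $$\widehat T_n=\sum_{j\in[n]}\sum_{\pi\in\Pi_{[n]\setminus\{j\}}}\prod_k\frac1{|\pi_k|}\sum_{\pi_k=\pi_k'\sqcup\pi_k''}\mathbf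 B_{|\pi_k'|}(\mathcal E_1^*,\mathcal E_2^*,\dots)(z_{\pi_k})\,\mathbf A(z_{\pi_k})^{|\pi_k''|},$$ where the inner sum is over the ordered decompositions of $\pi_k$ into two disjoint, possibly empty, subsets. -/

import Mathlib

open Complex Finset

noncomputable section

namespace EllipticGW

/-- The lattice `2πi ℤ + 2πi τ ℤ`, so that the elliptic curve is `ℂ` modulo this lattice. -/
def Lat (τ : ℂ) : Set ℂ :=
  {l | ∃ a b : ℤ, l = 2 * Real.pi * I * a + 2 * Real.pi * I * τ * b}

/-- The nome `q = e^{2πiτ}`. -/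
def nome (τ : ℂ) : ℂ := cexp (2 * Real.pi * I * τ)

/-- The odd Jacobi theta series
`∑_{m ∈ ℤ} (-1)^{m+1/2} q^{(m+1/2)^2/2} e^{(m+1/2)z}`, with `(-1)^x = e^{πix}`. -/
def thetaSeries (τ z : ℂ) : ℂ :=
  ∑' m : ℤ, cexp (Real.pi * I * (m + 1 / 2)) * cexp (Real.pi * I * τ * (m + 1 / 2) ^ 2)
    * cexp ((m + 1 / 2) * z)

/-- The odd Jacobi theta function, normalized to have derivative `1` at `z = 0`. -/
def theta (τ z : ℂ) : ℂ := thetaSeries τ z / deriv (thetaSeries τ) 0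

/-- The Euler function `(q)_∞ = ∏_{k ≥ 1} (1 - q^k)`. -/
def eulerQ (τ : ℂ) : ℂ := ∏' k : ℕ, (1 - nome τ ^ (k + 1))

/-- The eigenvalue `∑_{k ≥ 1} e^{w(λ_k - k + 1/2)}` of the operator `𝓔₀(w)` on the state labelled
by the partition `λ`. The rows of a Young diagram are indexed from `0` here. -/
def charE (w : ℂ) (μ : YoungDiagram) : ℂ :=
  ∑' k : ℕ, cexp (w * ((μ.rowLen k : ℂ) - k - 1 / 2))

/-- The `n`-point function
`F_n(z₁,…,z_n;q) = Tr(q^H ∏ᵢ 𝓔₀(zᵢ)) = ∑_λ q^{|λ|} ∏ᵢ ∑_{k ≥ 1} e^{zᵢ(λ_k - k + 1/2)}`,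
the trace over the charge zero part of the semi-infinite wedge. -/
def nPoint {n : ℕ} (τ : ℂ) (z : Fin n → ℂ) : ℂ :=
  ∑' μ : YoungDiagram, nome τ ^ μ.card * ∏ i, charE (z i) μ

/-- `T_n(z₁,…,z_n;q) = θ(z₁ + ⋯ + z_n) (q)_∞ F_n(z₁,…,z_n;q)`. -/
def gwT {n : ℕ} (τ : ℂ) (z : Fin n → ℂ) : ℂ :=
  theta τ (∑ i, z i) * eulerQ τ * nPoint τ z

/-- The domain `|uᵢ| > 1`, `|u₁ ⋯ u_n| < |q|⁻¹` (with `uᵢ = e^{zᵢ}`) where the series defining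
`F_n` converges absolutely. -/
def traceDomain (n : ℕ) (τ : ℂ) : Set (Fin n → ℂ) :=
  {z | (∀ i, 0 < (z i).re) ∧ (∑ i, z i).re < 2 * Real.pi * τ.im}

/-- The complement in `ℂⁿ` of the divisors `∑_{i ∈ S} zᵢ ∈ Λ_τ`, for `∅ ≠ S ⊊ [n]`. -/
def regularLocus (n : ℕ) (τ : ℂ) : Set (Fin n → ℂ) :=
  {z | ∀ S : Finset (Fin n), S.Nonempty → S ≠ univ → ∑ i ∈ S, z i ∉ Lat τ}

/-- The Eisenstein series `𝔾_a = ½ (a-1)! ∑_{λ ∈ Λ_τ - 0} λ^{-a}` for even `a ≥ 2` (Eisenstein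
summation: first over `2πiℤ`, then over `2πiτℤ`; the term `λ = 0` is `1 / 0 = 0`), and `𝔾_a = 0`
for odd `a`. -/
def eisG (τ : ℂ) (a : ℕ) : ℂ :=
  if Even a then
    1 / 2 * ((a - 1).factorial : ℂ) *
      ∑' m : ℤ, ∑' k : ℤ, 1 / (2 * Real.pi * I * k + 2 * Real.pi * I * τ * m) ^ a
  else 0

/-- `𝓔*_a(z) = (ln θ)^{(a)}(z) + 2 𝔾_a`, for `a ≥ 1`. -/
def EStar (τ : ℂ) (a : ℕ) (z : ℂ) : ℂ :=
  iteratedDeriv (a - 1) (logDeriv (theta τ)) z + 2 * eisG τ a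

/-- `A(z) = im(z / 2πi) / im τ`. -/
def anomA (τ z : ℂ) : ℂ := (((z / (2 * Real.pi * I)).im / τ.im : ℝ) : ℂ)

/-- `𝓔*₁ + A` in degree `1`, and `𝓔*_a` in degrees `a ≥ 2`. -/
def EStarHat (τ : ℂ) (a : ℕ) (z : ℂ) : ℂ :=
  if a = 1 then EStar τ 1 z + anomA τ z else EStar τ a z

/-- The complete Bell polynomial `B_m(x₁,…,x_m) = m! [t^m] exp(∑_{k ≥ 1} x_k t^k / k!)`. -/
def bellPoly (m : ℕ) (x : ℕ → ℂ) : ℂ :=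
  (m.factorial : ℂ) * PowerSeries.coeff m
    ((PowerSeries.exp ℂ).subst
      (PowerSeries.mk fun k => if k = 0 then 0 else x k / (k.factorial : ℂ)))

/-- `∑_{j ∈ [n]} ∑_{π ∈ Π_{[n]∖{j}}} ∏_k B_{|π_k|}(x₁, x₂, …)/|π_k|`, where the variables in the
factor of the block `π_k` are `x_a = E_a(∑_{i ∈ π_k} zᵢ)`. -/
def partitionSum {n : ℕ} (E : ℕ → ℂ → ℂ) (z : Fin n → ℂ) : ℂ :=
  ∑ j : Fin n, ∑ P : Finpartition (univ.erase j),
    ∏ b ∈ P.parts, bellPoly b.card (fun a => E a (∑ i ∈ b, z i)) / (b.card : ℂ)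

/-- `∑_{j ∈ [n]} ∑_{π ∈ Π_{[n]∖{j}}} ∏_k (1/|π_k|) ∑_{π_k = π'_k ⊔ π''_k}
B_{π'_k}(u_{π_k}) A^{|π''_k|}(u_{π_k})`. -/
def explicitSum {n : ℕ} (τ : ℂ) (z : Fin n → ℂ) : ℂ :=
  ∑ j : Fin n, ∑ P : Finpartition (univ.erase j),
    ∏ b ∈ P.parts, 1 / (b.card : ℂ) *
      ∑ s ∈ b.powerset, bellPoly s.card (fun a => EStar τ a (∑ i ∈ b, z i)) *
        anomA τ (∑ i ∈ b, z i) ^ (b \ s).card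

/-- Meromorphic functions of `(τ, z)` on `ℍ × ℂⁿ` with poles at most along the divisors
`∑_{i ∈ S} zᵢ ∈ Λ_τ`, `∅ ≠ S ⊊ [n]`: near every point of `ℍ × ℂⁿ` (also on these divisors) the
function is a quotient of two holomorphic functions, the denominator having no zeros off the
divisors. -/
def IsMero {n : ℕ} (c : ℂ × (Fin n → ℂ) → ℂ) : Prop :=
  ∀ p : ℂ × (Fin n → ℂ), 0 < p.1.im →
    ∃ (V : Set (ℂ × (Fin n → ℂ))) (g h : ℂ × (Fin n → ℂ) → ℂ),
      IsOpen V ∧ p ∈ V ∧ DifferentiableOn ℂ g V ∧ DifferentiableOn ℂ h V ∧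
        ∀ x ∈ V, 0 < x.1.im → x.2 ∈ regularLocus n x.1 → h x ≠ 0 ∧ c x = g x / h x

/-- `fhat` is almost-elliptic with holomorphic part `f`: off the polar divisors it is a polynomial
in `A(z₁), …, A(z_n)` with meromorphic coefficients, and its constant coefficient is the
meromorphic continuation of the function `f`, which is given on `traceDomain`. -/
def IsAlmostMeroExtension {n : ℕ} (f fhat : ℂ → (Fin n → ℂ) → ℂ) : Prop :=
  ∃ (s : Finset (Fin n → ℕ)) (c : (Fin n → ℕ) → ℂ × (Fin n → ℂ) → ℂ),
    (∀ α, IsMero (c α)) ∧ 0 ∈ s ∧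
    (∀ τ : ℂ, 0 < τ.im → ∀ z ∈ traceDomain n τ, c 0 (τ, z) = f τ z) ∧
    ∀ τ : ℂ, 0 < τ.im → ∀ z ∈ regularLocus n τ,
      fhat τ z = ∑ α ∈ s, c α (τ, z) * ∏ i, anomA τ (z i) ^ α i

/-- Invariance under translations of each variable by the lattice `Λ_τ`. -/
def IsElliptic {n : ℕ} (F : ℂ → (Fin n → ℂ) → ℂ) : Prop :=
  ∀ τ : ℂ, 0 < τ.im → ∀ z ∈ regularLocus n τ, ∀ l : Fin n → ℂ, (∀ i, l i ∈ Lat τ) →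
    F τ (z + l) = F τ z

/-- Modularity of weight `w` under `SL₂(ℤ)`. -/
def IsModular {n : ℕ} (w : ℕ) (F : ℂ → (Fin n → ℂ) → ℂ) : Prop :=
  ∀ τ : ℂ, 0 < τ.im → ∀ z ∈ regularLocus n τ, ∀ a b c d : ℤ, a * d - b * c = 1 →
    F ((a * τ + b) / (c * τ + d)) (fun i => z i / (c * τ + d)) = (c * τ + d) ^ w * F τ z

/-- `fhat` is the elliptic and modular completion, of weight `w`, of the function `f`. -/
structure IsCompletion {n : ℕ} (w : ℕ) (f fhat : ℂ → (Fin n → ℂ) → ℂ) : Prop where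
  extension : IsAlmostMeroExtension f fhat
  elliptic : IsElliptic fhat
  modular : IsModular w fhat

end EllipticGW

end

open Complex Finset

noncomputable section

namespace EllipticGW

/-! The charge zero trace is reached through the trace over the whole semi-infinite wedge, with a
parameter `t` that weights the charge. Relative to the Dirac sea an occupied mode `k` has weight
`x_k = -e^t q^k`, so the modes are independent, and the full trace can be computed in two ways.

Sort the states by charge and partition. Charge `c` multiplies the eigenvalue of each insertion by
`e^{c z_i}`, so the trace is `ϑ(t + z_1 + ⋯ + z_n) F_n` up to an elementary factor
(`tsum_stateWeight_mul_occSum`). Treat the modes as independent instead: the trace becomes a sum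
over set partitions of cumulants, and a block `b` contributes `∂_t^{|b|-1} K(z_b, t)` with the
Kronecker series `K(z, t) = ∑_k e^{kz} x_k / (1 + x_k)` (`tsum_stateWeight_eq_partSum`,
`thetaSeries_mul_nPoint`). With no insertion this comparison is the Jacobi triple product, which
locates the zeros of `ϑ`. With one insertion and `t → 0` it gives `K(z, t) = θ(z + t) / (θ(z) θ(t))`
(`kron_eq`).

Now let `t → 0` for general `n`. By the exponential formula and `exp(log(1 + X/t)) = 1 + X/t`, the
poles of all blocks collapse to at most one simple pole, carried by a singleton `{j}`
(`partSum_pole_add`). The zero of `ϑ(t)` cancels it, and this leaves the sum over `j`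
(`gwT_eq_sum_partSum`). The other blocks carry Taylor coefficients of the regular part of `K`, that
is, `1/|b|` times the `|b|`-th derivative of `tK` at `0`. The logarithmic derivative of `tK` has
derivatives `𝓔*_a(z)` at `t = 0`, the terms `2𝔾_a` coming from the expansion of `ln(θ(t)/t)`, and
Bell polynomials pass from these to the derivatives of `tK`.

For the completion, `e^{A(z)t} t θ(z + t) / (θ(z) θ(t))` is lattice periodic in `z` and invariant
when `t` is rescaled together with `z` under `SL₂(ℤ)` (`kronHat_add_period`, `kronHat_moebius`). Its
`m`-th derivative at `t = 0` is thus elliptic of weight `m`, and the block sizes add up to `n - 1`.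
The factor `e^{At}` only adds `A` to the first logarithmic derivative; expanding it by Leibniz gives
the explicit form. Uniqueness comes from ellipticity: on the real locus `A(z) = -b` a translation by
`2πiτb` leaves only the constant coefficient, and the resulting identity continues analytically
(`coeff_eq_zero_of_elliptic`). -/

/-- The sum over all set partitions of `s` of the product of the values of `f` on the blocks. -/
def partSum {ι R : Type*} [DecidableEq ι] [CommRing R] (f : Finset ι → R) (s : Finset ι) : R :=
  ∑ P : Finpartition s, ∏ b ∈ P.parts, f b

/-! ### Sums over set partitions and the exponential formula. -/

section PartSum

variable {ι R : Type*} [DecidableEq ι] [CommRing R]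

@[simp]
theorem partSum_empty (f : Finset ι → R) : partSum f ∅ = 1 := by
  have h : ∀ P : Finpartition (∅ : Finset ι), P.parts = ∅ := fun P =>
    P.parts_eq_empty_iff.2 rfl
  have : Unique (Finpartition (∅ : Finset ι)) :=
    inferInstanceAs (Unique (Finpartition (⊥ : Finset ι)))
  rw [partSum, Fintype.sum_unique, h, prod_empty]

theorem partSum_congr {f g : Finset ι → R} {s : Finset ι}
    (h : ∀ b ⊆ s, b.Nonempty → f b = g b) : partSum f s = partSum g s :=
  sum_congr rfl fun P _ => prod_congr rfl fun b hb => h b (P.le hb) (P.nonempty_of_mem_parts hb)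

/-- Deleting the block of `a` and putting it back are inverse bijections between the partitions with
that prescribed block and the partitions of the complement `s \ t`. -/
theorem sum_part_eq (f : Finset ι → R) {a : ι} {s t : Finset ι} (ha : a ∉ s) (ht : t ⊆ s) :
    ∑ P : Finpartition (insert a s) with P.part a = insert a t, ∏ b ∈ P.parts, f b =
      f (insert a t) * partSum f (s \ t) := by
  have hat : a ∉ t := fun h => ha (ht h)
  have hsd : insert a s \ insert a t = s \ t := by
    ext x; simp only [mem_sdiff, mem_insert]
    by_cases hx : x = a
    · subst hx; simp [ha]
    · simp [hx]
  have hav : ∀ P : Finpartition (insert a s), P.part a = insert a t →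
      (P.avoid (insert a t)).parts = P.parts.erase (insert a t) := by
    intro P hP
    have hmem : insert a t ∈ P.parts := hP ▸ P.part_mem.2 (mem_insert_self _ _)
    ext c
    rw [Finpartition.mem_avoid, mem_erase]
    constructor
    · rintro ⟨d, hd, hdn, rfl⟩
      have hne : d ≠ insert a t := fun h => hdn h.le
      have : d \ insert a t = d := sdiff_eq_left.2 (P.disjoint hd hmem hne)
      rw [this]; exact ⟨hne, hd⟩
    · rintro ⟨hne, hc⟩
      have hdisj : Disjoint c (insert a t) := P.disjoint hc hmem hne
      refine ⟨c, hc, fun hle => P.ne_empty hc ?_, sdiff_eq_left.2 hdisj⟩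
      exact disjoint_self.1 (hdisj.mono_right hle)
  have hdis : Disjoint (s \ t) (insert a t) := by
    rw [disjoint_insert_right]
    exact ⟨fun h => ha (mem_sdiff.1 h).1, sdiff_disjoint⟩
  have hsup : (s \ t) ⊔ insert a t = insert a s := by
    ext x
    have := @ht x
    simp only [sup_eq_union, mem_union, mem_sdiff, mem_insert]
    tauto
  rw [partSum, mul_sum]
  refine sum_bij' (fun P _ => (P.avoid (insert a t)).copy hsd)
    (fun Q _ => Q.extend (insert_ne_empty a t) hdis hsup) (fun _ _ => mem_univ _) ?_ ?_ ?_ ?_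
  · intro Q _
    rw [mem_filter]
    exact ⟨mem_univ _, Finpartition.part_eq_of_mem _ (mem_insert_self _ _) (mem_insert_self _ _)⟩
  · intro P hP
    have hP' := (mem_filter.1 hP).2
    have hmem : insert a t ∈ P.parts := hP' ▸ P.part_mem.2 (mem_insert_self _ _)
    ext1
    change insert (insert a t) (P.avoid (insert a t)).parts = P.parts
    rw [hav P hP', insert_erase hmem]
  · intro Q _
    ext1
    have hp : (Q.extend (insert_ne_empty a t) hdis hsup).part a = insert a t :=
      Finpartition.part_eq_of_mem _ (mem_insert_self _ _) (mem_insert_self _ _)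
    change ((Q.extend (insert_ne_empty a t) hdis hsup).avoid (insert a t)).parts = Q.parts
    rw [hav _ hp]
    change (insert (insert a t) Q.parts).erase (insert a t) = Q.parts
    refine erase_insert fun h => ?_
    exact ha (mem_sdiff.1 (Q.le h (mem_insert_self a t))).1
  · intro P hP
    have hP' := (mem_filter.1 hP).2
    have hmem : insert a t ∈ P.parts := hP' ▸ P.part_mem.2 (mem_insert_self _ _)
    change _ = _ * ∏ b ∈ (P.avoid (insert a t)).parts, f b
    rw [hav P hP', mul_prod_erase _ _ hmem]

/-- The recursion for `partSum` on the block that contains a new element. -/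
theorem partSum_insert (f : Finset ι → R) {a : ι} {s : Finset ι} (ha : a ∉ s) :
    partSum f (insert a s) = ∑ t ∈ s.powerset, f (insert a t) * partSum f (s \ t) := by
  have hfib : ∀ P ∈ (univ : Finset (Finpartition (insert a s))),
      (P.part a).erase a ∈ s.powerset := by
    intro P _
    rw [mem_powerset]
    intro x hx
    have := P.part_subset a (mem_of_mem_erase hx)
    exact (mem_insert.1 this).resolve_left (ne_of_mem_erase hx)
  rw [partSum, ← sum_fiberwise_of_maps_to hfib]
  refine sum_congr rfl fun t ht => ?_
  rw [← sum_part_eq f ha (mem_powerset.1 ht)]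
  refine sum_congr (filter_congr fun P _ => ?_) fun _ _ => rfl
  have h1 : a ∈ P.part a := P.mem_part_self.2 (mem_insert_self _ _)
  have h2 : a ∉ t := fun h => ha (mem_powerset.1 ht h)
  constructor
  · rintro rfl; rw [insert_erase h1]
  · intro h; rw [h, erase_insert h2]

/-- A set function determined by the recursion of `partSum_insert` is a `partSum`. -/
theorem eq_mul_partSum (f G : Finset ι → R)
    (h : ∀ a s, a ∉ s → G (insert a s) = ∑ t ∈ s.powerset, f (insert a t) * G (s \ t))
    (s : Finset ι) : G s = G ∅ * partSum f s := by
  induction s using Finset.strongInduction with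
  | H s ih =>
    rcases s.eq_empty_or_nonempty with rfl | ⟨a, ha⟩
    · simp
    · rw [← insert_erase ha, h a _ (notMem_erase a s), partSum_insert f (notMem_erase a s), mul_sum]
      refine sum_congr rfl fun t _ => ?_
      rw [ih _ ((sdiff_subset).trans_ssubset (erase_ssubset ha))]
      ring

/-- Both sides run over the ordered decompositions of `s` into three pieces, a nested pair `u ⊆ t`
corresponding to the disjoint pair `(u, t \ u)`. -/
theorem sum_powerset_powerset {M : Type*} [AddCommMonoid M]
    (F : Finset ι → Finset ι → Finset ι → M) (s : Finset ι) :
    ∑ t ∈ s.powerset, ∑ u ∈ t.powerset, F u (t \ u) (s \ t) =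
      ∑ u ∈ s.powerset, ∑ v ∈ (s \ u).powerset, F u v ((s \ u) \ v) := by
  rw [sum_sigma', sum_sigma']
  refine sum_bij' (fun x _ => ⟨x.2, x.1 \ x.2⟩) (fun x _ => ⟨x.1 ∪ x.2, x.1⟩) ?_ ?_ ?_ ?_ ?_
  · rintro ⟨t, u⟩ h
    simp only [mem_sigma, mem_powerset] at h ⊢
    exact ⟨h.2.trans h.1, sdiff_subset_sdiff h.1 le_rfl⟩
  · rintro ⟨u, v⟩ h
    simp only [mem_sigma, mem_powerset] at h ⊢
    exact ⟨union_subset h.1 (h.2.trans sdiff_subset), subset_union_left⟩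
  · rintro ⟨t, u⟩ h
    simp only [mem_sigma, mem_powerset] at h
    simp [union_sdiff_of_subset h.2]
  · rintro ⟨u, v⟩ h
    simp only [mem_sigma, mem_powerset] at h
    have : Disjoint u v := (disjoint_sdiff.mono_right h.2)
    simp [union_sdiff_cancel_left this]
  · rintro ⟨t, u⟩ h
    simp only [mem_sigma, mem_powerset] at h
    simp only [_root_.sdiff_sdiff_left, sup_eq_union, union_sdiff_of_subset h.2]

/-- This is `exp(f + g) = exp f · exp g` for exponential generating functions. The right side
satisfies the recursion of `eq_mul_partSum`: the block of the new element is weighted either by `f`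
or by `g`. -/
theorem partSum_add (f g : Finset ι → R) (s : Finset ι) :
    partSum (fun b => f b + g b) s = ∑ t ∈ s.powerset, partSum f t * partSum g (s \ t) := by
  symm
  have := eq_mul_partSum (fun b => f b + g b)
    (fun s => ∑ t ∈ s.powerset, partSum f t * partSum g (s \ t)) ?_ s
  · simpa using this
  intro a s ha
  have key2 : ∀ F : Finset ι → Finset ι → Finset ι → R,
      ∑ t ∈ s.powerset, ∑ u ∈ (s \ t).powerset, F t u ((s \ t) \ u) =
      ∑ u ∈ s.powerset, ∑ t ∈ (s \ u).powerset, F t u ((s \ u) \ t) := by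
    intro F
    rw [sum_sigma', sum_sigma']
    refine sum_bij' (fun x _ => ⟨x.2, x.1⟩) (fun x _ => ⟨x.2, x.1⟩) ?_ ?_ (fun _ _ => rfl)
      (fun _ _ => rfl) ?_
    · rintro ⟨t, u⟩ h
      simp only [mem_sigma, mem_powerset, subset_sdiff] at h ⊢
      exact ⟨h.2.1, h.1, h.2.2.symm⟩
    · rintro ⟨t, u⟩ h
      simp only [mem_sigma, mem_powerset, subset_sdiff] at h ⊢
      exact ⟨h.2.1, h.1, h.2.2.symm⟩
    · rintro ⟨t, u⟩ h
      simp only [sdiff_sdiff_comm]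
  rw [sum_powerset_insert ha]
  have h1 : ∀ t ∈ s.powerset, partSum f t * partSum g (insert a s \ t) =
      ∑ u ∈ (s \ t).powerset, partSum f t * (g (insert a u) * partSum g ((s \ t) \ u)) := by
    intro t ht
    have hat : a ∉ t := fun h => ha (mem_powerset.1 ht h)
    rw [insert_sdiff_of_notMem _ hat, partSum_insert g (fun h => ha (mem_sdiff.1 h).1), mul_sum]
  have h2 : ∀ t ∈ s.powerset, partSum f (insert a t) * partSum g (insert a s \ insert a t) =
      ∑ u ∈ t.powerset, f (insert a u) * partSum f (t \ u) * partSum g (s \ t) := by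
    intro t ht
    have hat : a ∉ t := fun h => ha (mem_powerset.1 ht h)
    rw [partSum_insert f hat, sum_mul]
    have : insert a s \ insert a t = s \ t := by
      rw [insert_sdiff_insert, sdiff_insert, erase_eq_of_notMem]
      exact fun h => ha (mem_sdiff.1 h).1
    rw [this]
  rw [sum_congr rfl h1, sum_congr rfl h2,
    key2 (fun t u v => partSum f t * (g (insert a u) * partSum g v)),
    sum_powerset_powerset (fun u v w => f (insert a u) * partSum f v * partSum g w),
    ← sum_add_distrib]
  refine sum_congr rfl fun u _ => ?_
  rw [add_comm, add_mul, mul_sum, mul_sum]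
  congr 1 <;> refine sum_congr rfl fun _ _ => by ring

/-- The block weights are the exponential coefficients of `log(1 + cX)`, so the sums over partitions
are those of `1 + cX`. -/
theorem partSum_pole {K : Type*} [Field K] (c : K) (s : Finset ι) :
    partSum (fun b : Finset ι => (-1) ^ (b.card - 1) * ((b.card - 1).factorial : K) * c ^ b.card) s =
      if s.card = 0 then 1 else if s.card = 1 then c else 0 := by
  induction s using Finset.strongInduction with
  | H s ih =>
    rcases s.eq_empty_or_nonempty with rfl | ⟨a, ha⟩
    · simp
    obtain ⟨s, has, rfl⟩ : ∃ s', a ∉ s' ∧ insert a s' = s :=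
      ⟨s.erase a, notMem_erase _ _, insert_erase ha⟩
    rw [partSum_insert _ has]
    have hcard : (insert a s).card = s.card + 1 := card_insert_of_notMem has
    have h1 : ∀ t ∈ s.powerset, ((-1) ^ ((insert a t).card - 1) *
        (((insert a t).card - 1).factorial : K) * c ^ (insert a t).card) *
          partSum (fun b : Finset ι => (-1) ^ (b.card - 1) * ((b.card - 1).factorial : K) *
            c ^ b.card) (s \ t) =
        (-1) ^ t.card * (t.card.factorial : K) * c ^ (t.card + 1) *
          (if s.card - t.card = 0 then 1 else if s.card - t.card = 1 then c else 0) := by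
      intro t ht
      have hat : a ∉ t := fun h => has (mem_powerset.1 ht h)
      rw [ih (s \ t) (sdiff_subset.trans_ssubset (ssubset_insert has)),
        card_sdiff_of_subset (mem_powerset.1 ht), card_insert_of_notMem hat]
      simp
    rw [sum_congr rfl h1, hcard, sum_powerset_apply_card (fun k => (-1) ^ k * (k.factorial : K) *
      c ^ (k + 1) * (if s.card - k = 0 then 1 else if s.card - k = 1 then c else 0))]
    rcases Nat.eq_zero_or_pos s.card with h0 | h0
    · simp [h0]
    · obtain ⟨m, hm⟩ : ∃ m, s.card = m + 1 := ⟨s.card - 1, by omega⟩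
      -- Only the complements of size `0` and `1` contribute, and these two terms cancel because `(m
      -- + 1)! = (m + 1) · m!`.
      rw [hm, sum_range_succ, sum_range_succ, sum_eq_zero]
      · simp [Nat.factorial_succ]; ring
      · intro k hk
        have := mem_range.1 hk
        rw [if_neg (by omega), if_neg (by omega)]; simp

/-- Adding to the weight of each block `b` the `(|b|-1)`-st derivative of a simple pole changes
the sum over set partitions only by terms where one singleton block is a pole. -/
theorem partSum_pole_add {K : Type*} [Field K] (c : K) (r : Finset ι → K) (s : Finset ι) :
    partSum (fun b => (-1) ^ (b.card - 1) * ((b.card - 1).factorial : K) * c ^ b.card + r b) s =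
      partSum r s + c * ∑ j ∈ s, partSum r (s.erase j) := by
  rw [partSum_add]
  simp_rw [partSum_pole]
  have hsplit : ∀ t ∈ s.powerset, (if t.card = 0 then (1 : K) else if t.card = 1 then c else 0) *
      partSum r (s \ t) = (if t.card = 0 then partSum r (s \ t) else 0) +
        (if t.card = 1 then c * partSum r (s \ t) else 0) := by
    intro t _
    by_cases h : t.card = 0
    · simp [h]
    · by_cases h' : t.card = 1 <;> simp [h, h']
  rw [sum_congr rfl hsplit, sum_add_distrib, ← sum_filter, ← sum_filter, mul_sum]
  congr 1
  · have : s.powerset.filter (fun t => t.card = 0) = {∅} := by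
      ext t; simp only [mem_filter, mem_powerset, card_eq_zero, mem_singleton]
      exact ⟨fun h => h.2, fun h => by simp [h]⟩
    rw [this]; simp
  · have : s.powerset.filter (fun t => t.card = 1) = s.powersetCard 1 := by
      ext t; simp [mem_powersetCard]
    rw [this, powersetCard_one, sum_map]
    refine sum_congr rfl fun j _ => ?_
    simp [sdiff_singleton_eq_erase]

end PartSum

/-! ### Independent fermionic modes and their cumulants. -/

/-- The mode `k` is occupied in the state `D`, where `D` is the set of modes whose occupation
differs from that in the Dirac sea `{k < 0}`. -/
def Occ (D : Finset ℤ) (k : ℤ) : Prop := k ∈ D ↔ 0 ≤ k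

instance (D : Finset ℤ) (k : ℤ) : Decidable (Occ D k) := inferInstanceAs (Decidable (_ ↔ _))

/-- Switch the occupation of the mode `k`. -/
def toggle (k : ℤ) : Finset ℤ ≃ Finset ℤ where
  toFun D := symmDiff D {k}
  invFun D := symmDiff D {k}
  left_inv _ := symmDiff_symmDiff_cancel_right _ _
  right_inv _ := symmDiff_symmDiff_cancel_right _ _

theorem mem_toggle {k j : ℤ} {D : Finset ℤ} :
    j ∈ toggle k D ↔ if j = k then j ∉ D else j ∈ D := by
  change j ∈ symmDiff D {k} ↔ _
  rw [mem_symmDiff, mem_singleton]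
  split_ifs with h <;> simp [h]

theorem occ_toggle_self {k : ℤ} {D : Finset ℤ} : Occ (toggle k D) k ↔ ¬ Occ D k := by
  simp only [Occ, mem_toggle, if_true]; tauto

theorem occ_toggle_of_ne {k j : ℤ} {D : Finset ℤ} (h : j ≠ k) : Occ (toggle k D) j ↔ Occ D j := by
  simp only [Occ, mem_toggle, if_neg h]

/-- The weight of a state relative to the Dirac sea, when an occupied mode `k` has weight `x k`. -/
def stateWeight (x : ℤ → ℂ) (D : Finset ℤ) : ℂ := ∏ k ∈ D, if 0 ≤ k then x k else (x k)⁻¹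

/-- The sum of `a` over the occupied modes. -/
def occSum (a : ℤ → ℂ) (D : Finset ℤ) : ℂ := ∑' k, if Occ D k then a k else 0

theorem stateWeight_toggle {x : ℤ → ℂ} {k : ℤ} (hx : x k ≠ 0) {D : Finset ℤ} (h : ¬ Occ D k) :
    stateWeight x (toggle k D) = x k * stateWeight x D := by
  by_cases hk : 0 ≤ k
  · have hD : k ∉ D := fun h' => h (by simp [Occ, h', hk])
    have : toggle k D = insert k D := by
      ext j; rw [mem_toggle, mem_insert]; split_ifs with hj <;> simp [hj, hD]
    rw [stateWeight, this, prod_insert hD, if_pos hk, stateWeight]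
  · have hD : k ∈ D := by
      by_contra h'; exact h (by simp [Occ, h', hk])
    have : toggle k D = D.erase k := by
      ext j; rw [mem_toggle, mem_erase]; split_ifs with hj <;> simp [hj, hD]
    rw [stateWeight, this, stateWeight, ← mul_prod_erase D _ hD, if_neg hk, mul_inv_cancel_left₀ hx]

theorem occSum_toggle {a : ℤ → ℂ} {k : ℤ} {D : Finset ℤ} (h : ¬ Occ D k)
    (hs : Summable fun j => if Occ D j then a j else 0) :
    occSum a (toggle k D) = occSum a D + a k := by
  have : (fun j => if Occ (toggle k D) j then a j else 0) =
      fun j => (if Occ D j then a j else 0) + if j = k then a k else 0 := by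
    funext j
    by_cases hj : j = k
    · subst hj; simp [occ_toggle_self, h]
    · simp [occ_toggle_of_ne hj, hj]
  rw [occSum, this, hs.tsum_add (hasSum_ite_eq k (a k)).summable, (hasSum_ite_eq k (a k)).tsum_eq,
    occSum]

section Insertion

variable {ι : Type*} [DecidableEq ι]

/-- One mode in a product of independent fermionic modes: the contribution `N` of the states where
the mode is occupied in terms of the total `M + N`. -/
theorem occupied_eq_sum (x : ℂ) (a : ι → ℂ) (c : ℕ → ℂ)
    (hc : ∀ l, c l + x * ∑ j ∈ range (l + 1), (l.choose j : ℂ) * c j = x)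
    (N M : Finset ι → ℂ)
    (h : ∀ s, N s = x * ∑ t ∈ s.powerset, (∏ i ∈ t, a i) * M (s \ t)) (s : Finset ι) :
    N s = ∑ t ∈ s.powerset, (∏ i ∈ t, a i) * c t.card * (N (s \ t) + M (s \ t)) := by
  have h1 : ∀ t ∈ s.powerset, (∏ i ∈ t, a i) * c t.card * (N (s \ t) + M (s \ t)) =
      (∑ u ∈ (s \ t).powerset,
        (∏ i ∈ t, a i) * c t.card * (x * ((∏ i ∈ u, a i) * M ((s \ t) \ u)))) +
      (∏ i ∈ t, a i) * c t.card * M (s \ t) := by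
    intro t _
    rw [mul_add, h (s \ t), mul_sum, mul_sum]
  rw [sum_congr rfl h1, sum_add_distrib,
    ← sum_powerset_powerset (fun u v w => (∏ i ∈ u, a i) * c u.card *
      (x * ((∏ i ∈ v, a i) * M w))), ← sum_add_distrib, h s, mul_sum]
  refine sum_congr rfl fun t _ => ?_
  have h2 : ∑ u ∈ t.powerset, (∏ i ∈ u, a i) * c u.card * (x * ((∏ i ∈ t \ u, a i) * M (s \ t))) =
      (∏ i ∈ t, a i) * M (s \ t) * (x * ∑ u ∈ t.powerset, c u.card) := by
    rw [mul_sum, mul_sum]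
    refine sum_congr rfl fun u hu => ?_
    rw [← prod_sdiff (mem_powerset.1 hu)]; ring
  rw [h2, sum_powerset_apply_card]
  -- After the substitution the coefficient of `M (s \ t)` depends on `t` only through its product
  -- of `a i` and its size, and `hc` says that it is the required one.
  have := hc t.card
  simp only [nsmul_eq_mul]
  linear_combination (-(∏ i ∈ t, a i) * M (s \ t)) * this

/-- The expectation of a product of insertions `∑_k a i k`, summed over occupied modes, in a
system of independent fermionic modes, is given by a recursion. -/
theorem tsum_stateWeight_insert (x : ℤ → ℂ) (hx : ∀ k, x k ≠ 0) (a : ι → ℤ → ℂ) (c : ℤ → ℕ → ℂ)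
    (hc : ∀ k l, c k l + x k * ∑ j ∈ range (l + 1), (l.choose j : ℂ) * c k j = x k)
    (ha : ∀ i D, Summable fun k => if Occ D k then ‖a i k‖ else 0)
    (hw : ∀ s : Finset ι, Summable fun D => ‖stateWeight x D‖ *
      ∏ i ∈ s, ∑' k, if Occ D k then ‖a i k‖ else 0)
    (hk : ∀ s : Finset ι, s.Nonempty → Summable fun k => (∏ i ∈ s, a i k) * c k (s.card - 1))
    {n : ι} {s : Finset ι} (hn : n ∉ s) :
    ∑' D, stateWeight x D * ∏ i ∈ insert n s, occSum (a i) D =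
      ∑ t ∈ s.powerset, (∑' k, (∏ i ∈ insert n t, a i k) * c k ((insert n t).card - 1)) *
        ∑' D, stateWeight x D * ∏ i ∈ s \ t, occSum (a i) D := by
  have ha' : ∀ i D, Summable fun k => if Occ D k then a i k else 0 := fun i D =>
    Summable.of_norm ((ha i D).congr fun k => by split_ifs <;> simp)
  have hE : ∀ i D, ‖occSum (a i) D‖ ≤ ∑' k, if Occ D k then ‖a i k‖ else 0 := fun i D => by
    refine (norm_tsum_le_tsum_norm ((ha i D).congr fun k => by split_ifs <;> simp)).trans_eq ?_
    exact tsum_congr fun k => by split_ifs <;> simp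
  have hE0 : ∀ i D, 0 ≤ ∑' k, if Occ D k then ‖a i k‖ else 0 := fun i D =>
    tsum_nonneg fun k => by split_ifs <;> simp
  have hP : ∀ (s : Finset ι) D, ‖∏ i ∈ s, occSum (a i) D‖ ≤
      ∏ i ∈ s, ∑' k, if Occ D k then ‖a i k‖ else 0 := fun s D => by
    rw [norm_prod]; exact prod_le_prod (fun _ _ => norm_nonneg _) fun i _ => hE i D
  have hG : ∀ s : Finset ι, Summable fun D => stateWeight x D * ∏ i ∈ s, occSum (a i) D :=
    fun s => (hw s).of_norm_bounded fun D => by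
      rw [norm_mul]; exact mul_le_mul_of_nonneg_left (hP s D) (norm_nonneg _)
  have hN : ∀ k (s : Finset ι), Summable fun D => if Occ D k then
      stateWeight x D * ∏ i ∈ s, occSum (a i) D else 0 := fun k s =>
    (hG s).norm.of_norm_bounded fun D => by
      split_ifs <;> simp only [norm_zero, le_refl, norm_nonneg]
  have hM : ∀ k (s : Finset ι), Summable fun D => if Occ D k then 0 else
      stateWeight x D * ∏ i ∈ s, occSum (a i) D := fun k s =>
    (hG s).norm.of_norm_bounded fun D => by
      split_ifs <;> simp only [norm_zero, le_refl, norm_nonneg]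
  set N : ℤ → Finset ι → ℂ := fun k s => ∑' D, if Occ D k then
    stateWeight x D * ∏ i ∈ s, occSum (a i) D else 0 with hNdef
  set M : ℤ → Finset ι → ℂ := fun k s => ∑' D, if Occ D k then 0 else
    stateWeight x D * ∏ i ∈ s, occSum (a i) D with hMdef
  have hNM : ∀ k (s : Finset ι), N k s + M k s =
      ∑' D, stateWeight x D * ∏ i ∈ s, occSum (a i) D := fun k s => by
    rw [hNdef, hMdef]
    simp only
    rw [← (hN k s).tsum_add (hM k s)]
    exact tsum_congr fun D => by split_ifs <;> simp
  have hrel : ∀ k (s : Finset ι),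
      N k s = x k * ∑ t ∈ s.powerset, (∏ i ∈ t, a i k) * M k (s \ t) := fun k s => by
    rw [hNdef]
    simp only
    -- Toggling `k` pairs occupied states with empty ones. Occupying `k` multiplies the weight by `x
    -- k` and adds `a i k` to the `i`-th insertion; expanding the product yields the sum over `t`.
    rw [← (toggle k).tsum_eq]
    simp_rw [hMdef, ← tsum_mul_left]
    rw [← Summable.tsum_finsetSum (fun t _ => ((hM k _).mul_left _)), ← tsum_mul_left]
    refine tsum_congr fun D => ?_
    by_cases hD : Occ D k
    · simp [occ_toggle_self, hD]
    · simp only [occ_toggle_self, hD, not_false_eq_true, if_true, if_false]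
      rw [stateWeight_toggle (hx k) hD]
      have : ∀ i ∈ s, occSum (a i) (toggle k D) = a i k + occSum (a i) D := fun i _ => by
        rw [occSum_toggle hD (ha' i D), add_comm]
      rw [prod_congr rfl this, prod_add, mul_sum, mul_sum]
      exact sum_congr rfl fun t _ => by ring
  -- Only the insertion `n` is expanded over modes. The exchange of the two sums is absolutely
  -- convergent by `hw` for `insert n s`.
  have hfub : ∑' D, stateWeight x D * ∏ i ∈ insert n s, occSum (a i) D =
      ∑' k, a n k * N k s := by
    have h1 : ∀ D, stateWeight x D * ∏ i ∈ insert n s, occSum (a i) D =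
        ∑' k, if Occ D k then a n k * (stateWeight x D * ∏ i ∈ s, occSum (a i) D) else 0 := by
      intro D
      rw [prod_insert hn, occSum, mul_left_comm, ← tsum_mul_right]
      exact tsum_congr fun k => by split_ifs <;> simp
    have h2 : ∀ k, a n k * N k s = ∑' D, if Occ D k then
        a n k * (stateWeight x D * ∏ i ∈ s, occSum (a i) D) else 0 := by
      intro k
      rw [hNdef]; simp only; rw [← tsum_mul_left]
      exact tsum_congr fun D => by split_ifs <;> simp
    simp_rw [h1, h2]
    refine (Summable.tsum_comm (f := fun D k => if Occ D k then
        a n k * (stateWeight x D * ∏ i ∈ s, occSum (a i) D) else 0) ?_).symm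
    refine Summable.of_norm ?_
    rw [summable_prod_of_nonneg (fun _ => norm_nonneg _)]
    have h3 : ∀ D k, ‖(if Occ D k then a n k * (stateWeight x D * ∏ i ∈ s, occSum (a i) D)
        else 0)‖ = (if Occ D k then ‖a n k‖ else 0) *
          ‖stateWeight x D * ∏ i ∈ s, occSum (a i) D‖ := by
      intro D k; split_ifs <;> simp
    simp only [Function.uncurry_apply_pair, h3]
    refine ⟨fun D => (ha n D).mul_right _, ?_⟩
    refine (hw (insert n s)).of_nonneg_of_le
      (fun D => tsum_nonneg fun k => mul_nonneg (by split_ifs <;> simp) (norm_nonneg _)) fun D => ?_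
    rw [tsum_mul_right, norm_mul, prod_insert hn]
    have := mul_le_mul_of_nonneg_left (hP s D)
      (mul_nonneg (hE0 n D) (norm_nonneg (stateWeight x D)))
    linarith
  rw [hfub]
  have hexp : ∀ k, a n k * N k s = ∑ t ∈ s.powerset,
      (∏ i ∈ insert n t, a i k) * c k ((insert n t).card - 1) *
        ∑' D, stateWeight x D * ∏ i ∈ s \ t, occSum (a i) D := by
    intro k
    rw [occupied_eq_sum (x k) (fun i => a i k) (c k) (hc k) (N k) (M k) (hrel k) s, mul_sum]
    refine sum_congr rfl fun t ht => ?_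
    have : n ∉ t := fun h => hn (mem_powerset.1 ht h)
    rw [hNM, prod_insert this, card_insert_of_notMem this, Nat.add_sub_cancel]
    ring
  simp_rw [hexp]
  rw [Summable.tsum_finsetSum fun t _ => (hk (insert n t) (insert_nonempty n t)).mul_right _]
  exact sum_congr rfl fun t _ => tsum_mul_right

/-- The block function is the joint cumulant of the insertions in `b`. Cumulants add over
independent modes, hence the single sum over `k`; the index `b.card - 1` appears because one
insertion selects the mode and the others differentiate its occupation number. -/
theorem tsum_stateWeight_eq_partSum (x : ℤ → ℂ) (hx : ∀ k, x k ≠ 0) (a : ι → ℤ → ℂ)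
    (c : ℤ → ℕ → ℂ)
    (hc : ∀ k l, c k l + x k * ∑ j ∈ range (l + 1), (l.choose j : ℂ) * c k j = x k)
    (ha : ∀ i D, Summable fun k => if Occ D k then ‖a i k‖ else 0)
    (hw : ∀ s : Finset ι, Summable fun D => ‖stateWeight x D‖ *
      ∏ i ∈ s, ∑' k, if Occ D k then ‖a i k‖ else 0)
    (hk : ∀ s : Finset ι, s.Nonempty → Summable fun k => (∏ i ∈ s, a i k) * c k (s.card - 1))
    (s : Finset ι) :
    ∑' D, stateWeight x D * ∏ i ∈ s, occSum (a i) D = (∑' D, stateWeight x D) *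
      partSum (fun b => ∑' k, (∏ i ∈ b, a i k) * c k (b.card - 1)) s := by
  have := eq_mul_partSum (fun b => ∑' k, (∏ i ∈ b, a i k) * c k (b.card - 1))
    (fun s => ∑' D, stateWeight x D * ∏ i ∈ s, occSum (a i) D)
    (fun n s hn => tsum_stateWeight_insert x hx a c hc ha hw hk hn) s
  simpa using this

end Insertion

/-! ### Partitions, Maya diagrams and the labelling of states. -/

section Young

/-- The Young diagram with given row lengths. -/
def youngOfRows (f : ℕ → ℕ) (hf : Antitone f) (N : ℕ) : YoungDiagram where
  cells := (range N ×ˢ range (f 0)).filter fun p => p.2 < f p.1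
  isLowerSet := by
    rintro ⟨a, b⟩ ⟨c, d⟩ h hab
    obtain ⟨h1, h2⟩ := Prod.mk_le_mk.1 h
    simp only [coe_filter, mem_product, mem_range, Set.mem_ofPred_eq] at hab ⊢
    have := hf h1
    omega

theorem rowLen_youngOfRows {f : ℕ → ℕ} (hf : Antitone f) {N : ℕ} (hN : ∀ i, N ≤ i → f i = 0)
    (i : ℕ) : (youngOfRows f hf N).rowLen i = f i := by
  have h : ∀ j, j < (youngOfRows f hf N).rowLen i ↔ j < f i := by
    intro j
    rw [← YoungDiagram.mem_iff_lt_rowLen, ← YoungDiagram.mem_cells]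
    simp only [youngOfRows, mem_filter, mem_product, mem_range]
    have := hf (Nat.zero_le i)
    by_cases hi : N ≤ i
    · simp [hN i hi]
    · constructor
      · exact fun h => h.2
      · exact fun h => ⟨⟨by omega, by omega⟩, h⟩
  exact le_antisymm (not_lt.1 fun h' => lt_irrefl _ ((h _).1 h'))
    (not_lt.1 fun h' => lt_irrefl _ ((h _).2 h'))

theorem youngDiagram_ext_rowLen {μ ν : YoungDiagram} (h : ∀ i, μ.rowLen i = ν.rowLen i) :
    μ = ν := by
  ext ⟨i, j⟩
  rw [YoungDiagram.mem_cells, YoungDiagram.mem_cells, YoungDiagram.mem_iff_lt_rowLen,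
    YoungDiagram.mem_iff_lt_rowLen, h]

theorem rowLen_eq_zero {μ : YoungDiagram} {i : ℕ} (h : μ.colLen 0 ≤ i) : μ.rowLen i = 0 := by
  by_contra hne
  have : (i, 0) ∈ μ := YoungDiagram.mem_iff_lt_rowLen.2 (Nat.pos_of_ne_zero hne)
  exact absurd (YoungDiagram.mem_iff_lt_colLen.1 this) (not_lt.2 h)

theorem card_eq_sum_rowLen {μ : YoungDiagram} {N : ℕ} (h : μ.colLen 0 ≤ N) :
    μ.card = ∑ i ∈ range N, μ.rowLen i := by
  have hm : ∀ p ∈ μ.cells, p.1 ∈ range N := by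
    rintro ⟨i, j⟩ hp
    rw [mem_range]
    by_contra hi
    have h1 := YoungDiagram.mem_iff_lt_rowLen.1 ((YoungDiagram.mem_cells _).1 hp)
    rw [rowLen_eq_zero (h.trans (not_lt.1 hi))] at h1
    exact absurd h1 (Nat.not_lt_zero _)
  rw [YoungDiagram.card, card_eq_sum_card_fiberwise hm]
  exact sum_congr rfl fun i _ => (YoungDiagram.rowLen_eq_card μ).symm

end Young

/-- The occupied modes, in decreasing order, of the state of charge `c` labelled by `μ`. -/
def maya (p : ℤ × YoungDiagram) (i : ℕ) : ℤ := p.2.rowLen i - i - 1 + p.1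

theorem maya_strictAnti (p : ℤ × YoungDiagram) : StrictAnti (maya p) :=
  strictAnti_nat_of_succ_lt fun i => by
    have := p.2.rowLen_anti i (i + 1) (Nat.le_succ i)
    simp only [maya]; push_cast; omega

theorem maya_eq {p : ℤ × YoungDiagram} {i : ℕ} (h : p.2.colLen 0 ≤ i) :
    maya p i = p.1 - 1 - i := by
  rw [maya, rowLen_eq_zero h]; push_cast; ring

theorem mem_range_maya {p : ℤ × YoungDiagram} {N : ℕ} (hN : p.2.colLen 0 ≤ N) {k : ℤ}
    (hk : k < p.1 - N) : k ∈ Set.range (maya p) := by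
  refine ⟨(p.1 - 1 - k).toNat, ?_⟩
  rw [maya_eq (by omega)]; omega

/-- The state of charge `p.1` labelled by the partition `p.2`. -/
def stateOf (p : ℤ × YoungDiagram) : Finset ℤ :=
  (Set.Finite.subset (s := Set.Icc (min 0 (p.1 - p.2.colLen 0)) (max 0 (maya p 0)))
    (t := {k | k ∈ Set.range (maya p) ↔ 0 ≤ k}) (Set.finite_Icc _ _) (by
      intro k hk
      rw [Set.mem_ofPred_eq] at hk
      rw [Set.mem_Icc]
      constructor
      · by_contra hlt
        have h1 : k < 0 ∧ k < p.1 - p.2.colLen 0 := by omega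
        exact absurd (hk.1 (mem_range_maya le_rfl h1.2)) (not_le.2 h1.1)
      · by_contra hlt
        have h1 : 0 ≤ k ∧ maya p 0 < k := by omega
        obtain ⟨i, rfl⟩ := hk.2 h1.1
        exact absurd ((maya_strictAnti p).antitone (Nat.zero_le i)) (not_le.2 h1.2))).toFinset

theorem mem_stateOf {p : ℤ × YoungDiagram} {k : ℤ} :
    k ∈ stateOf p ↔ (k ∈ Set.range (maya p) ↔ 0 ≤ k) := by
  simp [stateOf]

theorem occ_stateOf {p : ℤ × YoungDiagram} {k : ℤ} :
    Occ (stateOf p) k ↔ k ∈ Set.range (maya p) := by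
  rw [Occ, mem_stateOf]; tauto

/-- A strictly decreasing enumeration is determined by its range. Its tail `p.1 - 1 - i` reveals the
charge, and the remaining data are the row lengths. -/
theorem stateOf_injective : Function.Injective stateOf := by
  intro p p' h
  have hr : Set.range (fun i => -maya p i) = Set.range (fun i => -maya p' i) := by
    have : Set.range (maya p) = Set.range (maya p') := by
      ext k; rw [← occ_stateOf, ← occ_stateOf, h]
    ext k
    have := Set.ext_iff.1 this (-k)
    simp only [Set.mem_range] at this ⊢
    simpa only [neg_eq_iff_eq_neg] using this
  have hs : ∀ p, StrictMono fun i => -maya p i := fun p i j hij =>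
    neg_lt_neg (maya_strictAnti p hij)
  have he := (StrictMono.range_inj (hs p) (hs p')).1 hr
  have he' : ∀ i, maya p i = maya p' i := fun i => neg_injective (congrFun he i)
  have hc : p.1 = p'.1 := by
    have := he' (max (p.2.colLen 0) (p'.2.colLen 0))
    rw [maya_eq (le_max_left _ _), maya_eq (le_max_right _ _)] at this
    linarith
  refine Prod.ext hc (youngDiagram_ext_rowLen fun i => ?_)
  have := he' i
  simp only [maya, hc] at this
  omega

/-- All exceptional modes lie in `[-N, N)`. Reading the modes downwards from `N - 1`, the occupied
ones are enumerated by `Nat.nth P`; if `K` of the first `2N` are occupied, the charge is `K - N`,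
and the deviation `g` of the enumeration from its tail is the partition. -/
theorem stateOf_surjective : Function.Surjective stateOf := by
  classical
  intro D
  obtain ⟨N, hN⟩ : ∃ N : ℕ, ∀ k ∈ D, -(N : ℤ) ≤ k ∧ k < N := by
    refine ⟨(∑ k ∈ D, k.natAbs) + 1, fun k hk => ?_⟩
    have := single_le_sum (f := fun k : ℤ => k.natAbs) (fun _ _ => Nat.zero_le _) hk
    omega
  set P : ℕ → Prop := fun j => Occ D ((N : ℤ) - 1 - j) with hP
  have hPtrue : ∀ j, 2 * N ≤ j → P j := by
    intro j hj
    have h1 : (N : ℤ) - 1 - j ∉ D := fun h => by have := (hN _ h).1; omega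
    simp only [hP, Occ, h1, false_iff]; omega
  have hinf : {j | P j}.Infinite := by
    refine Set.infinite_of_not_bddAbove ?_
    rintro ⟨b, hb⟩
    have := hb (hPtrue (max (b + 1) (2 * N)) (le_max_right _ _))
    omega
  set K := Nat.count P (2 * N) with hK
  have hnth : ∀ i, K ≤ i → Nat.nth P i = 2 * N + (i - K) := by
    intro i hi
    have h1 : Nat.count P (2 * N + (i - K)) = i := by
      rw [Nat.count_add, (Nat.count_iff_forall (p := fun k => P (2 * N + k))).2
        fun j _ => hPtrue _ (by omega)]
      omega
    conv_lhs => rw [← h1]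
    exact Nat.nth_count (hPtrue _ (by omega))
  set g : ℕ → ℤ := fun i => 2 * N - K + i - Nat.nth P i with hg
  have hganti : Antitone g := antitone_nat_of_succ_le fun i => by
    have := Nat.nth_strictMono (p := P) hinf (Nat.lt_succ_self i)
    simp only [hg, Nat.succ_eq_add_one] at this ⊢; push_cast; omega
  have hgz : ∀ i, K ≤ i → g i = 0 := by
    intro i hi
    simp only [hg]; rw [hnth i hi]; push_cast [hi]; ring
  have hg0 : ∀ i, 0 ≤ g i := fun i => by
    rw [← hgz (max i K) (le_max_right _ _)]; exact hganti (le_max_left _ _)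
  have hf : Antitone fun i => (g i).toNat := fun i j hij => Int.toNat_le_toNat (hganti hij)
  refine ⟨⟨K - N, youngOfRows _ hf K⟩, ?_⟩
  have hm : ∀ i, maya ⟨K - N, youngOfRows _ hf K⟩ i = N - 1 - Nat.nth P i := by
    intro i
    rw [maya, rowLen_youngOfRows hf (fun i hi => by rw [hgz i hi]; rfl), Int.toNat_of_nonneg (hg0 i)]
    simp only [hg]; ring
  ext k
  have hocc : k ∈ Set.range (maya ⟨K - N, youngOfRows _ hf K⟩) ↔ Occ D k := by
    constructor
    · rintro ⟨i, rfl⟩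
      rw [hm]
      exact Nat.nth_mem_of_infinite hinf i
    · intro hk
      have hkN : k < N := by
        by_contra h
        exact absurd (hN k (hk.2 (by omega))).2 h
      have hPk : P (((N : ℤ) - 1 - k).toNat) := by
        simp only [hP]
        rwa [Int.toNat_of_nonneg (by omega), sub_sub_cancel]
      obtain ⟨i, hi⟩ : (((N : ℤ) - 1 - k).toNat) ∈ Set.range (Nat.nth P) := by
        rw [Nat.range_nth_of_infinite hinf]; exact hPk
      refine ⟨i, ?_⟩
      rw [hm, hi]; omega
  rw [mem_stateOf, hocc, Occ]; tauto

/-- States of the fermionic system are labelled by their charge and a partition. -/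
def stateEquiv : ℤ × YoungDiagram ≃ Finset ℤ :=
  Equiv.ofBijective stateOf ⟨stateOf_injective, stateOf_surjective⟩

/-- Below `-l = c - N` (with `c` the charge) the state agrees with the Dirac sea. Its weight is
therefore the product over the occupied modes `S` above this cutoff divided by the product over the
sea modes `T` above it, and both exponents are arithmetic sums. -/
theorem stateWeight_stateOf (α β : ℂ) (p : ℤ × YoungDiagram) :
    stateWeight (fun k => cexp (α + β * k)) (stateOf p) =
      cexp (α * p.1 + β * (p.1 * (p.1 - 1) / 2 + p.2.card)) := by
  obtain ⟨N, hN, hc⟩ : ∃ N : ℕ, p.2.colLen 0 ≤ N ∧ p.1 ≤ N :=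
    ⟨max (p.2.colLen 0) p.1.toNat, le_max_left _ _, by omega⟩
  obtain ⟨l, hl⟩ : ∃ l : ℕ, (l : ℤ) = N - p.1 := ⟨(N - p.1).toNat, by omega⟩
  set x : ℤ → ℂ := fun k => cexp (α + β * k) with hx
  set S : Finset ℤ := (range N).image (maya p) with hS
  set T : Finset ℤ := (range l).image (fun j : ℕ => -(j : ℤ) - 1) with hT
  have hTm : ∀ k, k ∈ T ↔ -(l : ℤ) ≤ k ∧ k < 0 := by
    intro k
    simp only [hT, mem_image, mem_range]
    constructor
    · rintro ⟨j, hj, rfl⟩; omega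
    · rintro ⟨h1, h2⟩; exact ⟨(-k - 1).toNat, by omega, by omega⟩
  have hSm : ∀ k, k ∈ S ↔ k ∈ Set.range (maya p) ∧ -(l : ℤ) ≤ k := by
    intro k
    simp only [hS, mem_image, mem_range, Set.mem_range]
    constructor
    · rintro ⟨i, hi, rfl⟩
      refine ⟨⟨i, rfl⟩, ?_⟩
      simp only [maya]; omega
    · rintro ⟨⟨i, rfl⟩, h⟩
      refine ⟨i, ?_, rfl⟩
      by_contra hi
      rw [maya_eq (by omega)] at h; omega
  have hD1 : (stateOf p).filter (fun k => 0 ≤ k) = S \ T := by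
    ext k
    rw [mem_filter, mem_stateOf, mem_sdiff, hTm, hSm]
    constructor
    · rintro ⟨h1, h2⟩; exact ⟨⟨h1.2 h2, by omega⟩, by omega⟩
    · rintro ⟨⟨h1, h2⟩, h3⟩
      have : 0 ≤ k := by omega
      exact ⟨⟨fun _ => this, fun _ => h1⟩, this⟩
  have hD2 : (stateOf p).filter (fun k => ¬ 0 ≤ k) = T \ S := by
    ext k
    rw [mem_filter, mem_stateOf, mem_sdiff, hTm, hSm]
    constructor
    · rintro ⟨h1, h2⟩
      have h3 : k ∉ Set.range (maya p) := fun h => h2 (h1.1 h)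
      refine ⟨⟨?_, by omega⟩, fun h => h3 h.1⟩
      by_contra h4
      exact h3 (mem_range_maya hN (by omega))
    · rintro ⟨⟨h1, h2⟩, h3⟩
      have h4 : k ∉ Set.range (maya p) := fun h => h3 ⟨h, h1⟩
      exact ⟨⟨fun h => absurd h h4, fun h => absurd h (by omega)⟩, by omega⟩
  have hx0 : ∀ k, x k ≠ 0 := fun k => Complex.exp_ne_zero _
  have hw : stateWeight x (stateOf p) * ∏ k ∈ T, x k = ∏ k ∈ S, x k := by
    rw [stateWeight, prod_ite, hD1, hD2, ← prod_inter_mul_prod_sdiff T S, inter_comm T S,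
      ← prod_inter_mul_prod_sdiff S T]
    have : (∏ k ∈ T \ S, (x k)⁻¹) * ∏ k ∈ T \ S, x k = 1 := by
      rw [← prod_mul_distrib]; exact prod_eq_one fun k _ => inv_mul_cancel₀ (hx0 k)
    linear_combination (∏ k ∈ S \ T, x k) * (∏ k ∈ S ∩ T, x k) * this
  have hgauss : ∀ n : ℕ, ∑ i ∈ range n, ((i : ℂ) + 1) = n * (n + 1) / 2 := by
    intro n
    induction n with
    | zero => simp
    | succ n ih => rw [sum_range_succ, ih]; push_cast; ring
  have hST : ∏ k ∈ T, x k = cexp (α * l - β * (l * (l + 1) / 2)) := by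
    have h1 : ∀ i : ℕ, α + β * ((-(i : ℤ) - 1 : ℤ) : ℂ) = α - β * ((i : ℂ) + 1) := fun i => by
      push_cast; ring
    simp only [hT, hx]
    rw [prod_image (fun i _ j _ h => by simpa using h), ← Complex.exp_sum, ← hgauss]
    simp only [h1]
    rw [sum_sub_distrib, ← mul_sum]; simp [mul_comm]
  have hSS : ∏ k ∈ S, x k =
      cexp (α * N + β * (p.2.card - N * (N + 1) / 2 + N * p.1)) := by
    have h1 : ∀ i : ℕ, α + β * ((maya p i : ℤ) : ℂ) =
        (α + β * p.1) + β * (p.2.rowLen i - ((i : ℂ) + 1)) := fun i => by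
      simp only [maya]; push_cast; ring
    simp only [hS, hx]
    rw [prod_image (fun i _ j _ h => (maya_strictAnti p).injective h), ← Complex.exp_sum,
      ← hgauss, card_eq_sum_rowLen hN]
    simp only [h1]
    rw [sum_add_distrib, ← mul_sum, sum_sub_distrib]
    simp only [sum_const, card_range, nsmul_eq_mul, Nat.cast_sum]
    congr 1; ring
  rw [hST, hSS] at hw
  have hl' : (l : ℂ) = N - p.1 := by exact_mod_cast congrArg (Int.cast : ℤ → ℂ) hl
  refine mul_right_cancel₀ (Complex.exp_ne_zero _) (hw.trans ?_)
  rw [← Complex.exp_add, hl']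
  congr 1; ring

theorem occSum_stateOf (z : ℂ) (p : ℤ × YoungDiagram) :
    occSum (fun k => cexp ((k + 1 / 2) * z)) (stateOf p) = cexp (p.1 * z) * charE z p.2 := by
  rw [occSum, ← (maya_strictAnti p).injective.tsum_eq, charE, ← tsum_mul_left]
  · refine tsum_congr fun i => ?_
    rw [if_pos (occ_stateOf.2 ⟨i, rfl⟩), ← Complex.exp_add]
    congr 1
    simp only [maya]; push_cast; ring
  · intro k hk
    by_contra h
    exact hk (if_neg fun h' => h (occ_stateOf.1 h'))

/-! ### Euler's product for the generating function of partitions. -/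

section PartitionFunction

theorem colLen_zero_le_iff {μ : YoungDiagram} {r : ℕ} : μ.colLen 0 ≤ r ↔ μ.rowLen r = 0 := by
  refine ⟨rowLen_eq_zero, fun h => ?_⟩
  by_contra hlt
  have := YoungDiagram.mem_iff_lt_rowLen.1 (YoungDiagram.mem_iff_lt_colLen.2 (not_le.1 hlt))
  omega

/-- Add a column of height `r + 1` to the first `r + 1` rows. -/
def addCol (r : ℕ) (μ : YoungDiagram) : YoungDiagram :=
  youngOfRows (fun i => if i ≤ r then μ.rowLen i + 1 else 0) (fun i j hij => by
    have := μ.rowLen_anti i j hij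
    simp only
    split_ifs <;> omega) (r + 1)

theorem rowLen_addCol (r : ℕ) (μ : YoungDiagram) (i : ℕ) :
    (addCol r μ).rowLen i = if i ≤ r then μ.rowLen i + 1 else 0 :=
  rowLen_youngOfRows _ (fun i hi => if_neg (by omega)) i

theorem addCol_surj {r : ℕ} {ν : YoungDiagram} (h1 : ν.rowLen (r + 1) = 0) (h2 : 0 < ν.rowLen r) :
    ∃ μ : YoungDiagram, μ.rowLen (r + 1) = 0 ∧ addCol r μ = ν := by
  have hz : ∀ i, r + 1 ≤ i → ν.rowLen i = 0 := fun i hi =>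
    Nat.eq_zero_of_le_zero (h1 ▸ ν.rowLen_anti _ _ hi)
  have hr : ∀ i, (youngOfRows (fun i => ν.rowLen i - 1) (fun i j hij =>
      Nat.sub_le_sub_right (ν.rowLen_anti i j hij) 1) (r + 1)).rowLen i = ν.rowLen i - 1 :=
    rowLen_youngOfRows _ fun i hi => by rw [hz i hi]
  refine ⟨_, (hr _).trans (by rw [h1]), youngDiagram_ext_rowLen fun i => ?_⟩
  rw [rowLen_addCol, hr]
  split_ifs with hi
  · have := ν.rowLen_anti i r hi; omega
  · exact (hz i (by omega)).symm

theorem card_addCol {r : ℕ} {μ : YoungDiagram} (h : μ.rowLen (r + 1) = 0) :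
    (addCol r μ).card = r + 1 + μ.card := by
  have h' : (addCol r μ).rowLen (r + 1) = 0 := by simp [rowLen_addCol]
  rw [card_eq_sum_rowLen (colLen_zero_le_iff.2 h), card_eq_sum_rowLen (colLen_zero_le_iff.2 h'),
    sum_congr rfl fun i hi => by
      rw [rowLen_addCol, if_pos (Nat.lt_succ_iff.1 (mem_range.1 hi))], sum_add_distrib]
  simp [add_comm]

/-- The generating function of partitions with at most `r` parts. -/
theorem tsum_pow_card_mul_prod {q : ℂ} (hq : Summable fun μ : YoungDiagram => ‖q ^ μ.card‖)
    (r : ℕ) :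
    (∑' μ : YoungDiagram, if μ.rowLen r = 0 then q ^ μ.card else 0) *
      ∏ i ∈ range r, (1 - q ^ (i + 1)) = 1 := by
  induction r with
  | zero =>
    rw [tsum_eq_single ⊥]
    · have : (⊥ : YoungDiagram).rowLen 0 = 0 := by
        by_contra h
        exact YoungDiagram.notMem_bot _
          (YoungDiagram.mem_iff_lt_rowLen.2 (Nat.pos_of_ne_zero h))
      have hc : (⊥ : YoungDiagram).card = 0 := by simp [YoungDiagram.card]
      simp [this, hc]
    · intro μ hμ
      refine if_neg fun h => hμ (youngDiagram_ext_rowLen fun i => ?_)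
      have h1 := μ.rowLen_anti 0 i (Nat.zero_le i)
      have : (⊥ : YoungDiagram).rowLen i = 0 := by
        by_contra h
        exact YoungDiagram.notMem_bot _
          (YoungDiagram.mem_iff_lt_rowLen.2 (Nat.pos_of_ne_zero h))
      omega
  | succ r ih =>
    have hs : ∀ p : YoungDiagram → Prop, ∀ [DecidablePred p],
        Summable fun μ : YoungDiagram => if p μ then q ^ μ.card else 0 := fun p _ =>
      hq.of_norm_bounded fun μ => by split_ifs <;> simp
    -- At most `r + 1` parts means at most `r` parts, or exactly `r + 1`. In the second case
    -- deleting the first column, of height `r + 1`, leaves an arbitrary partition with at most `r +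
    -- 1` parts.
    have hsplit : ∀ μ : YoungDiagram, (if μ.rowLen (r + 1) = 0 then q ^ μ.card else 0) =
        (if μ.rowLen r = 0 then q ^ μ.card else 0) +
          if μ.rowLen (r + 1) = 0 ∧ 0 < μ.rowLen r then q ^ μ.card else 0 := by
      intro μ
      have := μ.rowLen_anti r (r + 1) (Nat.le_succ r)
      by_cases h : μ.rowLen r = 0
      · simp [h, show μ.rowLen (r + 1) = 0 by omega]
      · simp [h, Nat.pos_of_ne_zero h]
    have hbij : ∑' μ : YoungDiagram,
        (if μ.rowLen (r + 1) = 0 ∧ 0 < μ.rowLen r then q ^ μ.card else 0) =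
        q ^ (r + 1) * ∑' μ : YoungDiagram, if μ.rowLen (r + 1) = 0 then q ^ μ.card else 0 := by
      have hinj : Function.Injective
          fun μ : {μ : YoungDiagram // μ.rowLen (r + 1) = 0} => addCol r μ := by
        rintro ⟨μ, hμ⟩ ⟨ν, hν⟩ h
        refine Subtype.ext (youngDiagram_ext_rowLen fun i => ?_)
        have h' := congrArg (fun κ : YoungDiagram => κ.rowLen i) h
        simp only [rowLen_addCol] at h'
        have h1 := μ.rowLen_anti (r + 1) i
        have h2 := ν.rowLen_anti (r + 1) i
        simp only
        split_ifs at h' <;> omega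
      rw [← hinj.tsum_eq, ← tsum_mul_left]
      · rw [← tsum_subtype_eq_of_support_subset (s := {μ : YoungDiagram | μ.rowLen (r + 1) = 0})]
        · refine tsum_congr fun μ => ?_
          have hμ : μ.1.rowLen (r + 1) = 0 := μ.2
          rw [if_pos, if_pos hμ, card_addCol hμ, pow_add]
          simp [rowLen_addCol]
        · intro μ hμ
          by_contra h
          exact hμ (by simp only; rw [if_neg (show ¬ μ.rowLen (r + 1) = 0 from h), mul_zero])
      · intro μ hμ
        by_cases h : μ.rowLen (r + 1) = 0 ∧ 0 < μ.rowLen r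
        · obtain ⟨ν, h1, h2⟩ := addCol_surj h.1 h.2
          exact ⟨⟨ν, h1⟩, h2⟩
        · exact absurd (if_neg h) hμ
    have hrec := tsum_congr (L := .unconditional _) hsplit
    rw [(hs _).tsum_add (hs _), hbij] at hrec
    rw [prod_range_succ]
    linear_combination (∏ i ∈ range r, (1 - q ^ (i + 1))) * hrec + ih

/-- Let `r → ∞` in `tsum_pow_card_mul_prod`. Each partition is eventually counted, so dominated
convergence applies to the sum. -/
theorem tsum_pow_card_mul_tprod {q : ℂ} (hq : Summable fun μ : YoungDiagram => ‖q ^ μ.card‖)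
    (hq1 : ‖q‖ < 1) :
    (∑' μ : YoungDiagram, q ^ μ.card) * ∏' k : ℕ, (1 - q ^ (k + 1)) = 1 := by
  have h1 : Filter.Tendsto (fun r : ℕ => ∑' μ : YoungDiagram,
      if μ.rowLen r = 0 then q ^ μ.card else 0) Filter.atTop
      (nhds (∑' μ : YoungDiagram, q ^ μ.card)) := by
    refine tendsto_tsum_of_dominated_convergence hq (fun μ => ?_)
      (Filter.Eventually.of_forall fun r μ => by split_ifs <;> simp)
    refine tendsto_const_nhds.congr' ?_
    filter_upwards [Filter.eventually_ge_atTop (μ.colLen 0)] with r hr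
    rw [if_pos (rowLen_eq_zero hr)]
  have h2 := (ModularForm.multipliable_one_sub_pow hq1).hasProd.tendsto_prod_nat
  refine tendsto_nhds_unique (h1.mul h2) ?_
  simp_rw [tsum_pow_card_mul_prod hq]
  exact tendsto_const_nhds

end PartitionFunction

/-! ### Mode weights and absolute convergence. -/

/-- The weight `-e^t q^k` of the mode `k`. -/
def modeWeight (τ t : ℂ) (k : ℤ) : ℂ := cexp (t + Real.pi * I + 2 * Real.pi * I * τ * k)

theorem modeWeight_ne_zero (τ t : ℂ) (k : ℤ) : modeWeight τ t k ≠ 0 := Complex.exp_ne_zero _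

theorem modeWeight_eq (τ t : ℂ) (k : ℤ) : modeWeight τ t k = -cexp (t + 2 * Real.pi * I * τ * k) := by
  rw [modeWeight, add_right_comm, Complex.exp_add, Complex.exp_pi_mul_I, mul_neg_one]

theorem norm_modeWeight (τ t : ℂ) (k : ℤ) :
    ‖modeWeight τ t k‖ = Real.exp (t.re - 2 * Real.pi * τ.im * k) := by
  rw [modeWeight, Complex.norm_exp]
  congr 1
  simp only [add_re, mul_re, mul_im, re_ofNat, im_ofNat, ofReal_re, ofReal_im, I_re, I_im,
    intCast_re, intCast_im]
  ring

theorem one_add_modeWeight_ne_zero {τ t : ℂ} (ht : t ∉ Lat τ) (k : ℤ) :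
    1 + modeWeight τ t k ≠ 0 := by
  rw [modeWeight_eq, ← sub_eq_add_neg, sub_ne_zero]
  intro h
  obtain ⟨n, hn⟩ := Complex.exp_eq_one_iff.1 h.symm
  exact ht ⟨n, -k, by push_cast; linear_combination hn⟩

section Summability

theorem summable_exp_nat {b : ℝ} (hb : b < 0) (a : ℝ) :
    Summable fun n : ℕ => Real.exp (a + b * n) := by
  have := (Real.summable_exp_nat_mul_iff.2 hb).mul_left (Real.exp a)
  refine this.congr fun n => ?_
  rw [← Real.exp_add]; ring_nf

/-- Two-sided geometric series. -/
theorem summable_ite_exp {b c : ℝ} (hb : b < 0) (hc : 0 < c) (a d : ℝ) :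
    Summable fun k : ℤ => if 0 ≤ k then Real.exp (a + b * k) else Real.exp (d + c * k) := by
  refine Summable.of_nat_of_neg_add_one ?_ ?_
  · simpa using summable_exp_nat hb a
  · have : ∀ n : ℕ, (if (0 : ℤ) ≤ -(n + 1 : ℤ) then Real.exp (a + b * ((-(n + 1 : ℤ) : ℤ) : ℝ))
        else Real.exp (d + c * ((-(n + 1 : ℤ) : ℤ) : ℝ))) = Real.exp ((d - c) + (-c) * n) := by
      intro n
      rw [if_neg (by omega)]
      congr 1; push_cast; ring
    simp only [this]
    exact summable_exp_nat (by linarith) _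

theorem summable_weight {τ : ℂ} (hτ : 0 < τ.im) (t : ℂ) : Summable fun k : ℤ =>
    ‖if 0 ≤ k then modeWeight τ t k else (modeWeight τ t k)⁻¹‖ := by
  have hp : 0 < 2 * Real.pi * τ.im := by positivity
  refine (summable_ite_exp (neg_lt_zero.2 hp) hp t.re (-t.re)).congr fun k => ?_
  split_ifs
  · rw [norm_modeWeight]; ring_nf
  · rw [norm_inv, norm_modeWeight, ← Real.exp_neg]; ring_nf

theorem summable_stateWeight {τ : ℂ} (hτ : 0 < τ.im) (t : ℂ) :
    Summable fun D => ‖stateWeight (modeWeight τ t) D‖ := by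
  simp only [stateWeight, norm_prod]
  exact summable_finsetProd_of_summable_nonneg (fun _ => norm_nonneg _) (summable_weight hτ t)

theorem norm_insertion (k : ℤ) (z : ℂ) : ‖cexp (k * z)‖ = Real.exp (k * z.re) := by
  rw [Complex.norm_exp]; simp

theorem summable_neg_exp {x : ℝ} (hx : 0 < x) :
    Summable fun k : ℤ => if 0 ≤ k then 0 else Real.exp (k * x) := by
  refine (summable_ite_exp (b := -1) (by norm_num) hx 0 0).of_nonneg_of_le
    (fun k => by split_ifs <;> positivity) fun k => ?_
  split_ifs
  · positivity
  · rw [zero_add, mul_comm]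

theorem hasSum_finite_pos (D : Finset ℤ) (x : ℝ) :
    HasSum (fun k : ℤ => if k ∈ D ∧ 0 ≤ k then Real.exp (k * x) else 0)
      (∑ k ∈ D with 0 ≤ k, Real.exp (k * x)) := by
  have := hasSum_sum_of_ne_finset_zero (L := .unconditional ℤ) (f := fun k : ℤ => if k ∈ D ∧ 0 ≤ k then
    Real.exp (k * x) else 0) (s := D.filter fun k => 0 ≤ k) fun k hk => if_neg fun h =>
      hk (mem_filter.2 h)
  rwa [sum_congr rfl fun k hk => if_pos (mem_filter.1 hk)] at this

theorem occ_le (D : Finset ℤ) (x : ℝ) (k : ℤ) : (if Occ D k then Real.exp (k * x) else 0) ≤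
    (if 0 ≤ k then 0 else Real.exp (k * x)) +
      if k ∈ D ∧ 0 ≤ k then Real.exp (k * x) else 0 := by
  have := Real.exp_pos (k * x)
  by_cases hk : 0 ≤ k
  · simp only [Occ, hk, iff_true, and_true, if_true, zero_add, le_refl]
  · simp only [hk, if_false, and_false, add_zero]
    split_ifs <;> linarith

theorem summable_occ {z : ℂ} (hz : 0 < z.re) (D : Finset ℤ) :
    Summable fun k : ℤ => if Occ D k then ‖cexp (k * z)‖ else 0 := by
  simp only [norm_insertion]
  exact ((summable_neg_exp hz).add (hasSum_finite_pos D z.re).summable).of_nonneg_of_le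
    (fun k => by split_ifs <;> positivity) (occ_le D z.re)

theorem one_add_sum_le_prod {ι : Type*} {f : ι → ℝ} (s : Finset ι) (hf : ∀ i, 0 ≤ f i) :
    1 + ∑ i ∈ s, f i ≤ ∏ i ∈ s, (1 + f i) := by
  classical
  induction s using Finset.induction_on with
  | empty => simp
  | insert a s ha ih =>
    rw [sum_insert ha, prod_insert ha]
    nlinarith [hf a, sum_nonneg fun i (_ : i ∈ s) => hf i, mul_le_mul_of_nonneg_left ih (hf a)]

/-- Bounds an insertion by a product over modes, so that summability over all states reduces to
summability over single modes. The constant absorbs the Dirac sea, which is summable since `0 <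
z.re`. -/
theorem exists_tsum_occ_le {z : ℂ} (hz : 0 < z.re) : ∃ C : ℝ, 0 ≤ C ∧ ∀ D : Finset ℤ,
    (∑' k : ℤ, if Occ D k then ‖cexp (k * z)‖ else 0) ≤
      C * ∏ k ∈ D with 0 ≤ k, (1 + Real.exp (k * z.re)) := by
  have h0 : 0 ≤ ∑' k : ℤ, if 0 ≤ k then 0 else Real.exp (k * z.re) :=
    tsum_nonneg fun k => by split_ifs <;> positivity
  refine ⟨(∑' k : ℤ, if 0 ≤ k then 0 else Real.exp (k * z.re)) + 1, by linarith, fun D => ?_⟩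
  have h1 := (summable_occ hz D).tsum_le_tsum (g := fun k : ℤ =>
    (if 0 ≤ k then 0 else Real.exp (k * z.re)) +
      if k ∈ D ∧ 0 ≤ k then Real.exp (k * z.re) else 0)
    (fun k => by simp only [norm_insertion]; exact occ_le D z.re k)
    ((summable_neg_exp hz).add (hasSum_finite_pos D z.re).summable)
  rw [(summable_neg_exp hz).tsum_add (hasSum_finite_pos D z.re).summable,
    (hasSum_finite_pos D z.re).tsum_eq] at h1
  have h2 : 1 + ∑ k ∈ D with 0 ≤ k, Real.exp (k * z.re) ≤
      ∏ k ∈ D with 0 ≤ k, (1 + Real.exp (k * z.re)) :=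
    one_add_sum_le_prod _ fun k => (Real.exp_pos _).le
  have h3 : 0 ≤ ∑ k ∈ D with 0 ≤ k, Real.exp (k * z.re) :=
    sum_nonneg fun k _ => (Real.exp_pos _).le
  nlinarith

/-- The majorant factors as `∏ k ∈ D, v k`. For `k ≥ 0` each insertion costs at most `2 e^{k Re
z_i}`, which gives the `n log 2`, and the growth `e^{kY}` is beaten by `|q|^k` because `Y < 2π Im
τ`. -/
theorem summable_stateWeight_mul {τ : ℂ} (hτ : 0 < τ.im) (t : ℂ) {n : ℕ} {z : Fin n → ℂ}
    (hz : z ∈ traceDomain n τ) (s : Finset (Fin n)) :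
    Summable fun D => ‖stateWeight (modeWeight τ t) D‖ *
      ∏ i ∈ s, ∑' k : ℤ, if Occ D k then ‖cexp (k * z i)‖ else 0 := by
  choose C hC0 hC using fun i => exists_tsum_occ_le (hz.1 i)
  have hp : 0 < 2 * Real.pi * τ.im := by positivity
  set Y : ℝ := ∑ i, (z i).re with hY
  have hYlt : Y < 2 * Real.pi * τ.im := by rw [hY, ← Complex.re_sum]; exact hz.2
  set v : ℤ → ℝ := fun k => if 0 ≤ k then
    Real.exp (t.re + n * Real.log 2 + (Y - 2 * Real.pi * τ.im) * k) else
      Real.exp (-t.re + 2 * Real.pi * τ.im * k) with hv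
  have hvs : Summable v := summable_ite_exp (by linarith) hp _ _
  have hv0 : ∀ k, 0 ≤ v k := fun k => by simp only [hv]; split_ifs <;> positivity
  have hsum := (summable_finsetProd_of_summable_nonneg hv0 hvs).mul_left (∏ i ∈ s, C i)
  have hT0 : ∀ i D, 0 ≤ ∑' k : ℤ, if Occ D k then ‖cexp (k * z i)‖ else 0 := fun i D =>
    tsum_nonneg fun k => by split_ifs <;> positivity
  refine hsum.of_nonneg_of_le (fun D => mul_nonneg (norm_nonneg _)
    (prod_nonneg fun i _ => hT0 i D)) fun D => ?_
  have h1 : ∏ i ∈ s, (∑' k : ℤ, if Occ D k then ‖cexp (k * z i)‖ else 0) ≤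
      (∏ i ∈ s, C i) * ∏ k ∈ D, if 0 ≤ k then Real.exp (n * Real.log 2 + Y * k) else 1 := by
    refine (prod_le_prod (fun i _ => hT0 i D) fun i _ => hC i D).trans ?_
    rw [prod_mul_distrib, prod_comm, ← prod_filter]
    refine mul_le_mul_of_nonneg_left (prod_le_prod (fun k _ => prod_nonneg fun i _ => by positivity)
      fun k hk => ?_) (prod_nonneg fun i _ => hC0 i)
    have hk0 : 0 ≤ k := (mem_filter.1 hk).2
    have hk' : (0 : ℝ) ≤ k := by exact_mod_cast hk0
    calc ∏ i ∈ s, (1 + Real.exp (k * (z i).re)) ≤ ∏ i, (1 + Real.exp (k * (z i).re)) :=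
          prod_le_prod_of_subset_of_one_le (subset_univ s) (fun i _ => by positivity)
            fun i _ _ => by linarith [Real.exp_pos (k * (z i).re)]
      _ ≤ ∏ i : Fin n, (Real.exp (Real.log 2 + k * (z i).re)) := by
          refine prod_le_prod (fun i _ => by positivity) fun i _ => ?_
          rw [Real.exp_add, Real.exp_log (by norm_num)]
          have : 1 ≤ Real.exp (k * (z i).re) :=
            Real.one_le_exp (mul_nonneg hk' (hz.1 i).le)
          linarith
      _ = Real.exp (n * Real.log 2 + Y * k) := by
          rw [← Real.exp_sum, sum_add_distrib, ← mul_sum]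
          simp [mul_comm, hY]
  calc _ ≤ ‖stateWeight (modeWeight τ t) D‖ * ((∏ i ∈ s, C i) *
        ∏ k ∈ D, if 0 ≤ k then Real.exp (n * Real.log 2 + Y * k) else 1) :=
        mul_le_mul_of_nonneg_left h1 (norm_nonneg _)
    _ = (∏ i ∈ s, C i) * ∏ k ∈ D, v k := by
        rw [mul_left_comm, stateWeight, norm_prod, ← prod_mul_distrib]
        congr 1
        refine prod_congr rfl fun k _ => ?_
        simp only [hv]
        split_ifs
        · rw [norm_modeWeight, ← Real.exp_add]; ring_nf
        · rw [norm_inv, norm_modeWeight, ← Real.exp_neg, mul_one]; ring_nf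

end Summability

/-! ### The full trace, sorted by charge. -/

/-- The theta series `∑_c (-1)^c q^{c(c-1)/2} e^{cu}`. -/
def chargeTheta (τ u : ℂ) : ℂ :=
  ∑' c : ℤ, cexp ((u + Real.pi * I) * c + 2 * Real.pi * I * τ * (c * (c - 1) / 2))

/-- Substitute `m = c - 1` and use `(c - 1/2)² = c(c - 1) + 1/4`. -/
theorem thetaSeries_eq_chargeTheta (τ u : ℂ) : thetaSeries τ u =
    cexp (-(Real.pi * I / 2) + Real.pi * I * τ / 4 - u / 2) * chargeTheta τ u := by
  rw [thetaSeries, chargeTheta, ← tsum_mul_left, ← (Equiv.subRight (1 : ℤ)).tsum_eq]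
  refine tsum_congr fun c => ?_
  rw [← Complex.exp_add, ← Complex.exp_add, ← Complex.exp_add]
  congr 1
  simp only [Equiv.subRight_apply]; push_cast; ring

/-- The generating function of all partitions. -/
def partitionGF (τ : ℂ) : ℂ := ∑' μ : YoungDiagram, nome τ ^ μ.card

theorem norm_nome_lt_one {τ : ℂ} (hτ : 0 < τ.im) : ‖nome τ‖ < 1 := by
  rw [nome, Complex.norm_exp, Real.exp_lt_one_iff]
  have : 0 < 2 * Real.pi * τ.im := by positivity
  simpa [mul_re, mul_im] using this

theorem stateWeight_stateEquiv (τ t : ℂ) (p : ℤ × YoungDiagram) :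
    stateWeight (modeWeight τ t) (stateEquiv p) =
      cexp ((t + Real.pi * I) * p.1 + 2 * Real.pi * I * τ * (p.1 * (p.1 - 1) / 2)) *
        nome τ ^ p.2.card := by
  have := stateWeight_stateOf (t + Real.pi * I) (2 * Real.pi * I * τ) p
  change stateWeight (fun k => cexp (t + Real.pi * I + 2 * Real.pi * I * τ * k)) (stateOf p) = _
  rw [this, nome, ← Complex.exp_nat_mul, ← Complex.exp_add]
  congr 1; ring

/-- The partitions are the charge zero slice of the summable family of all states, at `t = 0`. -/
theorem summable_nome_pow_card {τ : ℂ} (hτ : 0 < τ.im) :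
    Summable fun μ : YoungDiagram => ‖nome τ ^ μ.card‖ := by
  have h := (stateEquiv.summable_iff.2 (summable_stateWeight hτ 0)).comp_injective
    (i := fun μ : YoungDiagram => ((0 : ℤ), μ)) (fun a b h => congrArg Prod.snd h)
  refine h.congr fun μ => ?_
  simp only [Function.comp]
  rw [stateWeight_stateEquiv]; simp

theorem partitionGF_mul_eulerQ {τ : ℂ} (hτ : 0 < τ.im) : partitionGF τ * eulerQ τ = 1 :=
  tsum_pow_card_mul_tprod (summable_nome_pow_card hτ) (norm_nome_lt_one hτ)

theorem partitionGF_ne_zero {τ : ℂ} (hτ : 0 < τ.im) : partitionGF τ ≠ 0 :=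
  left_ne_zero_of_mul_eq_one (partitionGF_mul_eulerQ hτ)

theorem tsum_state_eq {f : Finset ℤ → ℂ} (hf : Summable f) :
    ∑' D, f D = ∑' c : ℤ, ∑' μ : YoungDiagram, f (stateEquiv (c, μ)) := by
  rw [← stateEquiv.tsum_eq]
  exact (stateEquiv.summable_iff.2 hf).tsum_prod

theorem tsum_stateWeight_modeWeight {τ : ℂ} (hτ : 0 < τ.im) (t : ℂ) :
    ∑' D, stateWeight (modeWeight τ t) D = chargeTheta τ t * partitionGF τ := by
  rw [tsum_state_eq (summable_stateWeight hτ t).of_norm, chargeTheta, ← tsum_mul_right]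
  refine tsum_congr fun c => ?_
  rw [partitionGF, ← tsum_mul_left]
  exact tsum_congr fun μ => stateWeight_stateEquiv τ t (c, μ)

theorem norm_occSum_le {z : ℂ} (hz : 0 < z.re) (D : Finset ℤ) :
    ‖occSum (fun k => cexp (k * z)) D‖ ≤ ∑' k : ℤ, if Occ D k then ‖cexp (k * z)‖ else 0 := by
  refine (norm_tsum_le_tsum_norm ((summable_occ hz D).congr fun k => by
    split_ifs <;> simp)).trans_eq ?_
  exact tsum_congr fun k => by split_ifs <;> simp

theorem occSum_stateEquiv (z : ℂ) (p : ℤ × YoungDiagram) :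
    occSum (fun k => cexp (k * z)) (stateEquiv p) = cexp ((p.1 - 1 / 2) * z) * charE z p.2 := by
  have h1 : occSum (fun k => cexp (k * z)) (stateEquiv p) =
      cexp (-z / 2) * occSum (fun k => cexp ((k + 1 / 2) * z)) (stateOf p) := by
    rw [occSum, occSum, ← tsum_mul_left]
    refine tsum_congr fun k => ?_
    change (if Occ (stateOf p) k then _ else _) = _
    rw [mul_ite, mul_zero, ← Complex.exp_add]
    ring_nf
  rw [h1, occSum_stateOf, ← mul_assoc, ← Complex.exp_add]
  ring_nf

/-- The trace over the whole semi-infinite wedge in terms of the trace over charge zero. -/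
theorem tsum_stateWeight_mul_occSum {τ : ℂ} (hτ : 0 < τ.im) (t : ℂ) {n : ℕ} {z : Fin n → ℂ}
    (hz : z ∈ traceDomain n τ) :
    ∑' D, stateWeight (modeWeight τ t) D * ∏ i, occSum (fun k => cexp (k * z i)) D =
      cexp (-(∑ i, z i) / 2) * chargeTheta τ (t + ∑ i, z i) * nPoint τ z := by
  have hs : Summable fun D => stateWeight (modeWeight τ t) D *
      ∏ i, occSum (fun k => cexp (k * z i)) D := by
    refine (summable_stateWeight_mul hτ t hz univ).of_norm_bounded fun D => ?_
    rw [norm_mul, norm_prod]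
    exact mul_le_mul_of_nonneg_left (prod_le_prod (fun _ _ => norm_nonneg _)
      fun i _ => norm_occSum_le (hz.1 i) D) (norm_nonneg _)
  rw [tsum_state_eq hs, chargeTheta, ← tsum_mul_left, ← tsum_mul_right]
  refine tsum_congr fun c => ?_
  rw [nPoint, ← tsum_mul_left]
  refine tsum_congr fun μ => ?_
  rw [stateWeight_stateEquiv]
  simp only [occSum_stateEquiv]
  rw [prod_mul_distrib, ← Complex.exp_sum, ← mul_sum]
  have : cexp (-(∑ i, z i) / 2) * cexp ((t + ∑ i, z i + Real.pi * I) * c +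
      2 * Real.pi * I * τ * (c * (c - 1) / 2)) =
      cexp ((t + Real.pi * I) * c + 2 * Real.pi * I * τ * (c * (c - 1) / 2)) *
        cexp ((c - 1 / 2) * ∑ i, z i) := by
    rw [← Complex.exp_add, ← Complex.exp_add]; ring_nf
  linear_combination (-(nome τ ^ μ.card) * ∏ i, charE (z i) μ) * this

/-! ### Zeros and quasi-periods of the theta series. -/

section ThetaSeries

theorem thetaSeries_eq_jacobiTheta₂ (τ z : ℂ) : thetaSeries τ z =
    cexp (Real.pi * I / 2 + Real.pi * I * τ / 4 + z / 2) *
      jacobiTheta₂ (z / (2 * Real.pi * I) + 1 / 2 + τ / 2) τ := by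
  rw [thetaSeries, jacobiTheta₂, ← tsum_mul_left]
  refine tsum_congr fun m => ?_
  rw [jacobiTheta₂_term, ← Complex.exp_add, ← Complex.exp_add, ← Complex.exp_add]
  congr 1
  have := Complex.two_pi_I_ne_zero
  field_simp
  ring

theorem differentiable_thetaSeries {τ : ℂ} (hτ : 0 < τ.im) : Differentiable ℂ (thetaSeries τ) := by
  have h : thetaSeries τ = fun z => cexp (Real.pi * I / 2 + Real.pi * I * τ / 4 + z / 2) *
      jacobiTheta₂ (z / (2 * Real.pi * I) + 1 / 2 + τ / 2) τ :=
    funext (thetaSeries_eq_jacobiTheta₂ τ)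
  rw [h]
  intro z
  have h1 := (differentiableAt_jacobiTheta₂_fst (z / (2 * Real.pi * I) + 1 / 2 + τ / 2) hτ)
  have h2 : DifferentiableAt ℂ (fun z : ℂ => z / (2 * Real.pi * I) + 1 / 2 + τ / 2) z := by fun_prop
  have h3 := h1.comp z h2
  exact DifferentiableAt.mul (by fun_prop) h3

/-- The Jacobi triple product: summing over all sets of excited modes expands the infinite product,
and sorting the same states by charge gives theta times the partition function. -/
theorem chargeTheta_mul_partitionGF {τ : ℂ} (hτ : 0 < τ.im) (t : ℂ) :
    chargeTheta τ t * partitionGF τ =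
      ∏' k : ℤ, (1 + if 0 ≤ k then modeWeight τ t k else (modeWeight τ t k)⁻¹) := by
  rw [← tsum_stateWeight_modeWeight hτ t,
    tprod_one_add (summable_finsetProd_of_summable_norm (summable_weight hτ t))]
  rfl

/-- An absolutely convergent product vanishes only if a factor does, and the factor of the mode `k`
vanishes exactly when `e^t q^k = 1`. -/
theorem chargeTheta_eq_zero_iff {τ : ℂ} (hτ : 0 < τ.im) (t : ℂ) :
    chargeTheta τ t = 0 ↔ t ∈ Lat τ := by
  have h2 : chargeTheta τ t = 0 ↔ chargeTheta τ t * partitionGF τ = 0 := by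
    simp [partitionGF_ne_zero hτ]
  rw [h2, chargeTheta_mul_partitionGF hτ]
  constructor
  · intro h
    by_contra ht
    refine tprod_one_add_ne_zero_of_summable (fun k => ?_) (summable_weight hτ t) h
    have hk := one_add_modeWeight_ne_zero ht k
    split_ifs
    · exact hk
    · have h0 := modeWeight_ne_zero τ t k
      intro h
      apply hk
      field_simp at h
      linear_combination h
  · rintro ⟨a, b, rfl⟩
    refine tprod_of_exists_eq_zero ⟨-b, ?_⟩
    have : modeWeight τ (2 * Real.pi * I * a + 2 * Real.pi * I * τ * b) (-b) = -1 := by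
      rw [modeWeight_eq, neg_inj, Complex.exp_eq_one_iff]
      exact ⟨a, by push_cast; ring⟩
    rw [this]; norm_num

theorem thetaSeries_eq_zero_iff {τ : ℂ} (hτ : 0 < τ.im) (t : ℂ) :
    thetaSeries τ t = 0 ↔ t ∈ Lat τ := by
  rw [thetaSeries_eq_chargeTheta, mul_eq_zero, chargeTheta_eq_zero_iff hτ]
  simp [Complex.exp_ne_zero]

theorem zero_mem_Lat (τ : ℂ) : (0 : ℂ) ∈ Lat τ := ⟨0, 0, by simp⟩

theorem thetaSeries_zero {τ : ℂ} (hτ : 0 < τ.im) : thetaSeries τ 0 = 0 :=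
  (thetaSeries_eq_zero_iff hτ 0).2 (zero_mem_Lat τ)

theorem isOpen_compl_Lat {τ : ℂ} (hτ : 0 < τ.im) : IsOpen (Lat τ)ᶜ := by
  have : (Lat τ)ᶜ = {t | thetaSeries τ t ≠ 0} := by
    ext t; exact (thetaSeries_eq_zero_iff hτ t).not.symm
  rw [this]
  exact isOpen_ne_fun (differentiable_thetaSeries hτ).continuous continuous_const

theorem thetaSeries_add_period (τ z : ℂ) (a b : ℤ) :
    thetaSeries τ (z + (2 * Real.pi * I * a + 2 * Real.pi * I * τ * b)) =
      cexp (Real.pi * I * a - Real.pi * I * b - Real.pi * I * τ * b ^ 2 - b * z) *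
        thetaSeries τ z := by
  rw [thetaSeries, thetaSeries, ← tsum_mul_left]
  conv_rhs => rw [← (Equiv.addRight b).tsum_eq]
  refine tsum_congr fun m => ?_
  rw [← Complex.exp_add, ← Complex.exp_add, ← Complex.exp_add, ← Complex.exp_add,
    ← Complex.exp_add, Complex.exp_eq_exp_iff_exists_int]
  refine ⟨a * m, ?_⟩
  simp only [Equiv.coe_addRight]; push_cast; ring

end ThetaSeries

/-! ### The Kronecker series as cumulant of an insertion. -/

section Kronecker

/-- Termwise iterated differentiation of a locally uniformly convergent series of holomorphic
functions. -/
theorem hasSum_iteratedDeriv {ι : Type*} {F : ι → ℂ → ℂ} {f : ℂ → ℂ} {U : Set ℂ} (hU : IsOpen U)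
    (hF : ∀ i, DifferentiableOn ℂ (F i) U)
    (h : TendstoLocallyUniformlyOn (fun (s : Finset ι) t => ∑ i ∈ s, F i t) f Filter.atTop U)
    (l : ℕ) {t : ℂ} (ht : t ∈ U) :
    HasSum (fun i => iteratedDeriv l (F i) t) (iteratedDeriv l f t) := by
  have hd : ∀ (l : ℕ) (i : ι), DifferentiableOn ℂ (iteratedDeriv l (F i)) U := by
    intro l i
    induction l with
    | zero => simpa using hF i
    | succ l ih => rw [iteratedDeriv_succ]; exact ih.deriv hU
  have key : TendstoLocallyUniformlyOn (fun (s : Finset ι) t => ∑ i ∈ s, iteratedDeriv l (F i) t)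
      (iteratedDeriv l f) Filter.atTop U := by
    induction l with
    | zero => simpa using h
    | succ l ih =>
      have := ih.deriv (Filter.Eventually.of_forall fun s =>
        DifferentiableOn.fun_sum fun i _ => hd l i) hU
      rw [← iteratedDeriv_succ] at this
      refine this.congr fun s t ht => ?_
      simp only [Function.comp]
      rw [deriv_fun_sum fun i _ => (hd l i).differentiableAt (hU.mem_nhds ht)]
      simp only [iteratedDeriv_succ]
  exact key.tendsto_at ht

/-- The occupation number `x / (1 + x)` of a mode of weight `x = -e^t q^k`. -/
def modeOcc (τ : ℂ) (k : ℤ) (t : ℂ) : ℂ := modeWeight τ t k / (1 + modeWeight τ t k)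

/-- The Kronecker series `∑_k e^{kz} x_k / (1 + x_k)`, where `x_k = -e^t q^k`. -/
def kron (τ z t : ℂ) : ℂ := ∑' k : ℤ, cexp (k * z) * modeOcc τ k t

theorem differentiable_modeWeight (τ : ℂ) (k : ℤ) : Differentiable ℂ fun t => modeWeight τ t k := by
  unfold modeWeight; fun_prop

theorem deriv_modeWeight (τ : ℂ) (k : ℤ) :
    deriv (fun t => modeWeight τ t k) = fun t => modeWeight τ t k := by
  funext t
  have : HasDerivAt (fun t => modeWeight τ t k) (modeWeight τ t k * 1) t := by
    unfold modeWeight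
    exact ((((hasDerivAt_id t).add_const _).add_const _)).cexp
  simpa using this.deriv

theorem iteratedDeriv_modeWeight (τ : ℂ) (k : ℤ) (l : ℕ) :
    iteratedDeriv l (fun t => modeWeight τ t k) = fun t => modeWeight τ t k := by
  induction l with
  | zero => simp
  | succ l ih => rw [iteratedDeriv_succ, ih, deriv_modeWeight]

theorem differentiableAt_modeOcc {τ : ℂ} {k : ℤ} {t : ℂ} (h : 1 + modeWeight τ t k ≠ 0) :
    DifferentiableAt ℂ (modeOcc τ k) t :=
  (differentiable_modeWeight τ k t).div ((differentiable_modeWeight τ k t).const_add 1) h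

/-- The occupation number `p` satisfies `p + x p = x`. Differentiating `l` times in `t`, where `x`
is its own derivative, gives this relation by Leibniz. It identifies the coefficients `c` of the
cumulant formula as derivatives of `p`. -/
theorem iteratedDeriv_modeOcc_rec {τ : ℂ} (hτ : 0 < τ.im) {t : ℂ} (ht : t ∉ Lat τ) (k : ℤ)
    (l : ℕ) :
    iteratedDeriv l (modeOcc τ k) t + modeWeight τ t k *
      ∑ j ∈ range (l + 1), (l.choose j : ℂ) * iteratedDeriv j (modeOcc τ k) t =
      modeWeight τ t k := by
  have hU := isOpen_compl_Lat hτ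
  have hxd := differentiable_modeWeight τ k
  have hp : ContDiffAt ℂ l (modeOcc τ k) t := by
    have : DifferentiableOn ℂ (modeOcc τ k) (Lat τ)ᶜ := fun s hs =>
      (differentiableAt_modeOcc (one_add_modeWeight_ne_zero hs k)).differentiableWithinAt
    exact (this.contDiffOn hU).contDiffAt (hU.mem_nhds ht)
  have hev : modeOcc τ k + (fun t => modeWeight τ t k) * (modeOcc τ k)
      =ᶠ[nhds t] fun t => modeWeight τ t k := by
    filter_upwards [hU.mem_nhds ht] with s hs
    have := one_add_modeWeight_ne_zero hs k
    simp only [Pi.add_apply, Pi.mul_apply, modeOcc]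
    field_simp
  have h1 := hev.iteratedDeriv_eq l
  have hx : ContDiffAt ℂ l (fun t => modeWeight τ t k) t := hxd.contDiff.contDiffAt
  have hxp : ContDiffAt ℂ l ((fun t => modeWeight τ t k) * modeOcc τ k) t := hx.mul hp
  rw [iteratedDeriv_add hp hxp, iteratedDeriv_mul hx hp] at h1
  simp only [iteratedDeriv_modeWeight] at h1
  conv_rhs => rw [← h1]
  congr 1
  rw [mul_sum, ← sum_range_reflect]
  refine sum_congr rfl fun j hj => ?_
  have hj' : j ≤ l := Nat.lt_succ_iff.1 (mem_range.1 hj)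
  rw [show l + 1 - 1 - j = l - j by omega, Nat.choose_symm hj']
  ring

/-- Far up `|x_k| ≤ 1/2`, so the occupation number is at most `2|x_k|`; far down `|x_k| ≥ 2`, so it
is at most `2`. The finitely many modes in between may have poles near `t₀`, hence the cofinite
filter. -/
theorem eventually_norm_kron_term_le {τ : ℂ} {z : ℂ} (t₀ : ℂ) (hτ : 0 < τ.im) :
    ∀ᶠ k : ℤ in Filter.cofinite, ∀ t ∈ Metric.ball t₀ 1, ‖cexp (k * z) * modeOcc τ k t‖ ≤
      2 * if 0 ≤ k then Real.exp (t₀.re + 1 + (z.re - 2 * Real.pi * τ.im) * k)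
        else Real.exp (0 + z.re * k) := by
  have hp : 0 < 2 * Real.pi * τ.im := by positivity
  have hre : ∀ t ∈ Metric.ball t₀ 1, |t.re - t₀.re| < 1 := fun t ht => by
    rw [← sub_re]
    exact (abs_re_le_norm _).trans_lt (by rwa [Metric.mem_ball, dist_eq_norm] at ht)
  have hl2 : 0 < Real.log 2 := Real.log_pos (by norm_num)
  rw [Int.cofinite_eq, Filter.eventually_sup]
  constructor
  · obtain ⟨K, hK⟩ := exists_nat_gt ((1 - t₀.re + Real.log 2) / (2 * Real.pi * τ.im))
    rw [div_lt_iff₀ hp] at hK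
    filter_upwards [Filter.eventually_le_atBot (-(K : ℤ) - 1)] with k hk t ht
    have hk' : (k : ℝ) ≤ -K := by
      have : (k : ℝ) ≤ ((-(K : ℤ) - 1 : ℤ) : ℝ) := by exact_mod_cast hk
      push_cast at this; linarith
    rw [if_neg (by omega), norm_mul, norm_insertion, zero_add, mul_comm z.re, mul_comm 2]
    refine mul_le_mul_of_nonneg_left ?_ (Real.exp_pos _).le
    have hx : 2 ≤ ‖modeWeight τ t k‖ := by
      have h2 := abs_lt.1 (hre t ht)
      refine (Real.exp_log (show (0 : ℝ) < 2 by norm_num)).symm.le.trans ?_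
      rw [norm_modeWeight, Real.exp_le_exp]
      nlinarith
    have h1 : ‖modeWeight τ t k‖ - 1 ≤ ‖1 + modeWeight τ t k‖ := by
      have := norm_sub_norm_le (modeWeight τ t k) (-1)
      rw [norm_neg, norm_one, sub_neg_eq_add, add_comm (modeWeight τ t k)] at this
      exact this
    rw [modeOcc, norm_div, div_le_iff₀ (by linarith)]
    linarith
  · obtain ⟨K, hK⟩ := exists_nat_gt ((t₀.re + 1 + Real.log 2) / (2 * Real.pi * τ.im))
    rw [div_lt_iff₀ hp] at hK
    filter_upwards [Filter.eventually_ge_atTop (K : ℤ)] with k hk t ht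
    have hk' : (K : ℝ) ≤ k := by exact_mod_cast hk
    rw [if_pos (by omega), norm_mul, norm_insertion]
    have h2 := abs_lt.1 (hre t ht)
    have hx : ‖modeWeight τ t k‖ ≤ 1 / 2 := by
      rw [norm_modeWeight, show (1 : ℝ) / 2 = Real.exp (-Real.log 2) by
        rw [Real.exp_neg, Real.exp_log (by norm_num)]; norm_num, Real.exp_le_exp]
      nlinarith
    have hx' : ‖modeWeight τ t k‖ ≤ Real.exp (t₀.re + 1 - 2 * Real.pi * τ.im * k) := by
      rw [norm_modeWeight, Real.exp_le_exp]; linarith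
    have h1 : 1 - ‖modeWeight τ t k‖ ≤ ‖1 + modeWeight τ t k‖ := by
      have := norm_sub_norm_le 1 (-modeWeight τ t k)
      rwa [norm_neg, norm_one, sub_neg_eq_add] at this
    have h3 : ‖modeOcc τ k t‖ ≤ 2 * Real.exp (t₀.re + 1 - 2 * Real.pi * τ.im * k) := by
      rw [modeOcc, norm_div, div_le_iff₀ (by linarith)]
      nlinarith [norm_nonneg (modeWeight τ t k), Real.exp_pos (t₀.re + 1 - 2 * Real.pi * τ.im * k)]
    calc _ ≤ Real.exp (k * z.re) * (2 * Real.exp (t₀.re + 1 - 2 * Real.pi * τ.im * k)) :=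
          mul_le_mul_of_nonneg_left h3 (Real.exp_pos _).le
      _ = _ := by rw [mul_left_comm, ← Real.exp_add]; ring_nf

theorem summable_kron_bound {τ z : ℂ} (hz : 0 < z.re) (hz' : z.re < 2 * Real.pi * τ.im)
    (t₀ : ℂ) : Summable fun k : ℤ => 2 * if 0 ≤ k then
      Real.exp (t₀.re + 1 + (z.re - 2 * Real.pi * τ.im) * k) else Real.exp (0 + z.re * k) :=
  (summable_ite_exp (by linarith) hz _ _).mul_left 2

theorem hasSum_iteratedDeriv_kron {τ z : ℂ} (hτ : 0 < τ.im) (hz : 0 < z.re)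
    (hz' : z.re < 2 * Real.pi * τ.im) {t : ℂ} (ht : t ∉ Lat τ) (l : ℕ) :
    HasSum (fun k : ℤ => cexp (k * z) * iteratedDeriv l (modeOcc τ k) t)
      (iteratedDeriv l (kron τ z) t) := by
  have hU : IsOpen (Metric.ball t 1 ∩ (Lat τ)ᶜ) := Metric.isOpen_ball.inter (isOpen_compl_Lat hτ)
  have hunif := tendstoUniformlyOn_tsum_of_cofinite_eventually (summable_kron_bound hz hz' t)
    (eventually_norm_kron_term_le t hτ)
  have h := hasSum_iteratedDeriv hU (F := fun (k : ℤ) t => cexp (k * z) * modeOcc τ k t)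
    (fun k s hs => ((differentiableAt_modeOcc
      (one_add_modeWeight_ne_zero hs.2 k)).const_mul _).differentiableWithinAt)
    (hunif.mono Set.inter_subset_left).tendstoLocallyUniformlyOn l
    ⟨Metric.mem_ball_self one_pos, ht⟩
  simp only [iteratedDeriv_const_mul_field] at h
  exact h

theorem re_sum_pos_lt {τ : ℂ} {n : ℕ} {z : Fin n → ℂ} (hz : z ∈ traceDomain n τ)
    {s : Finset (Fin n)} (hs : s.Nonempty) :
    0 < (∑ i ∈ s, z i).re ∧ (∑ i ∈ s, z i).re < 2 * Real.pi * τ.im := by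
  have h2 := hz.2
  rw [Complex.re_sum] at h2 ⊢
  exact ⟨sum_pos (fun i _ => hz.1 i) hs, (sum_le_sum_of_subset_of_nonneg (subset_univ s)
    fun i _ _ => (hz.1 i).le).trans_lt h2⟩

/-- The `n`-point function in terms of sums over set partitions of derivatives of Kronecker
series. -/
theorem thetaSeries_mul_nPoint {τ : ℂ} (hτ : 0 < τ.im) {t : ℂ} (ht : t ∉ Lat τ) {n : ℕ}
    {z : Fin n → ℂ} (hz : z ∈ traceDomain n τ) :
    thetaSeries τ (t + ∑ i, z i) * nPoint τ z = thetaSeries τ t * partitionGF τ *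
      partSum (fun b => iteratedDeriv (b.card - 1) (kron τ (∑ i ∈ b, z i)) t) univ := by
  have hprod : ∀ (k : ℤ) (s : Finset (Fin n)),
      ∏ i ∈ s, cexp (k * z i) = cexp (k * ∑ i ∈ s, z i) := fun k s => by
    rw [mul_sum, Complex.exp_sum]
  have h := tsum_stateWeight_eq_partSum (modeWeight τ t) (modeWeight_ne_zero τ t)
    (fun (i : Fin n) k => cexp (k * z i)) (fun k l => iteratedDeriv l (modeOcc τ k) t)
    (iteratedDeriv_modeOcc_rec hτ ht) (fun i D => summable_occ (hz.1 i) D)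
    (summable_stateWeight_mul hτ t hz)
    (fun s hs => by
      simp only [hprod]
      obtain ⟨h1, h2⟩ := re_sum_pos_lt hz hs
      exact (hasSum_iteratedDeriv_kron hτ h1 h2 ht _).summable) univ
  rw [tsum_stateWeight_mul_occSum hτ t hz, tsum_stateWeight_modeWeight hτ t,
    partSum_congr (g := fun b => iteratedDeriv (b.card - 1) (kron τ (∑ i ∈ b, z i)) t)
      fun b _ hb => by
        simp only [hprod]
        obtain ⟨h1, h2⟩ := re_sum_pos_lt hz hb
        exact (hasSum_iteratedDeriv_kron hτ h1 h2 ht _).tsum_eq] at h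
  rw [thetaSeries_eq_chargeTheta, thetaSeries_eq_chargeTheta]
  have he : cexp (-(Real.pi * I / 2) + Real.pi * I * τ / 4 - (t + ∑ i, z i) / 2) =
      cexp (-(Real.pi * I / 2) + Real.pi * I * τ / 4 - t / 2) * cexp (-(∑ i, z i) / 2) := by
    rw [← Complex.exp_add]; ring_nf
  rw [he]
  linear_combination cexp (-(Real.pi * I / 2) + Real.pi * I * τ / 4 - t / 2) * h

end Kronecker

/-! ### The limit at `t = 0` and the one-point function. -/

section Residue

theorem re_of_mem_Lat {τ t : ℂ} (ht : t ∈ Lat τ) : ∃ b : ℤ, t.re = 2 * Real.pi * τ.im * b := by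
  obtain ⟨a, b, rfl⟩ := ht
  refine ⟨-b, ?_⟩
  simp [mul_re, mul_im]

theorem notMem_Lat_of_re {τ z : ℂ} (hz : 0 < z.re) (hz' : z.re < 2 * Real.pi * τ.im) :
    z ∉ Lat τ := fun h => by
  obtain ⟨b, hb⟩ := re_of_mem_Lat h
  have hp : 0 < 2 * Real.pi * τ.im := hz.trans hz'
  rw [hb] at hz hz'
  have h1 : (0 : ℝ) < b := by
    by_contra h; push Not at h; nlinarith
  have h2 : (b : ℝ) < 1 := by
    by_contra h; push Not at h; nlinarith
  have h3 : (0 : ℤ) < b := by exact_mod_cast h1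
  have h4 : b < (1 : ℤ) := by exact_mod_cast h2
  omega

theorem int_eq_zero_of_mul {c : ℝ} {b : ℤ} (hc : 0 < c) (h : |c * b| < c) : b = 0 := by
  rw [abs_mul, abs_of_pos hc] at h
  have h1 : |(b : ℝ)| < 1 := by
    by_contra h'; push Not at h'; nlinarith
  exact Int.abs_lt_one_iff.1 (by exact_mod_cast h1)

theorem eq_zero_of_mem_Lat {τ t : ℂ} (hτ : 0 < τ.im) (ht : t ∈ Lat τ)
    (h : t ∈ Metric.ball (0 : ℂ) (min 1 (2 * Real.pi * τ.im))) : t = 0 := by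
  have hp : 0 < 2 * Real.pi * τ.im := by positivity
  rw [mem_ball_zero_iff, lt_min_iff] at h
  obtain ⟨a, b, rfl⟩ := ht
  have hre := (abs_re_le_norm _).trans_lt h.2
  have him := (abs_im_le_norm _).trans_lt h.1
  have hb : b = 0 := by
    refine int_eq_zero_of_mul hp ?_
    simpa [mul_re, mul_im, abs_mul] using hre
  subst hb
  have ha : a = 0 := by
    refine int_eq_zero_of_mul Real.two_pi_pos (lt_trans ?_ (by linarith [Real.pi_gt_three] :
      (1 : ℝ) < 2 * Real.pi))
    simpa [mul_re, mul_im, abs_mul] using him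
  subst ha
  simp

theorem eventually_notMem_Lat {τ : ℂ} (hτ : 0 < τ.im) :
    ∀ᶠ t in nhdsWithin (0 : ℂ) {0}ᶜ, t ∉ Lat τ := by
  have hp : 0 < min 1 (2 * Real.pi * τ.im) := by positivity
  filter_upwards [mem_nhdsWithin_of_mem_nhds (Metric.ball_mem_nhds (0 : ℂ) hp),
    self_mem_nhdsWithin] with t h1 h2 h3
  exact h2 (eq_zero_of_mem_Lat hτ h3 h1)

theorem one_add_modeWeight_ne_zero' {τ t : ℂ} (hτ : 0 < τ.im)
    (h : t ∈ Metric.ball (0 : ℂ) (min 1 (2 * Real.pi * τ.im))) {k : ℤ} (hk : k ≠ 0) :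
    1 + modeWeight τ t k ≠ 0 := by
  intro h1
  have hp : 0 < 2 * Real.pi * τ.im := by positivity
  have h2 : ‖modeWeight τ t k‖ = 1 := by
    rw [eq_neg_of_add_eq_zero_right h1, norm_neg, norm_one]
  rw [norm_modeWeight, Real.exp_eq_one_iff, sub_eq_zero] at h2
  rw [mem_ball_zero_iff, lt_min_iff] at h
  exact hk (int_eq_zero_of_mul hp (h2 ▸ (abs_re_le_norm _).trans_lt h.2))

/-- Near `t = 0` only the mode `k = 0` has a pole, from `e^t / (e^t - 1)`. The rest `∑ k, F k` is
holomorphic on the small ball. -/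
theorem tendsto_mul_kron {τ z : ℂ} (hτ : 0 < τ.im) (hz : 0 < z.re)
    (hz' : z.re < 2 * Real.pi * τ.im) :
    Filter.Tendsto (fun t => t * kron τ z t) (nhdsWithin 0 {0}ᶜ) (nhds 1) := by
  have hp : 0 < min 1 (2 * Real.pi * τ.im) := by positivity
  set U := Metric.ball (0 : ℂ) (min 1 (2 * Real.pi * τ.im)) with hU
  have hUo : IsOpen U := Metric.isOpen_ball
  set F : ℤ → ℂ → ℂ := fun k t => if k = 0 then 0 else cexp (k * z) * modeOcc τ k t with hF
  have hle : ∀ᶠ k : ℤ in Filter.cofinite, ∀ t ∈ U, ‖F k t‖ ≤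
      2 * if 0 ≤ k then Real.exp ((0 : ℂ).re + 1 + (z.re - 2 * Real.pi * τ.im) * k)
        else Real.exp (0 + z.re * k) := by
    filter_upwards [eventually_norm_kron_term_le (z := z) 0 hτ] with k hk t ht
    have := hk t (Metric.ball_subset_ball (min_le_left _ _) ht)
    refine le_trans ?_ this
    simp only [hF]; split_ifs <;> simp
  have hd : DifferentiableOn ℂ (fun t => ∑' k, F k t) U := by
    refine (tendstoUniformlyOn_tsum_of_cofinite_eventually (summable_kron_bound hz hz' 0)
      hle).tendstoLocallyUniformlyOn.differentiableOn (Filter.Eventually.of_forall fun s =>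
        DifferentiableOn.fun_sum fun k _ t ht => ?_) hUo
    simp only [hF]
    split_ifs with hk
    · exact differentiableWithinAt_const _
    · exact ((differentiableAt_modeOcc (one_add_modeWeight_ne_zero' hτ ht hk)).const_mul
        _).differentiableWithinAt
  have hcont : Filter.Tendsto (fun t => ∑' k, F k t) (nhdsWithin 0 {0}ᶜ)
      (nhds (∑' k, F k 0)) :=
    ((hd.differentiableAt (hUo.mem_nhds (Metric.mem_ball_self hp))).continuousAt).tendsto.mono_left
      nhdsWithin_le_nhds
  have hid : Filter.Tendsto (fun t : ℂ => t) (nhdsWithin 0 {0}ᶜ) (nhds 0) :=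
    Filter.tendsto_id.mono_left nhdsWithin_le_nhds
  have hslope : Filter.Tendsto (fun t : ℂ => (cexp t - 1) / t) (nhdsWithin 0 {0}ᶜ) (nhds 1) := by
    have := (hasDerivAt_iff_tendsto_slope.1 (Complex.hasDerivAt_exp 0))
    simpa [slope_fun_def_field] using this
  have hexp : Filter.Tendsto cexp (nhdsWithin 0 {0}ᶜ) (nhds 1) := by
    have := (Complex.continuous_exp.tendsto 0).mono_left (nhdsWithin_le_nhds (s := {0}ᶜ))
    simpa using this
  have hlim := ((hexp.div hslope one_ne_zero).add (hid.mul hcont))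
  rw [div_one, zero_mul, add_zero] at hlim
  refine hlim.congr' ?_
  filter_upwards [eventually_notMem_Lat hτ, self_mem_nhdsWithin] with t ht ht0
  have ht0' : t ≠ 0 := ht0
  have hs := (hasSum_iteratedDeriv_kron hτ hz hz' ht 0)
  simp only [iteratedDeriv_zero] at hs
  have h1 : kron τ z t = modeOcc τ 0 t + ∑' k, F k t := by
    rw [kron, hs.summable.tsum_eq_add_tsum_ite 0]
    simp [hF]
  have h2 : modeOcc τ 0 t = cexp t / (cexp t - 1) := by
    rw [modeOcc, modeWeight_eq]
    have h3 := one_add_modeWeight_ne_zero ht 0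
    rw [modeWeight_eq] at h3
    simp only [Int.cast_zero, mul_zero, add_zero] at h3 ⊢
    have h4 : cexp t - 1 ≠ 0 := fun h => h3 (by linear_combination -h)
    field_simp
    ring
  have h3 : cexp t - 1 ≠ 0 := by
    intro h
    have := one_add_modeWeight_ne_zero ht 0
    rw [modeWeight_eq] at this
    simp only [Int.cast_zero, mul_zero, add_zero] at this
    exact this (by linear_combination -h)
  rw [h1, h2]
  simp only [Pi.div_apply]
  field_simp

theorem partSum_singleton {ι R : Type*} [DecidableEq ι] [CommRing R] (f : Finset ι → R) (a : ι) :
    partSum f {a} = f {a} := by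
  rw [← insert_empty_eq, partSum_insert f (notMem_empty a)]
  simp

theorem thetaSeries_mul_onePoint {τ z t : ℂ} (hτ : 0 < τ.im) (hz : 0 < z.re)
    (hz' : z.re < 2 * Real.pi * τ.im) (ht : t ∉ Lat τ) :
    thetaSeries τ (t + z) * nPoint τ (fun _ : Fin 1 => z) =
      thetaSeries τ t * partitionGF τ * kron τ z t := by
  have h := thetaSeries_mul_nPoint hτ ht (n := 1) (z := fun _ => z)
    ⟨fun _ => hz, by simpa using hz'⟩
  rw [univ_unique, partSum_singleton] at h
  simpa using h

theorem tendsto_thetaSeries_div {τ : ℂ} (hτ : 0 < τ.im) :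
    Filter.Tendsto (fun t => thetaSeries τ t / t) (nhdsWithin 0 {0}ᶜ)
      (nhds (deriv (thetaSeries τ) 0)) := by
  have := hasDerivAt_iff_tendsto_slope.1 ((differentiable_thetaSeries hτ) 0).hasDerivAt
  simpa [slope_fun_def_field, thetaSeries_zero hτ] using this

/-- Let `t → 0` in `thetaSeries_mul_onePoint`: the simple zero of theta meets the simple pole of the
Kronecker series, whose residue is `1`. -/
theorem thetaSeries_mul_onePoint_eq {τ z : ℂ} (hτ : 0 < τ.im) (hz : 0 < z.re)
    (hz' : z.re < 2 * Real.pi * τ.im) :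
    thetaSeries τ z * nPoint τ (fun _ : Fin 1 => z) =
      deriv (thetaSeries τ) 0 * partitionGF τ := by
  have h1 : Filter.Tendsto (fun t => thetaSeries τ (t + z) * nPoint τ (fun _ : Fin 1 => z))
      (nhdsWithin 0 {0}ᶜ) (nhds (thetaSeries τ z * nPoint τ (fun _ : Fin 1 => z))) := by
    have hc : Continuous fun t => thetaSeries τ (t + z) * nPoint τ (fun _ : Fin 1 => z) :=
      ((differentiable_thetaSeries hτ).continuous.comp (continuous_id.add continuous_const)).mul
        continuous_const
    simpa using (hc.tendsto 0).mono_left (nhdsWithin_le_nhds (s := {0}ᶜ))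
  have h2 := ((tendsto_thetaSeries_div hτ).mul_const (partitionGF τ)).mul
    (tendsto_mul_kron hτ hz hz')
  rw [mul_one] at h2
  refine tendsto_nhds_unique h1 (h2.congr' ?_)
  filter_upwards [eventually_notMem_Lat hτ, self_mem_nhdsWithin] with t ht ht0
  have ht0' : t ≠ 0 := ht0
  rw [thetaSeries_mul_onePoint hτ hz hz' ht]
  field_simp

/-- If the derivative vanished, so would the one-point function at some `z` of the strip, and then
the Kronecker series for all `t` off the lattice, contradicting its residue `1` at `t = 0`. -/
theorem deriv_thetaSeries_ne_zero {τ : ℂ} (hτ : 0 < τ.im) : deriv (thetaSeries τ) 0 ≠ 0 := by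
  intro h
  set z : ℂ := ((Real.pi * τ.im : ℝ) : ℂ) with hz
  have hpos : 0 < Real.pi * τ.im := by positivity
  have h1 : 0 < z.re := by simpa [hz] using hpos
  have h2 : z.re < 2 * Real.pi * τ.im := by simp only [hz, ofReal_re]; linarith
  have h3 := thetaSeries_mul_onePoint_eq hτ h1 h2
  rw [h, zero_mul, mul_eq_zero, thetaSeries_eq_zero_iff hτ] at h3
  have h4 := h3.resolve_left (notMem_Lat_of_re h1 h2)
  have h5 : Filter.Tendsto (fun t => t * kron τ z t) (nhdsWithin 0 {0}ᶜ) (nhds 0) := by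
    refine tendsto_const_nhds.congr' ?_
    filter_upwards [eventually_notMem_Lat hτ] with t ht
    have h6 := thetaSeries_mul_onePoint hτ h1 h2 ht
    rw [h4, mul_zero, eq_comm, mul_eq_zero, mul_eq_zero, thetaSeries_eq_zero_iff hτ] at h6
    rw [(h6.resolve_left (not_or.2 ⟨ht, partitionGF_ne_zero hτ⟩)), mul_zero]
  exact zero_ne_one (tendsto_nhds_unique h5 (tendsto_mul_kron hτ h1 h2))

end Residue

/-- In `f(t) = f(0) + t · dslope f 0 t` the Leibniz rule at `0` retains only the term that
differentiates `t` once. This is the source of the factors `1/|b|`, and also of the denominators in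
the Bernoulli and theta expansions. -/
theorem iteratedDeriv_dslope_zero {f : ℂ → ℂ} (hf : AnalyticAt ℂ f 0) (m : ℕ) :
    iteratedDeriv m (dslope f 0) 0 = iteratedDeriv (m + 1) f 0 / ((m + 1 : ℕ) : ℂ) := by
  obtain ⟨p, hp⟩ := hf
  have hd : AnalyticAt ℂ (dslope f 0) 0 := ⟨_, hp.has_fpower_series_dslope_fslope⟩
  have h : f = (fun _ => f 0) + id * dslope f 0 := funext fun t => by
    have := sub_smul_dslope f 0 t
    simp only [sub_zero, smul_eq_mul] at this
    simp [this]
  have hr : ContDiffAt ℂ ((m + 1 : ℕ) : WithTop ℕ∞) (dslope f 0) 0 := hd.contDiffAt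
  have hm : ContDiffAt ℂ ((m + 1 : ℕ) : WithTop ℕ∞) (id * dslope f 0) 0 := contDiffAt_id.mul hr
  have hcast : ((m + 1 : ℕ) : ℂ) ≠ 0 := by exact_mod_cast Nat.succ_ne_zero m
  rw [eq_div_iff hcast]
  conv_rhs => rw [h]
  rw [iteratedDeriv_add contDiffAt_const hm,
    iteratedDeriv_mul contDiffAt_id hr, sum_eq_single 1]
  · simp [iteratedDeriv_const, mul_comm]
  · intro i _ hi
    rcases i with _ | _ | i
    · simp
    · exact absurd rfl hi
    · have : iteratedDeriv (i + 1 + 1) (id : ℂ → ℂ) 0 = 0 := by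
        rw [iteratedDeriv_succ', iteratedDeriv_succ', deriv_id']
        simp
      rw [this]; simp
  · intro h; simp at h

/-! ### The normalized theta function and the limit formula for the trace. -/

section Theta

variable {τ : ℂ}

theorem differentiable_theta (hτ : 0 < τ.im) : Differentiable ℂ (theta τ) :=
  (differentiable_thetaSeries hτ).div_const _

theorem theta_eq_zero_iff (hτ : 0 < τ.im) (t : ℂ) : theta τ t = 0 ↔ t ∈ Lat τ := by
  rw [theta, div_eq_zero_iff, thetaSeries_eq_zero_iff hτ]
  simp [deriv_thetaSeries_ne_zero hτ]

theorem theta_zero (hτ : 0 < τ.im) : theta τ 0 = 0 := (theta_eq_zero_iff hτ 0).2 (zero_mem_Lat τ)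

theorem deriv_theta_zero (hτ : 0 < τ.im) : deriv (theta τ) 0 = 1 := by
  have : theta τ = fun z => thetaSeries τ z / deriv (thetaSeries τ) 0 := rfl
  rw [this, deriv_div_const, div_self (deriv_thetaSeries_ne_zero hτ)]

theorem theta_add_period (τ z : ℂ) (a b : ℤ) :
    theta τ (z + (2 * Real.pi * I * a + 2 * Real.pi * I * τ * b)) =
      cexp (Real.pi * I * a - Real.pi * I * b - Real.pi * I * τ * b ^ 2 - b * z) *
        theta τ z := by
  rw [theta, thetaSeries_add_period, theta, mul_div_assoc]

/-- The theta function divided by its argument. -/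
def thetaDiv (τ : ℂ) : ℂ → ℂ := dslope (theta τ) 0

theorem mul_thetaDiv (hτ : 0 < τ.im) (t : ℂ) : t * thetaDiv τ t = theta τ t := by
  have := sub_smul_dslope (theta τ) 0 t
  simpa [theta_zero hτ, thetaDiv] using this

theorem thetaDiv_zero (hτ : 0 < τ.im) : thetaDiv τ 0 = 1 := by
  rw [thetaDiv, dslope_same, deriv_theta_zero hτ]

theorem differentiable_thetaDiv (hτ : 0 < τ.im) : Differentiable ℂ (thetaDiv τ) := by
  rw [← differentiableOn_univ, thetaDiv,
    Complex.differentiableOn_dslope Filter.univ_mem]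
  exact (differentiable_theta hτ).differentiableOn

/-- The function `t θ(z + t) / (θ(z) θ(t))`, continued to `t = 0`. -/
def kronMul (τ z t : ℂ) : ℂ := theta τ (z + t) / (theta τ z * thetaDiv τ t)

theorem kronMul_zero (hτ : 0 < τ.im) {z : ℂ} (hz : z ∉ Lat τ) : kronMul τ z 0 = 1 := by
  rw [kronMul, thetaDiv_zero hτ, add_zero, mul_one,
    div_self (mt (theta_eq_zero_iff hτ z).1 hz)]

theorem thetaDiv_ne_zero (hτ : 0 < τ.im) {t : ℂ}
    (h : t ∈ Metric.ball (0 : ℂ) (min 1 (2 * Real.pi * τ.im))) : thetaDiv τ t ≠ 0 := by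
  intro h0
  have h1 := mul_thetaDiv hτ t
  rw [h0, mul_zero, eq_comm, theta_eq_zero_iff hτ] at h1
  have := eq_zero_of_mem_Lat hτ h1 h
  rw [this, thetaDiv_zero hτ] at h0
  exact one_ne_zero h0

theorem differentiableOn_kronMul (hτ : 0 < τ.im) {z : ℂ} (hz : z ∉ Lat τ) :
    DifferentiableOn ℂ (kronMul τ z) (Metric.ball (0 : ℂ) (min 1 (2 * Real.pi * τ.im))) := by
  refine DifferentiableOn.div ?_ ?_ fun t ht =>
    mul_ne_zero (mt (theta_eq_zero_iff hτ z).1 hz) (thetaDiv_ne_zero hτ ht)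
  · exact ((differentiable_theta hτ).comp (differentiable_id.const_add z)).differentiableOn
  · exact ((differentiable_thetaDiv hτ).const_mul _).differentiableOn

/-- Kronecker's formula, obtained by eliminating the one-point function between its value at general
`t` and its limit at `t = 0`. -/
theorem kron_eq (hτ : 0 < τ.im) {z t : ℂ} (hz : 0 < z.re)
    (hz' : z.re < 2 * Real.pi * τ.im) (ht : t ∉ Lat τ) : kron τ z t = kronMul τ z t / t := by
  have h1 := thetaSeries_mul_onePoint hτ hz hz' ht
  have h2 := thetaSeries_mul_onePoint_eq hτ hz hz'
  have h3 := deriv_thetaSeries_ne_zero hτ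
  have h4 := partitionGF_ne_zero hτ
  have h5 : thetaSeries τ z ≠ 0 := mt (thetaSeries_eq_zero_iff hτ z).1 (notMem_Lat_of_re hz hz')
  have h6 : thetaSeries τ t ≠ 0 := mt (thetaSeries_eq_zero_iff hτ t).1 ht
  have h7 : kronMul τ z t / t = theta τ (z + t) / (theta τ z * theta τ t) := by
    rw [kronMul, div_div, mul_assoc, mul_comm _ t, mul_thetaDiv hτ]
  rw [h7, theta, theta, theta, add_comm z t]
  field_simp
  have h8 : thetaSeries τ z * thetaSeries τ t * kron τ z t * partitionGF τ =
      deriv (thetaSeries τ) 0 * thetaSeries τ (t + z) * partitionGF τ := by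
    linear_combination (-thetaSeries τ z) * h1 + thetaSeries τ (t + z) * h2
  have h9 := mul_right_cancel₀ h4 h8
  linear_combination h9

/-- The regular part at `t = 0` of the Kronecker function `θ(z + t) / (θ(z) θ(t))`. -/
def kronReg (τ z : ℂ) : ℂ → ℂ := dslope (kronMul τ z) 0

theorem differentiableOn_kronReg (hτ : 0 < τ.im) {z : ℂ} (hz : z ∉ Lat τ) :
    DifferentiableOn ℂ (kronReg τ z) (Metric.ball (0 : ℂ) (min 1 (2 * Real.pi * τ.im))) := by
  rw [kronReg, Complex.differentiableOn_dslope (Metric.ball_mem_nhds _ (by positivity))]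
  exact differentiableOn_kronMul hτ hz

theorem kronMul_eq (hτ : 0 < τ.im) {z : ℂ} (hz : z ∉ Lat τ) (t : ℂ) :
    kronMul τ z t = 1 + t * kronReg τ z t := by
  have := sub_smul_dslope (kronMul τ z) 0 t
  rw [kronMul_zero hτ hz, sub_zero, smul_eq_mul] at this
  rw [kronReg, this]; ring

theorem contDiffAt_kronReg (hτ : 0 < τ.im) {z : ℂ} (hz : z ∉ Lat τ) (n : WithTop ℕ∞) {t : ℂ}
    (ht : t ∈ Metric.ball (0 : ℂ) (min 1 (2 * Real.pi * τ.im))) :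
    ContDiffAt ℂ n (kronReg τ z) t :=
  (((differentiableOn_kronReg hτ hz).analyticOnNhd Metric.isOpen_ball) t ht).contDiffAt

theorem analyticAt_kronMul (hτ : 0 < τ.im) {z : ℂ} (hz : z ∉ Lat τ) :
    AnalyticAt ℂ (kronMul τ z) 0 :=
  (differentiableOn_kronMul hτ hz).analyticAt (Metric.ball_mem_nhds _ (by positivity))

theorem iteratedDeriv_kronReg (hτ : 0 < τ.im) {z : ℂ} (hz : z ∉ Lat τ) (m : ℕ) :
    iteratedDeriv m (kronReg τ z) 0 = iteratedDeriv (m + 1) (kronMul τ z) 0 / ((m + 1 : ℕ) : ℂ) :=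
  iteratedDeriv_dslope_zero (analyticAt_kronMul hτ hz) m

theorem iteratedDeriv_kron (hτ : 0 < τ.im) {z : ℂ} (hz : 0 < z.re)
    (hz' : z.re < 2 * Real.pi * τ.im) {t : ℂ} (ht : t ∉ Lat τ)
    (ht' : t ∈ Metric.ball (0 : ℂ) (min 1 (2 * Real.pi * τ.im))) (m : ℕ) :
    iteratedDeriv m (kron τ z) t = (-1) ^ m * (m.factorial : ℂ) * t⁻¹ ^ (m + 1) +
      iteratedDeriv m (kronReg τ z) t := by
  have hzL := notMem_Lat_of_re hz hz'
  have ht0 : t ≠ 0 := fun h => ht (h ▸ zero_mem_Lat τ)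
  have hev : kron τ z =ᶠ[nhds t] Inv.inv + kronReg τ z := by
    filter_upwards [(isOpen_compl_Lat hτ).mem_nhds ht] with s hs
    have hs0 : s ≠ 0 := fun h => hs (h ▸ zero_mem_Lat τ)
    rw [kron_eq hτ hz hz' hs, kronMul_eq hτ hzL, Pi.add_apply]
    field_simp
  rw [hev.iteratedDeriv_eq, iteratedDeriv_add (contDiffAt_inv ℂ ht0)
    (contDiffAt_kronReg hτ hzL m ht'), iteratedDeriv_eq_iterate, iter_deriv_inv]
  congr 2
  rw [inv_pow, ← zpow_natCast, ← zpow_neg]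
  congr 1; push_cast; ring

/-- The trace as a sum over set partitions of Taylor coefficients of the Kronecker function. -/
theorem gwT_eq_sum_partSum (hτ : 0 < τ.im) {n : ℕ} {z : Fin n → ℂ} (hz : z ∈ traceDomain n τ) :
    gwT τ z = ∑ j, partSum (fun b =>
      iteratedDeriv (b.card - 1) (kronReg τ (∑ i ∈ b, z i)) 0) (univ.erase j) := by
  have hp : 0 < min 1 (2 * Real.pi * τ.im) := by positivity
  set U := Metric.ball (0 : ℂ) (min 1 (2 * Real.pi * τ.im)) with hU
  have hcont : ∀ s : Finset (Fin n), Filter.Tendsto (fun t => partSum (fun b =>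
      iteratedDeriv (b.card - 1) (kronReg τ (∑ i ∈ b, z i)) t) s) (nhdsWithin 0 {0}ᶜ)
      (nhds (partSum (fun b =>
        iteratedDeriv (b.card - 1) (kronReg τ (∑ i ∈ b, z i)) 0) s)) := by
    intro s
    refine tendsto_finsetSum _ fun P _ => tendsto_finsetProd _ fun b hb => ?_
    obtain ⟨h1, h2⟩ := re_sum_pos_lt hz (P.nonempty_of_mem_parts hb)
    have han := ((differentiableOn_kronReg hτ (notMem_Lat_of_re h1 h2)).analyticOnNhd
      Metric.isOpen_ball) 0 (Metric.mem_ball_self hp)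
    simp only [iteratedDeriv_eq_iterate]
    exact (han.iterated_deriv (b.card - 1)).continuousAt.tendsto.mono_left nhdsWithin_le_nhds
  have h1 : Filter.Tendsto (fun t => partitionGF τ * (t * partSum (fun b =>
      iteratedDeriv (b.card - 1) (kronReg τ (∑ i ∈ b, z i)) t) univ + ∑ j, partSum (fun b =>
      iteratedDeriv (b.card - 1) (kronReg τ (∑ i ∈ b, z i)) t) (univ.erase j)))
      (nhdsWithin 0 {0}ᶜ) (nhds (partitionGF τ * (0 * partSum (fun b =>
      iteratedDeriv (b.card - 1) (kronReg τ (∑ i ∈ b, z i)) 0) univ + ∑ j, partSum (fun b =>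
      iteratedDeriv (b.card - 1) (kronReg τ (∑ i ∈ b, z i)) 0) (univ.erase j)))) :=
    (((Filter.tendsto_id.mono_left nhdsWithin_le_nhds).mul (hcont univ)).add
      (tendsto_finsetSum _ fun j _ => hcont (univ.erase j))).const_mul _
  -- The identity `thetaSeries_mul_nPoint`, divided by `ϑ(t)/t`, tends to `T_n` up to the factor
  -- `(q)_∞`. The other side, `t` times the partition sum, has its limit in `h1`.
  have h2 : Filter.Tendsto (fun t => (thetaSeries τ t / t)⁻¹ *
      (thetaSeries τ (t + ∑ i, z i) * nPoint τ z)) (nhdsWithin 0 {0}ᶜ)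
      (nhds ((deriv (thetaSeries τ) 0)⁻¹ * (thetaSeries τ (∑ i, z i) * nPoint τ z))) := by
    refine ((tendsto_thetaSeries_div hτ).inv₀ (deriv_thetaSeries_ne_zero hτ)).mul ?_
    have hc : Continuous fun t => thetaSeries τ (t + ∑ i, z i) * nPoint τ z :=
      ((differentiable_thetaSeries hτ).continuous.comp (continuous_id.add continuous_const)).mul
        continuous_const
    simpa using (hc.tendsto 0).mono_left (nhdsWithin_le_nhds (s := {0}ᶜ))
  have h3 := tendsto_nhds_unique h1 (h2.congr' ?_)
  · have h4 := partitionGF_mul_eulerQ hτ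
    rw [zero_mul, zero_add] at h3
    rw [gwT, theta]
    have h5 := deriv_thetaSeries_ne_zero hτ
    linear_combination (-eulerQ τ) * h3 + (∑ j, partSum (fun b =>
      iteratedDeriv (b.card - 1) (kronReg τ (∑ i ∈ b, z i)) 0) (univ.erase j)) * h4
  · filter_upwards [eventually_notMem_Lat hτ, self_mem_nhdsWithin,
      mem_nhdsWithin_of_mem_nhds (Metric.ball_mem_nhds (0 : ℂ) hp)] with t ht ht0 htU
    have ht0' : t ≠ 0 := ht0
    have h6 : thetaSeries τ t ≠ 0 := mt (thetaSeries_eq_zero_iff hτ t).1 ht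
    -- Splitting off the poles, with `c = t⁻¹`, leaves `t` times one regular sum plus the sum over
    -- `j` free of `t⁻¹`.
    rw [thetaSeries_mul_nPoint hτ ht hz, partSum_congr (g := fun b =>
      (-1) ^ (b.card - 1) * ((b.card - 1).factorial : ℂ) * t⁻¹ ^ b.card +
        iteratedDeriv (b.card - 1) (kronReg τ (∑ i ∈ b, z i)) t), partSum_pole_add]
    · field_simp
    · intro b _ hb
      obtain ⟨h7, h8⟩ := re_sum_pos_lt hz hb
      rw [iteratedDeriv_kron hτ h7 h8 ht htU, Nat.sub_add_cancel hb.card_pos]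

end Theta

/-! ### Bernoulli numbers and geometric series. -/

section TaylorCoefficients

/-- The function `(e^t - 1) / t`. -/
def expDiv : ℂ → ℂ := dslope cexp 0

theorem mul_expDiv (t : ℂ) : t * expDiv t = cexp t - 1 := by
  simpa [expDiv] using sub_smul_dslope cexp 0 t

theorem expDiv_zero : expDiv 0 = 1 := by simp [expDiv, dslope_same]

theorem differentiable_expDiv : Differentiable ℂ expDiv := by
  rw [← differentiableOn_univ, expDiv, Complex.differentiableOn_dslope Filter.univ_mem]
  exact Complex.differentiable_exp.differentiableOn

theorem iteratedDeriv_expDiv (n : ℕ) : iteratedDeriv n expDiv 0 = 1 / ((n + 1 : ℕ) : ℂ) := by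
  rw [expDiv, iteratedDeriv_dslope_zero (Complex.differentiable_exp.analyticAt 0),
    iteratedDeriv_eq_iterate, iter_deriv_exp, Complex.exp_zero]

theorem analyticAt_inv_expDiv : AnalyticAt ℂ (expDiv⁻¹) 0 :=
  (differentiable_expDiv.analyticAt 0).inv (by simp [expDiv_zero])

/-- Differentiating `expDiv⁻¹ · expDiv = 1` at `0` produces the defining recursion `sum_bernoulli`.
-/
theorem iteratedDeriv_inv_expDiv (n : ℕ) : iteratedDeriv n (expDiv⁻¹) 0 = (bernoulli n : ℂ) := by
  induction n using Nat.strong_induction_on with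
  | _ n ih =>
  have hE : ContDiffAt ℂ n expDiv 0 := differentiable_expDiv.contDiff.contDiffAt
  have hB : ContDiffAt ℂ n (expDiv⁻¹) 0 := analyticAt_inv_expDiv.contDiffAt
  have hev : expDiv⁻¹ * expDiv =ᶠ[nhds 0] fun _ => 1 := by
    filter_upwards [differentiable_expDiv.continuous.continuousAt.eventually_ne
      (by simp [expDiv_zero] : expDiv 0 ≠ 0)] with t ht
    simp [inv_mul_cancel₀ ht]
  have h1 := hev.iteratedDeriv_eq n
  rw [iteratedDeriv_mul hB hE, sum_range_succ] at h1
  have h2 : ∑ i ∈ range n, (n.choose i : ℂ) * iteratedDeriv i (expDiv⁻¹) 0 *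
      iteratedDeriv (n - i) expDiv 0 =
      (∑ i ∈ range n, ((n + 1).choose i : ℂ) * (bernoulli i : ℂ)) / (n + 1) := by
    rw [sum_div]
    refine sum_congr rfl fun i hi => ?_
    have hi' := mem_range.1 hi
    rw [ih i hi', iteratedDeriv_expDiv]
    have h3 : ((n.choose i : ℕ) : ℂ) * (n + 1) = ((n + 1).choose i : ℕ) * ((n - i + 1 : ℕ) : ℂ) := by
      rw [← Nat.sub_add_comm hi'.le]
      exact_mod_cast Nat.choose_mul_succ_eq n i
    have h4 : ((n - i + 1 : ℕ) : ℂ) ≠ 0 := Nat.cast_ne_zero.2 (Nat.succ_ne_zero _)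
    have h5 : (n + 1 : ℂ) ≠ 0 := Nat.cast_add_one_ne_zero n
    field_simp
    linear_combination (bernoulli i : ℂ) * h3
  have h4 : ∑ i ∈ range (n + 1), ((n + 1).choose i : ℂ) * (bernoulli i : ℂ) =
      if n = 0 then 1 else 0 := by
    have := congr_arg (Rat.cast : ℚ → ℂ) (sum_bernoulli (n + 1))
    push_cast at this
    rw [this]
    by_cases hn : n = 0 <;> simp [hn]
  have h5 : (n + 1 : ℂ) ≠ 0 := Nat.cast_add_one_ne_zero n
  rw [sum_range_succ, Nat.choose_succ_self_right] at h4
  rw [h2, Nat.sub_self, iteratedDeriv_zero, expDiv_zero, Nat.choose_self, iteratedDeriv_const] at h1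
  have h6 : ∑ i ∈ range n, ((n + 1).choose i : ℂ) * (bernoulli i : ℂ) =
    (if n = 0 then 1 else 0) - (n + 1) * bernoulli n := by
    push_cast at h4; linear_combination h4
  rw [h6] at h1
  by_cases hn : n = 0
  · subst hn
    simpa using h1
  · rw [if_neg hn] at h1
    field_simp at h1
    have h7 : (n + 1 : ℂ) * (iteratedDeriv n (expDiv⁻¹) 0 - bernoulli n) = 0 := by
      linear_combination h1
    exact sub_eq_zero.1 ((mul_eq_zero.1 h7).resolve_left h5)

/-- Both sides equal `e^t/(e^t - 1) - 1/t`, and `e^t/(e^t - 1) = 1 + 1/(e^t - 1)`. -/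
theorem logDeriv_expDiv {t : ℂ} (ht : t ≠ 0) (h : expDiv t ≠ 0) :
    logDeriv expDiv t = 1 + dslope (expDiv⁻¹) 0 t := by
  have h1 : HasDerivAt (fun t => t * expDiv t) (1 * expDiv t + t * deriv expDiv t) t :=
    (hasDerivAt_id t).mul (differentiable_expDiv t).hasDerivAt
  have h2 : HasDerivAt (fun t => t * expDiv t) (cexp t) t := by
    simp only [mul_expDiv]; exact (Complex.hasDerivAt_exp t).sub_const 1
  have h3 := h1.unique h2
  have h4 := mul_expDiv t
  rw [logDeriv_apply, dslope_of_ne _ ht, slope_def_field]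
  simp only [Pi.inv_apply, expDiv_zero]
  field_simp
  linear_combination h3 - h4

theorem iteratedDeriv_logDeriv_expDiv (l : ℕ) : iteratedDeriv l (logDeriv expDiv) 0 =
    (if l = 0 then 1 else 0) + (bernoulli (l + 1) : ℂ) / ((l + 1 : ℕ) : ℂ) := by
  have hB := analyticAt_inv_expDiv
  have hd : AnalyticAt ℂ (dslope (expDiv⁻¹) 0) 0 := by
    obtain ⟨p, hp⟩ := hB
    exact ⟨_, hp.has_fpower_series_dslope_fslope⟩
  have hE := differentiable_expDiv.analyticAt 0
  have hne : ∀ᶠ t in nhds 0, expDiv t ≠ 0 :=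
    differentiable_expDiv.continuous.continuousAt.eventually_ne (by simp [expDiv_zero])
  have hL : AnalyticAt ℂ (logDeriv expDiv) 0 := hE.deriv.div hE (by simp [expDiv_zero])
  have hev : logDeriv expDiv =ᶠ[nhds 0] (fun _ => 1) + dslope (expDiv⁻¹) 0 := by
    rw [← ContinuousAt.eventuallyEq_nhds_iff_eventuallyEq_nhdsNE hL.continuousAt
      (analyticAt_const.add hd).continuousAt]
    filter_upwards [self_mem_nhdsWithin, mem_nhdsWithin_of_mem_nhds hne] with t h0 h1
    exact logDeriv_expDiv h0 h1
  rw [hev.iteratedDeriv_eq, iteratedDeriv_add contDiffAt_const hd.contDiffAt,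
    iteratedDeriv_dslope_zero hB, iteratedDeriv_inv_expDiv, iteratedDeriv_const]

theorem iteratedDeriv_geometric {Q : ℂ} (hQ : ‖Q‖ < 1) (s : ℂ) (l : ℕ) :
    iteratedDeriv l (fun t => cexp (s * t) * Q / (1 - cexp (s * t) * Q)) 0 =
      ∑' m : ℕ, (s * (m + 1)) ^ l * Q ^ (m + 1) := by
  set ρ := (1 + ‖Q‖) / 2
  have hρ1 : ρ < 1 := by simp only [ρ]; linarith
  have hρ0 : 0 ≤ ρ := by simp only [ρ]; positivity
  set U := {t : ℂ | ‖cexp (s * t) * Q‖ < ρ}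
  have hU : IsOpen U := isOpen_lt (by fun_prop) continuous_const
  have h0 : (0 : ℂ) ∈ U := by simp [U, ρ]; linarith
  have hunif : TendstoUniformlyOn (fun (S : Finset ℕ) t => ∑ m ∈ S, (cexp (s * t) * Q) ^ (m + 1))
      (fun t => ∑' m : ℕ, (cexp (s * t) * Q) ^ (m + 1)) Filter.atTop U :=
    tendstoUniformlyOn_tsum (u := fun m => ρ ^ (m + 1))
      ((summable_nat_add_iff 1).2 (summable_geometric_of_lt_one hρ0 hρ1)) fun m t ht => by
        rw [norm_pow]; exact pow_le_pow_left₀ (norm_nonneg _) (le_of_lt ht) _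
  have h := hasSum_iteratedDeriv hU (F := fun (m : ℕ) t => (cexp (s * t) * Q) ^ (m + 1))
    (fun m => by fun_prop) hunif.tendstoLocallyUniformlyOn l h0
  have hev : (fun t => cexp (s * t) * Q / (1 - cexp (s * t) * Q)) =ᶠ[nhds 0]
      fun t => ∑' m : ℕ, (cexp (s * t) * Q) ^ (m + 1) := by
    filter_upwards [hU.mem_nhds h0] with t ht
    have : ‖cexp (s * t) * Q‖ < 1 := lt_trans ht hρ1
    simp only [pow_succ]
    rw [tsum_mul_right, tsum_geometric_of_norm_lt_one this, div_eq_mul_inv, mul_comm]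
  rw [hev.iteratedDeriv_eq, ← h.tsum_eq]
  refine tsum_congr fun m => ?_
  have : (fun t => (cexp (s * t) * Q) ^ (m + 1)) =
      fun t => Q ^ (m + 1) * cexp ((s * (m + 1)) * t) := funext fun t => by
    rw [mul_pow, ← Complex.exp_nat_mul, mul_comm]; push_cast; ring_nf
  rw [this, iteratedDeriv_const_mul_field, iteratedDeriv_cexp_const_mul]
  simp [mul_comm]

end TaylorCoefficients

/-! ### Logarithmic derivative of the theta product at the origin. -/

section LogDerivTheta

/-- The product over `k ≠ 0` of the factors `1 + x_k` (`k > 0`) and `1 + x_k⁻¹` (`k < 0`) of the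
theta function, where `x_k = -e^t q^k`, minus one. -/
def thetaFactor (τ : ℂ) (k : ℤ) (t : ℂ) : ℂ :=
  if k = 0 then 0 else -(cexp (k.sign * t) * nome τ ^ k.natAbs)

theorem thetaFactor_eq {τ : ℂ} {k : ℤ} (hk : k ≠ 0) (t : ℂ) : thetaFactor τ k t =
    if 0 ≤ k then modeWeight τ t k else (modeWeight τ t k)⁻¹ := by
  rw [thetaFactor, if_neg hk, modeWeight_eq, nome, ← Complex.exp_nat_mul, ← Complex.exp_add]
  rcases lt_or_gt_of_ne hk with h | h
  · rw [if_neg (not_le.2 h), inv_neg, ← Complex.exp_neg, Int.sign_eq_neg_one_of_neg h]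
    rw [Nat.cast_natAbs, abs_of_neg h]; congr 2; push_cast; ring
  · rw [if_pos h.le, Int.sign_eq_one_of_pos h]
    rw [Nat.cast_natAbs, abs_of_pos h]; congr 2; push_cast; ring

theorem differentiable_thetaFactor (τ : ℂ) (k : ℤ) : Differentiable ℂ (thetaFactor τ k) := by
  unfold thetaFactor
  split_ifs <;> fun_prop

theorem norm_thetaFactor_le {τ : ℂ} {t : ℂ} (ht : ‖t‖ ≤ 1) (k : ℤ) :
    ‖thetaFactor τ k t‖ ≤ Real.exp 1 * ‖nome τ‖ ^ k.natAbs := by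
  rw [thetaFactor]
  split_ifs with hk
  · rw [norm_zero]; positivity
  · rw [norm_neg, norm_mul, norm_pow, Complex.norm_exp]
    refine mul_le_mul_of_nonneg_right (Real.exp_le_exp.2 ?_) (by positivity)
    refine (re_le_norm _).trans ?_
    rw [norm_mul, norm_intCast]
    have h1 : |((k.sign : ℤ) : ℝ)| = 1 := by
      rcases lt_or_gt_of_ne hk with h | h
      · rw [Int.sign_eq_neg_one_of_neg h]; simp
      · rw [Int.sign_eq_one_of_pos h]; simp
    rw [h1, one_mul]; exact ht

theorem summable_pow_natAbs {r : ℝ} (hr : 0 ≤ r) (hr1 : r < 1) :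
    Summable fun k : ℤ => r ^ k.natAbs := by
  rw [summable_int_iff_summable_nat_and_neg]
  simp only [Int.natAbs_neg, Int.natAbs_natCast]
  exact ⟨summable_geometric_of_lt_one hr hr1, summable_geometric_of_lt_one hr hr1⟩

theorem one_add_thetaFactor_ne_zero {τ t : ℂ} (hτ : 0 < τ.im)
    (h : t ∈ Metric.ball (0 : ℂ) (min 1 (2 * Real.pi * τ.im))) (k : ℤ) :
    1 + thetaFactor τ k t ≠ 0 := by
  by_cases hk : k = 0
  · simp [thetaFactor, hk]
  · have h1 := one_add_modeWeight_ne_zero' hτ h hk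
    rw [thetaFactor_eq hk]
    split_ifs
    · exact h1
    · have h0 := modeWeight_ne_zero τ t k
      intro h
      apply h1
      field_simp at h
      linear_combination h

/-- The product of the factors of the theta function that do not vanish at the origin. -/
def thetaTail (τ t : ℂ) : ℂ := ∏' k : ℤ, (1 + thetaFactor τ k t)

theorem chargeTheta_mul_partitionGF_eq {τ : ℂ} (hτ : 0 < τ.im) (t : ℂ) :
    chargeTheta τ t * partitionGF τ = (1 - cexp t) * thetaTail τ t := by
  rw [chargeTheta_mul_partitionGF hτ]
  have hs : Summable fun k : ℤ => ‖thetaFactor τ k t‖ := by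
    refine (summable_weight hτ t).of_nonneg_of_le (fun _ => norm_nonneg _) fun k => ?_
    by_cases hk : k = 0
    · simp [thetaFactor, hk]
    · rw [thetaFactor_eq hk]
  rw [show (fun k : ℤ => 1 + if 0 ≤ k then modeWeight τ t k else (modeWeight τ t k)⁻¹) =
    fun k => (if k = 0 then 1 - cexp t else 1) * (1 + thetaFactor τ k t) from funext fun k => by
      by_cases hk : k = 0
      · simp [hk, thetaFactor, modeWeight_eq, sub_eq_add_neg]
      · rw [if_neg hk, one_mul, thetaFactor_eq hk]]
  rw [Multipliable.tprod_mul, tprod_ite_eq, thetaTail]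
  · exact multipliable_of_hasFiniteMulSupport ((Set.finite_singleton (0 : ℤ)).subset fun k hk => by
      by_contra h; exact hk (if_neg h))
  · exact multipliable_one_add_of_summable hs

/-- The triple product with its only vanishing factor `1 - e^t` isolated. The constant is
irrelevant, since only the logarithmic derivative is used. -/
theorem thetaDiv_eq {τ : ℂ} (hτ : 0 < τ.im) {t : ℂ} (ht : t ≠ 0) : thetaDiv τ t =
    -(cexp (-(Real.pi * I / 2) + Real.pi * I * τ / 4) /
      (partitionGF τ * deriv (thetaSeries τ) 0)) * cexp (-1 / 2 * t) * expDiv t *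
      thetaTail τ t := by
  have h1 := mul_thetaDiv hτ t
  have h2 := chargeTheta_mul_partitionGF_eq hτ t
  have h3 := mul_expDiv t
  have h4 := partitionGF_ne_zero hτ
  have h5 := deriv_thetaSeries_ne_zero hτ
  rw [theta, thetaSeries_eq_chargeTheta, show -(Real.pi * I / 2) + Real.pi * I * τ / 4 - t / 2 =
    (-(Real.pi * I / 2) + Real.pi * I * τ / 4) + -1 / 2 * t by ring, Complex.exp_add] at h1
  refine mul_left_cancel₀ (mul_ne_zero ht (mul_ne_zero h4 h5)) ?_
  generalize cexp (-(Real.pi * I / 2) + Real.pi * I * τ / 4) = e₁, cexp (-1 / 2 * t) = e₂ at *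
  rw [eq_div_iff h5] at h1
  have h6 : t * (partitionGF τ * deriv (thetaSeries τ) 0) *
      (-(e₁ / (partitionGF τ * deriv (thetaSeries τ) 0)) * e₂ * expDiv t * thetaTail τ t) =
      -(e₁ * e₂ * (t * expDiv t) * thetaTail τ t) := by
    field_simp
  rw [h6]
  linear_combination partitionGF τ * h1 + e₁ * e₂ * (h2 + thetaTail τ t * h3)

theorem multipliableLocallyUniformlyOn_thetaTail {τ : ℂ} (hτ : 0 < τ.im) :
    MultipliableLocallyUniformlyOn (fun k t => 1 + thetaFactor τ k t)
      (Metric.ball (0 : ℂ) (min 1 (2 * Real.pi * τ.im))) :=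
  Summable.multipliableLocallyUniformlyOn_one_add Metric.isOpen_ball
    ((summable_pow_natAbs (norm_nonneg _) (norm_nome_lt_one hτ)).mul_left (Real.exp 1))
    (Filter.Eventually.of_forall fun k _ ht => norm_thetaFactor_le
      ((mem_ball_zero_iff.1 ht).le.trans (min_le_left _ _)) k)
    fun k => (differentiable_thetaFactor τ k).continuous.continuousOn

theorem thetaTail_ne_zero {τ t : ℂ} (hτ : 0 < τ.im)
    (h : t ∈ Metric.ball (0 : ℂ) (min 1 (2 * Real.pi * τ.im))) : thetaTail τ t ≠ 0 :=
  tprod_one_add_ne_zero_of_summable (one_add_thetaFactor_ne_zero hτ h)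
    (((summable_pow_natAbs (norm_nonneg _) (norm_nome_lt_one hτ)).mul_left
      (Real.exp 1)).of_nonneg_of_le (fun _ => norm_nonneg _) fun k => norm_thetaFactor_le
        ((mem_ball_zero_iff.1 h).le.trans (min_le_left _ _)) k)

theorem differentiableOn_thetaTail {τ : ℂ} (hτ : 0 < τ.im) :
    DifferentiableOn ℂ (thetaTail τ) (Metric.ball (0 : ℂ) (min 1 (2 * Real.pi * τ.im))) :=
  (multipliableLocallyUniformlyOn_thetaTail hτ).hasProdLocallyUniformlyOn.differentiableOn
    (Filter.Eventually.of_forall fun _ => DifferentiableOn.fun_finsetProd fun k _ =>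
      ((differentiable_thetaFactor τ k).const_add 1).differentiableOn) Metric.isOpen_ball

theorem logDeriv_one_add_thetaFactor (τ : ℂ) (k : ℤ) :
    logDeriv (fun t => 1 + thetaFactor τ k t) =
      fun t => k.sign * thetaFactor τ k t / (1 + thetaFactor τ k t) := by
  funext t
  rw [logDeriv_apply, deriv_const_add]
  congr 1
  by_cases hk : k = 0
  · subst hk
    have : thetaFactor τ 0 = fun _ => 0 := by funext t; simp [thetaFactor]
    simp [this]
  · have h : thetaFactor τ k = fun t => -(cexp (k.sign * t) * nome τ ^ k.natAbs) :=
      funext fun t => if_neg hk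
    have h1 : HasDerivAt (thetaFactor τ k)
        (-(cexp (k.sign * t) * (k.sign * 1) * nome τ ^ k.natAbs)) t := by
      rw [h]
      exact ((((hasDerivAt_id t).const_mul _).cexp).mul_const _).neg
    rw [h1.deriv, h]; ring

/-- The logarithmic derivatives of the factors are geometrically small uniformly on the ball, so the
series may be differentiated termwise. -/
theorem hasSum_iteratedDeriv_logDeriv_thetaTail {τ : ℂ} (hτ : 0 < τ.im) (l : ℕ) :
    HasSum (fun k => iteratedDeriv l (logDeriv fun t => 1 + thetaFactor τ k t) 0)
      (iteratedDeriv l (logDeriv (thetaTail τ)) 0) := by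
  set U := Metric.ball (0 : ℂ) (min 1 (2 * Real.pi * τ.im)) with hU
  have hUo : IsOpen U := Metric.isOpen_ball
  have h0 : (0 : ℂ) ∈ U := Metric.mem_ball_self (by positivity)
  have hs := (summable_pow_natAbs (norm_nonneg _) (norm_nome_lt_one hτ)).mul_left (Real.exp 1)
  have hev : ∀ᶠ k : ℤ in Filter.cofinite, ∀ t ∈ U,
      ‖logDeriv (fun t => 1 + thetaFactor τ k t) t‖ ≤
        2 * (Real.exp 1 * ‖nome τ‖ ^ k.natAbs) := by
    filter_upwards [hs.tendsto_cofinite_zero.eventually_le_const (show (0 : ℝ) < 1 / 2 by norm_num)]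
      with k hk t ht
    have h1 := norm_thetaFactor_le (τ := τ) ((mem_ball_zero_iff.1 ht).le.trans (min_le_left _ _)) k
    have h2 : 1 - ‖thetaFactor τ k t‖ ≤ ‖1 + thetaFactor τ k t‖ := by
      have := norm_sub_norm_le 1 (-thetaFactor τ k t)
      rwa [norm_neg, norm_one, sub_neg_eq_add] at this
    have h3 : ‖((k.sign : ℤ) : ℂ)‖ ≤ 1 := by
      rw [norm_intCast]
      rcases lt_trichotomy k 0 with h | h | h
      · rw [Int.sign_eq_neg_one_of_neg h]; simp
      · simp [h]
      · rw [Int.sign_eq_one_of_pos h]; simp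
    rw [logDeriv_one_add_thetaFactor, norm_div, norm_mul, div_le_iff₀ (by linarith)]
    nlinarith [norm_nonneg (thetaFactor τ k t)]
  have hlog : ∀ t ∈ U, ∀ k, 1 + thetaFactor τ k t ≠ 0 :=
    fun t ht k => one_add_thetaFactor_ne_zero hτ ht k
  have hdl : ∀ k, DifferentiableOn ℂ (logDeriv fun t => 1 + thetaFactor τ k t) U := fun k => by
    rw [logDeriv_one_add_thetaFactor]
    intro t ht
    have := differentiable_thetaFactor τ k t
    exact ((this.const_mul _).div (this.const_add 1) (hlog t ht k)).differentiableWithinAt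
  have hunif := tendstoUniformlyOn_tsum_of_cofinite_eventually (hs.mul_left 2) hev
  have h := hasSum_iteratedDeriv hUo hdl hunif.tendstoLocallyUniformlyOn l h0
  have heq : logDeriv (thetaTail τ) =ᶠ[nhds 0]
      fun t => ∑' k, logDeriv (fun t => 1 + thetaFactor τ k t) t := by
    filter_upwards [hUo.mem_nhds h0] with t ht
    refine logDeriv_tprod_eq_tsum hUo ht (hlog t ht)
      (fun k => ((differentiable_thetaFactor τ k).const_add 1).differentiableOn) ?_
      (multipliableLocallyUniformlyOn_thetaTail hτ) (thetaTail_ne_zero hτ ht)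
    exact HasSum.summable (a := ∑' k, logDeriv (fun t => 1 + thetaFactor τ k t) t)
      (hunif.tendstoLocallyUniformlyOn.tendsto_at ht)
  rwa [heq.iteratedDeriv_eq]

/-- The exponential prefactor contributes only the constant `-1/2`, and `expDiv` a constant besides
its Bernoulli term; both constants disappear for `l ≠ 0`. -/
theorem iteratedDeriv_logDeriv_thetaDiv {τ : ℂ} (hτ : 0 < τ.im) {l : ℕ} (hl : l ≠ 0) :
    iteratedDeriv l (logDeriv (thetaDiv τ)) 0 =
      (bernoulli (l + 1) : ℂ) / ((l + 1 : ℕ) : ℂ) + iteratedDeriv l (logDeriv (thetaTail τ)) 0 := by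
  set U := Metric.ball (0 : ℂ) (min 1 (2 * Real.pi * τ.im)) with hU
  have hUo : IsOpen U := Metric.isOpen_ball
  have h0 : (0 : ℂ) ∈ U := Metric.mem_ball_self (by positivity)
  have hP := partitionGF_ne_zero hτ
  have hD := deriv_thetaSeries_ne_zero hτ
  have hE0 : expDiv 0 ≠ 0 := by simp [expDiv_zero]
  have hT : AnalyticAt ℂ (thetaTail τ) 0 := (differentiableOn_thetaTail hτ).analyticAt (hUo.mem_nhds h0)
  have hE := differentiable_expDiv.analyticAt 0
  set c := -(cexp (-(Real.pi * I / 2) + Real.pi * I * τ / 4) /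
      (partitionGF τ * deriv (thetaSeries τ) 0)) with hc
  have hc0 : c ≠ 0 := neg_ne_zero.2 (div_ne_zero (Complex.exp_ne_zero _) (mul_ne_zero hP hD))
  have hcont : ContinuousAt (fun t => c * cexp (-1 / 2 * t) * expDiv t * thetaTail τ t) 0 :=
    ContinuousAt.mul (ContinuousAt.mul (by fun_prop) hE.continuousAt) hT.continuousAt
  have h1 : thetaDiv τ =ᶠ[nhds 0] fun t => c * cexp (-1 / 2 * t) * expDiv t * thetaTail τ t := by
    rw [← ContinuousAt.eventuallyEq_nhds_iff_eventuallyEq_nhdsNE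
      (differentiable_thetaDiv hτ).continuous.continuousAt
      hcont]
    filter_upwards [self_mem_nhdsWithin] with t ht using thetaDiv_eq hτ ht
  have h2 : logDeriv (thetaDiv τ) =ᶠ[nhds 0]
      (fun _ => -1 / 2) + logDeriv expDiv + logDeriv (thetaTail τ) := by
    refine (logDeriv_congr_nhds h1).trans ?_
    filter_upwards [hUo.mem_nhds h0, hE.continuousAt.eventually_ne hE0] with t ht hEt
    have hdT := (differentiableOn_thetaTail hτ).differentiableAt (hUo.mem_nhds ht)
    have hdE := differentiable_expDiv t
    rw [logDeriv_mul (f := fun t => c * cexp (-1 / 2 * t) * expDiv t) t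
      (mul_ne_zero (mul_ne_zero hc0 (Complex.exp_ne_zero _)) hEt)
      (thetaTail_ne_zero hτ ht) (DifferentiableAt.mul (by fun_prop) hdE) hdT,
      logDeriv_mul (f := fun t => c * cexp (-1 / 2 * t)) t (mul_ne_zero hc0 (Complex.exp_ne_zero _)) hEt (by fun_prop) hdE,
      logDeriv_const_mul t c hc0]
    have : logDeriv (fun t => cexp (-1 / 2 * t)) t = -1 / 2 := by
      have h : HasDerivAt (fun t => cexp (-1 / 2 * t)) (cexp (-1 / 2 * t) * (-1 / 2 * 1)) t :=
        ((hasDerivAt_id t).const_mul _).cexp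
      rw [logDeriv_apply, h.deriv]
      have := Complex.exp_ne_zero (-1 / 2 * t)
      field_simp
    rw [this]; rfl
  have hlE : AnalyticAt ℂ (logDeriv expDiv) 0 := hE.deriv.div hE hE0
  have hlT : AnalyticAt ℂ (logDeriv (thetaTail τ)) 0 := hT.deriv.div hT (thetaTail_ne_zero hτ h0)
  rw [h2.iteratedDeriv_eq, iteratedDeriv_add (f := (fun _ => -1 / 2) + logDeriv expDiv)
    (contDiffAt_const.add hlE.contDiffAt) hlT.contDiffAt,
    iteratedDeriv_add contDiffAt_const hlE.contDiffAt, iteratedDeriv_const, if_neg hl,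
    iteratedDeriv_logDeriv_expDiv, if_neg hl, zero_add, zero_add]

end LogDerivTheta

/-! ### Eisenstein series as Taylor coefficients of theta. -/

section Eisenstein

/-- Euler's evaluation of zeta at even integers. The term `j = 0` counts as zero because `1 / 0 =
0`. -/
theorem tsum_lattice_row_zero {a : ℕ} (ha : 2 ≤ a) (he : Even a) :
    (a - 1).factorial * ∑' j : ℤ, 1 / (2 * Real.pi * I * j) ^ a = -(bernoulli a / a : ℂ) := by
  obtain ⟨k, hk⟩ := he
  have hk0 : k ≠ 0 := by omega
  have h1 := two_mul_riemannZeta_eq_tsum_int_inv_pow_of_even ha ⟨k, hk⟩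
  have h2 := riemannZeta_two_mul_nat hk0
  have h3 : ∑' j : ℤ, 1 / (2 * Real.pi * I * j) ^ a =
      ((2 * Real.pi * I) ^ a)⁻¹ * ∑' j : ℤ, ((j : ℂ) ^ a)⁻¹ := by
    rw [← tsum_mul_left]
    exact tsum_congr fun j => by rw [mul_pow (2 * Real.pi * I) (j : ℂ), one_div, mul_inv]
  have ha2 : a = 2 * k := by omega
  subst ha2
  push_cast at h1
  rw [h3, ← h1, h2]
  obtain ⟨m, rfl⟩ := Nat.exists_eq_succ_of_ne_zero hk0
  have hf : ((2 * (m + 1)).factorial : ℂ) = (2 * (m + 1) : ℕ) * ((2 * (m + 1) - 1).factorial : ℂ) := by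
    rw [← Nat.cast_mul, Nat.mul_factorial_pred (by omega)]
  have hf0 : ((2 * (m + 1) - 1).factorial : ℂ) ≠ 0 := Nat.cast_ne_zero.2 (Nat.factorial_ne_zero _)
  have hI : I ^ (2 * (m + 1)) = (-1) ^ (m + 1) := by rw [pow_mul, I_sq]
  have hp : (Real.pi : ℂ) ≠ 0 := by exact_mod_cast Real.pi_ne_zero
  have hm : ((2 * (m + 1) : ℕ) : ℂ) ≠ 0 := Nat.cast_ne_zero.2 (by omega)
  rw [Nat.succ_eq_add_one, hf, mul_pow, mul_pow, hI, show 2 * (m + 1) - 1 = 2 * m + 1 by omega] at *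
  rw [show (2 : ℂ) ^ (2 * (m + 1)) = 2 * 2 ^ (2 * m + 1) by ring, pow_succ (-1 : ℂ) (m + 1)]
  field_simp

/-- Lipschitz's formula for one row of the lattice. Evenness of the exponent identifies the rows `k`
and `-k`. -/
theorem tsum_lattice_row {τ : ℂ} (hτ : 0 < τ.im) {l : ℕ} (hl : l ≠ 0) (he : Even (l + 1)) {k : ℤ}
    (hk : k ≠ 0) : l.factorial * ∑' j : ℤ, 1 / (2 * Real.pi * I * j + 2 * Real.pi * I * τ * k) ^
      (l + 1) = ∑' m : ℕ, ((m : ℂ) + 1) ^ l * (nome τ ^ k.natAbs) ^ (m + 1) := by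
  have h1 : ∑' j : ℤ, 1 / (2 * Real.pi * I * j + 2 * Real.pi * I * τ * k) ^ (l + 1) =
      ∑' j : ℤ, 1 / (2 * Real.pi * I * j + 2 * Real.pi * I * τ * k.natAbs) ^ (l + 1) := by
    rcases lt_or_gt_of_ne hk with h | h
    · rw [← (Equiv.neg ℤ).tsum_eq]
      refine tsum_congr fun j => ?_
      rw [Nat.cast_natAbs, abs_of_neg h, ← he.neg_pow]
      congr 2; simp; ring
    · rw [Nat.cast_natAbs, abs_of_pos h]
  have hN : 0 < k.natAbs := Int.natAbs_pos.2 hk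
  have hNτ : 0 < ((k.natAbs : ℂ) * τ).im := by
    rw [← ofReal_natCast, im_ofReal_mul]
    have : (0 : ℝ) < k.natAbs := by exact_mod_cast hN
    positivity
  have h2 := EisensteinSeries.qExpansion_identity (Nat.one_le_iff_ne_zero.2 hl)
    ⟨(k.natAbs : ℂ) * τ, hNτ⟩
  have h3 : ∑' j : ℤ, 1 / (2 * Real.pi * I * j + 2 * Real.pi * I * τ * k.natAbs) ^ (l + 1) =
      ((2 * Real.pi * I) ^ (l + 1))⁻¹ * ∑' j : ℤ, 1 / ((k.natAbs : ℂ) * τ + j) ^ (l + 1) := by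
    rw [← tsum_mul_left]
    refine tsum_congr fun j => ?_
    rw [one_div, one_div, ← mul_inv, ← mul_pow]
    congr 2; ring
  have hq : cexp (2 * Real.pi * I * ((k.natAbs : ℂ) * τ)) = nome τ ^ k.natAbs := by
    rw [nome, ← Complex.exp_nat_mul]; congr 1; ring
  have hqn : ‖nome τ ^ k.natAbs‖ < 1 := by
    rw [norm_pow]; exact pow_lt_one₀ (norm_nonneg _) (norm_nome_lt_one hτ) hN.ne'
  simp only [hq] at h2
  rw [h1, h3, h2, (summable_pow_mul_geometric_of_norm_lt_one l hqn).tsum_eq_zero_add]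
  have h5 : ((2 : ℂ) * Real.pi * I) ^ (l + 1) ≠ 0 := pow_ne_zero _ Complex.two_pi_I_ne_zero
  have h6 : (l.factorial : ℂ) ≠ 0 := Nat.cast_ne_zero.2 (Nat.factorial_ne_zero _)
  rw [show (-2 * Real.pi * I : ℂ) = -(2 * Real.pi * I) by ring, he.neg_pow]
  simp only [Nat.cast_zero, zero_pow hl, zero_mul, zero_add, Nat.cast_add, Nat.cast_one]
  field_simp

theorem iteratedDeriv_logDeriv_thetaFactor {τ : ℂ} (hτ : 0 < τ.im) {k : ℤ} (hk : k ≠ 0) {l : ℕ}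
    (he : Even (l + 1)) : iteratedDeriv l (logDeriv fun t => 1 + thetaFactor τ k t) 0 =
      -∑' m : ℕ, ((m : ℂ) + 1) ^ l * (nome τ ^ k.natAbs) ^ (m + 1) := by
  have hqn : ‖nome τ ^ k.natAbs‖ < 1 := by
    rw [norm_pow]; exact pow_lt_one₀ (norm_nonneg _) (norm_nome_lt_one hτ) (Int.natAbs_ne_zero.2 hk)
  have h : (logDeriv fun t => 1 + thetaFactor τ k t) = fun t => -(k.sign : ℂ) *
      (cexp (k.sign * t) * nome τ ^ k.natAbs / (1 - cexp (k.sign * t) * nome τ ^ k.natAbs)) := by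
    rw [logDeriv_one_add_thetaFactor]
    funext t
    rw [thetaFactor, if_neg hk, ← sub_eq_add_neg]; ring
  rw [h, iteratedDeriv_const_mul_field, iteratedDeriv_geometric hqn, neg_mul, ← tsum_mul_left]
  congr 1
  refine tsum_congr fun m => ?_
  have hs : ((k.sign : ℤ) : ℂ) ^ (l + 1) = 1 := by
    rcases lt_or_gt_of_ne hk with h | h
    · rw [Int.sign_eq_neg_one_of_neg h]; push_cast; exact he.neg_one_pow
    · rw [Int.sign_eq_one_of_pos h]; simp
  rw [mul_pow, ← mul_assoc, ← mul_assoc, ← pow_succ', hs, one_mul]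

theorem theta_neg (τ z : ℂ) : theta τ (-z) = -theta τ z := by
  have : thetaSeries τ (-z) = -thetaSeries τ z := by
    rw [thetaSeries, thetaSeries, ← (Equiv.subLeft (-1 : ℤ)).tsum_eq, ← tsum_neg]
    refine tsum_congr fun m => ?_
    simp only [Equiv.subLeft_apply]
    push_cast
    have : cexp (Real.pi * I * (-1 - m + 1 / 2)) = -cexp (Real.pi * I * (m + 1 / 2)) := by
      rw [← Complex.exp_add_pi_mul_I, Complex.exp_eq_exp_iff_exists_int]
      exact ⟨-m - 1, by push_cast; ring⟩
    rw [this, show (-1 - m + 1 / 2 : ℂ) ^ 2 = (m + 1 / 2) ^ 2 by ring,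
      show (-1 - m + 1 / 2 : ℂ) * -z = (m + 1 / 2) * z by ring]
    ring
  rw [theta, theta, this, neg_div]

theorem thetaDiv_neg {τ : ℂ} (hτ : 0 < τ.im) (t : ℂ) : thetaDiv τ (-t) = thetaDiv τ t := by
  by_cases ht : t = 0
  · simp [ht]
  · have h1 := mul_thetaDiv hτ t
    have h2 := mul_thetaDiv hτ (-t)
    rw [theta_neg, ← h1] at h2
    exact mul_left_cancel₀ ht (by linear_combination -h2)

theorem logDeriv_thetaDiv_neg {τ : ℂ} (hτ : 0 < τ.im) (t : ℂ) :
    logDeriv (thetaDiv τ) (-t) = -logDeriv (thetaDiv τ) t := by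
  have h : (fun t => thetaDiv τ (-t)) = thetaDiv τ := funext (thetaDiv_neg hτ)
  have h1 := deriv_comp_neg (thetaDiv τ) t
  rw [h] at h1
  rw [logDeriv_apply, logDeriv_apply, thetaDiv_neg hτ, h1, neg_div, neg_neg]

/-- The Taylor coefficients of the logarithmic derivative of `θ(t) / t` are Eisenstein series. -/
theorem iteratedDeriv_logDeriv_thetaDiv_eq_eisG {τ : ℂ} (hτ : 0 < τ.im) (l : ℕ) :
    iteratedDeriv l (logDeriv (thetaDiv τ)) 0 = -2 * eisG τ (l + 1) := by
  by_cases he : Even (l + 1)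
  · have hl : l ≠ 0 := by rintro rfl; simp at he
    have hs := hasSum_iteratedDeriv_logDeriv_thetaTail hτ l
    have h0 : iteratedDeriv l (logDeriv fun t => 1 + thetaFactor τ 0 t) 0 = 0 := by
      have : (fun t => 1 + thetaFactor τ 0 t) = fun _ => 1 := by
        funext t; simp [thetaFactor]
      rw [this, logDeriv_const]
      exact iteratedDeriv_const.trans (if_neg hl)
    -- The tail has no factor at `k = 0`; this vacant place receives the Bernoulli term, which
    -- matches the row `m = 0` of the lattice sum. The comparison then goes row by row, in the order
    -- of Eisenstein summation.
    have hs' := hs.update 0 ((bernoulli (l + 1) : ℂ) / ((l + 1 : ℕ) : ℂ))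
    rw [h0, sub_zero] at hs'
    rw [iteratedDeriv_logDeriv_thetaDiv hτ hl, ← hs'.tsum_eq, eisG, if_pos he, Nat.add_sub_cancel,
      mul_assoc, ← tsum_mul_left, ← tsum_mul_left, ← tsum_mul_left]
    refine tsum_congr fun k => ?_
    by_cases hk : k = 0
    · subst hk
      have := tsum_lattice_row_zero (a := l + 1) (by omega) he
      rw [Nat.add_sub_cancel] at this
      simp only [Function.update_self, Int.cast_zero, mul_zero, add_zero]
      rw [← neg_eq_iff_eq_neg.2 this]; ring
    · rw [Function.update_of_ne hk, iteratedDeriv_logDeriv_thetaFactor hτ hk he,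
        ← tsum_lattice_row hτ hl he hk]
      ring
  · rw [eisG, if_neg he, mul_zero]
    -- Here `l` is even and the logarithmic derivative of the even function `θ(t)/t` is odd, so the
    -- coefficient vanishes.
    have h1 := iteratedDeriv_comp_neg l (logDeriv (thetaDiv τ)) 0
    have h2 : (fun t => logDeriv (thetaDiv τ) (-t)) = -logDeriv (thetaDiv τ) :=
      funext (logDeriv_thetaDiv_neg hτ)
    have h3 : Even l := by
      rcases Nat.even_or_odd l with h | h
      · exact h
      · exact absurd h.add_one he
    rw [h2, iteratedDeriv_neg, h3.neg_one_pow, neg_zero, one_smul] at h1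
    linear_combination (-1 / 2 : ℂ) * h1

end Eisenstein

/-! ### Bell polynomials and the formula for `T_n`. -/

section BellPolynomials

/-- The exponent `∑_{k ≥ 1} x_k t^k / k!` in the generating function of the Bell polynomials. -/
def bellExponent (x : ℕ → ℂ) : PowerSeries ℂ :=
  PowerSeries.mk fun k => if k = 0 then 0 else x k / (k.factorial : ℂ)

theorem hasSubst_bellExponent (x : ℕ → ℂ) : PowerSeries.HasSubst (bellExponent x) :=
  PowerSeries.HasSubst.of_constantCoeff_zero' (by simp [bellExponent])

theorem bellPoly_zero (x : ℕ → ℂ) : bellPoly 0 x = 1 := by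
  have h := PowerSeries.constantCoeff_subst (hasSubst_bellExponent x) (PowerSeries.exp ℂ)
  rw [finsum_eq_single _ 0 fun d hd => ?_] at h
  · rw [bellPoly, PowerSeries.coeff_zero_eq_constantCoeff_apply]
    simp only [Nat.factorial_zero, Nat.cast_one, one_mul]
    refine h.trans ?_
    simp
  · rw [map_pow, show MvPowerSeries.constantCoeff (bellExponent x) = 0 from
      PowerSeries.coeff_zero_eq_constantCoeff_apply (bellExponent x) ▸ by simp [bellExponent],
      zero_pow hd, smul_zero]

/-- Compare coefficients in the derivative of `exp ∘ E`, which is `(exp ∘ E) · E'`. -/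
theorem bellPoly_succ (m : ℕ) (x : ℕ → ℂ) : bellPoly (m + 1) x =
    ∑ i ∈ range (m + 1), (m.choose i : ℂ) * bellPoly i x * x (m - i + 1) := by
  have h := PowerSeries.derivative_subst (f := PowerSeries.exp ℂ) (hasSubst_bellExponent x)
  have h1 := congr_arg (PowerSeries.coeff m) h
  rw [PowerSeries.coeff_derivative, PowerSeries.derivative_exp, PowerSeries.coeff_mul,
    Nat.sum_antidiagonal_eq_sum_range_succ_mk] at h1
  have h2 : bellPoly (m + 1) x = (m.factorial : ℂ) * (PowerSeries.coeff (m + 1)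
      (PowerSeries.subst (bellExponent x) (PowerSeries.exp ℂ)) * (m + 1)) := by
    rw [bellPoly, Nat.factorial_succ]; push_cast; rw [bellExponent]; ring
  rw [h2, h1, mul_sum]
  refine sum_congr rfl fun i hi => ?_
  have hi' : i ≤ m := Nat.lt_succ_iff.1 (mem_range.1 hi)
  have h3 : ((m - i + 1).factorial : ℂ) = (((m - i : ℕ) : ℂ) + 1) * (m - i).factorial := by
    rw [Nat.factorial_succ]; push_cast; ring
  have h4 : (m.factorial : ℂ) = m.choose i * i.factorial * (m - i).factorial := by
    rw [← Nat.choose_mul_factorial_mul_factorial hi']; push_cast; ring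
  have h5 : ((m - i).factorial : ℂ) ≠ 0 := Nat.cast_ne_zero.2 (Nat.factorial_ne_zero _)
  have h6 : (((m - i : ℕ) : ℂ) + 1) ≠ 0 := Nat.cast_add_one_ne_zero _
  rw [PowerSeries.coeff_derivative, h4, bellPoly, ← bellExponent]
  nth_rewrite 2 [bellExponent]
  rw [PowerSeries.coeff_mk, if_neg (Nat.succ_ne_zero _), h3]
  field_simp

/-- A sequence is given by Bell polynomials if it is the sequence of derivatives of a function
with prescribed derivatives of its logarithmic derivative. -/
theorem bellPoly_eq_of_rec {x g : ℕ → ℂ} (h0 : g 0 = 1)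
    (h : ∀ m, g (m + 1) = ∑ i ∈ range (m + 1), (m.choose i : ℂ) * g i * x (m - i + 1)) (m : ℕ) :
    bellPoly m x = g m := by
  induction m using Nat.strong_induction_on with
  | _ m ih =>
    rcases m with _ | m
    · rw [bellPoly_zero, h0]
    · rw [bellPoly_succ, h]
      exact sum_congr rfl fun i hi => by rw [ih i (mem_range.1 hi)]

theorem bellPoly_congr {m : ℕ} {x y : ℕ → ℂ} (h : ∀ a, a ≠ 0 → x a = y a) :
    bellPoly m x = bellPoly m y :=
  bellPoly_eq_of_rec (g := fun m => bellPoly m y) (bellPoly_zero y) (fun m => by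
    rw [bellPoly_succ]; exact sum_congr rfl fun i _ => by rw [h _ (Nat.succ_ne_zero _)]) m

/-- Leibniz applied to `g' = g · (log g)'` is the Bell recursion. No branch of the logarithm is
needed. -/
theorem bellPoly_iteratedDeriv_logDeriv {g : ℂ → ℂ} (hg : AnalyticAt ℂ g 0) (h0 : g 0 = 1) (m : ℕ) :
    bellPoly m (fun a => iteratedDeriv (a - 1) (logDeriv g) 0) = iteratedDeriv m g 0 := by
  refine bellPoly_eq_of_rec (g := fun m => iteratedDeriv m g 0) (by simpa using h0) (fun m => ?_) m
  have hne : g 0 ≠ 0 := by rw [h0]; exact one_ne_zero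
  have hl : AnalyticAt ℂ (logDeriv g) 0 := hg.deriv.div hg hne
  have hev : deriv g =ᶠ[nhds 0] g * logDeriv g := by
    filter_upwards [hg.continuousAt.eventually_ne hne] with t ht
    rw [Pi.mul_apply, logDeriv_apply, mul_div_cancel₀ _ ht]
  rw [iteratedDeriv_succ', hev.iteratedDeriv_eq, iteratedDeriv_mul hg.contDiffAt hl.contDiffAt]
  rfl

/-- As a function of `t`, the logarithmic derivative is that of `θ(z + t)` minus that of `θ(t)/t`.
The first yields `(ln θ)^{(l+1)}(z)`, the second the Eisenstein term. -/
theorem iteratedDeriv_logDeriv_kronMul {τ : ℂ} (hτ : 0 < τ.im) {z : ℂ} (hz : z ∉ Lat τ) (l : ℕ) :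
    iteratedDeriv l (logDeriv (kronMul τ z)) 0 = EStar τ (l + 1) z := by
  set U := Metric.ball (0 : ℂ) (min 1 (2 * Real.pi * τ.im)) with hU
  have hUo : IsOpen U := Metric.isOpen_ball
  have h0 : (0 : ℂ) ∈ U := Metric.mem_ball_self (by positivity)
  have hθ := differentiable_theta hτ
  have hd := differentiable_thetaDiv hτ
  have hz0 : theta τ z ≠ 0 := mt (theta_eq_zero_iff hτ z).1 hz
  have hs : Differentiable ℂ fun t => theta τ (z + t) := hθ.comp (differentiable_id.const_add z)
  have hsne : ∀ᶠ t in nhds 0, theta τ (z + t) ≠ 0 :=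
    hs.continuous.continuousAt.eventually_ne (by simpa using hz0)
  have h1 : logDeriv (kronMul τ z) =ᶠ[nhds 0]
      (fun t => logDeriv (theta τ) (z + t)) - logDeriv (thetaDiv τ) := by
    filter_upwards [hUo.mem_nhds h0, hsne] with t ht hst
    have hdt := thetaDiv_ne_zero hτ ht
    have : kronMul τ z = fun t => theta τ (z + t) / (theta τ z * thetaDiv τ t) := rfl
    rw [this, logDeriv_div (f := fun t => theta τ (z + t)) (g := fun t => theta τ z * thetaDiv τ t) t hst (mul_ne_zero hz0 hdt) (hs t)
      ((hd t).const_mul _), logDeriv_const_mul t _ hz0, Pi.sub_apply, logDeriv_apply,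
      deriv_comp_const_add, logDeriv_apply (theta τ)]
  have hl1 : AnalyticAt ℂ (fun t => logDeriv (theta τ) (z + t)) 0 := by
    have : AnalyticAt ℂ (logDeriv (theta τ)) (z + 0) := by
      rw [add_zero]; exact (hθ.analyticAt z).deriv.div (hθ.analyticAt z) hz0
    exact this.comp (analyticAt_const.add analyticAt_id)
  have hl2 : AnalyticAt ℂ (logDeriv (thetaDiv τ)) 0 :=
    (hd.analyticAt 0).deriv.div (hd.analyticAt 0) (thetaDiv_ne_zero hτ h0)
  rw [h1.iteratedDeriv_eq, iteratedDeriv_sub hl1.contDiffAt hl2.contDiffAt,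
    iteratedDeriv_logDeriv_thetaDiv_eq_eisG hτ, iteratedDeriv_comp_const_add, EStar,
    Nat.add_sub_cancel]
  simp only [add_zero]
  ring

theorem bellPoly_EStar {τ : ℂ} (hτ : 0 < τ.im) {z : ℂ} (hz : z ∉ Lat τ) (m : ℕ) :
    bellPoly m (fun a => EStar τ a z) = iteratedDeriv m (kronMul τ z) 0 := by
  rw [← bellPoly_iteratedDeriv_logDeriv (analyticAt_kronMul hτ hz) (kronMul_zero hτ hz)]
  refine bellPoly_congr fun a ha => ?_
  rw [iteratedDeriv_logDeriv_kronMul hτ hz, Nat.sub_add_cancel (Nat.pos_of_ne_zero ha)]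

/-- The product `e^{A(z)t} t θ(z + t) / (θ(z) θ(t))`. -/
def kronHat (τ z t : ℂ) : ℂ := cexp (anomA τ z * t) * kronMul τ z t

/-- The Bell polynomials of `𝓔*₁ + A, 𝓔*₂, …` are the Taylor coefficients of the product of the
Kronecker function with `e^{At}`. -/
theorem bellPoly_EStarHat {τ : ℂ} (hτ : 0 < τ.im) {z : ℂ} (hz : z ∉ Lat τ) (m : ℕ) :
    bellPoly m (fun a => EStarHat τ a z) =
      iteratedDeriv m (kronHat τ z) 0 := by
  have hk := analyticAt_kronMul hτ hz
  have hk0 := kronMul_zero hτ hz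
  have hexp : AnalyticAt ℂ (fun t => cexp (anomA τ z * t)) 0 := by fun_prop
  have hg : AnalyticAt ℂ (kronHat τ z) 0 := hexp.mul hk
  rw [← bellPoly_iteratedDeriv_logDeriv hg (by simp [kronHat, hk0])]
  refine bellPoly_congr fun a ha => ?_
  obtain ⟨l, rfl⟩ := Nat.exists_eq_succ_of_ne_zero ha
  have hev : logDeriv (kronHat τ z) =ᶠ[nhds 0]
      (fun _ => anomA τ z) + logDeriv (kronMul τ z) := by
    filter_upwards [hk.continuousAt.eventually_ne (by rw [hk0]; exact one_ne_zero),
      hk.eventually_analyticAt] with t ht hat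
    have he : kronHat τ z = fun t => cexp (anomA τ z * t) * kronMul τ z t := rfl
    rw [he, logDeriv_mul (f := fun t => cexp (anomA τ z * t)) t (Complex.exp_ne_zero _) ht
      (by fun_prop) hat.differentiableAt]
    have h : HasDerivAt (fun t => cexp (anomA τ z * t)) (cexp (anomA τ z * t) * (anomA τ z * 1)) t :=
      ((hasDerivAt_id t).const_mul _).cexp
    rw [logDeriv_apply, h.deriv, Pi.add_apply, mul_one, mul_div_cancel_left₀ _ (Complex.exp_ne_zero _)]
  have hl : AnalyticAt ℂ (logDeriv (kronMul τ z)) 0 :=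
    hk.deriv.div hk (by rw [hk0]; exact one_ne_zero)
  rw [Nat.succ_sub_one, hev.iteratedDeriv_eq, iteratedDeriv_add contDiffAt_const hl.contDiffAt,
    iteratedDeriv_logDeriv_kronMul hτ hz, iteratedDeriv_const, EStarHat]
  rcases l with _ | l
  · simp [add_comm]
  · simp

theorem bellPoly_EStarHat_eq_sum {τ : ℂ} (hτ : 0 < τ.im) {z : ℂ} (hz : z ∉ Lat τ) (m : ℕ) :
    bellPoly m (fun a => EStarHat τ a z) = ∑ i ∈ range (m + 1),
      (m.choose i : ℂ) * bellPoly i (fun a => EStar τ a z) * anomA τ z ^ (m - i) := by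
  have hexp : AnalyticAt ℂ (fun t => cexp (anomA τ z * t)) 0 := by fun_prop
  have h := iteratedDeriv_mul (n := m) (analyticAt_kronMul hτ hz).contDiffAt hexp.contDiffAt
  rw [bellPoly_EStarHat hτ hz]
  simp only [bellPoly_EStar hτ hz]
  rw [show kronHat τ z =
    kronMul τ z * fun t => cexp (anomA τ z * t) from funext fun t => mul_comm _ _, h]
  refine sum_congr rfl fun i _ => ?_
  rw [iteratedDeriv_cexp_const_mul]
  simp

/-- The regular part is `(kronMul - 1)/t`, so its derivative of order `|b| - 1` at `0` is that of
`kronMul` of order `|b|`, divided by `|b|`. -/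
theorem gwT_eq_partitionSum {n : ℕ} {τ : ℂ} (hτ : 0 < τ.im) {z : Fin n → ℂ}
    (hz : z ∈ traceDomain n τ) : gwT τ z = partitionSum (EStar τ) z := by
  rw [gwT_eq_sum_partSum hτ hz, partitionSum]
  refine sum_congr rfl fun j _ => ?_
  refine partSum_congr fun b _ hb => ?_
  obtain ⟨h1, h2⟩ := re_sum_pos_lt hz hb
  have hL := notMem_Lat_of_re h1 h2
  rw [bellPoly_EStar hτ hL, iteratedDeriv_kronReg hτ hL, Nat.sub_add_cancel hb.card_pos]

theorem sum_mem_notMem_Lat {n : ℕ} {τ : ℂ} {z : Fin n → ℂ} (hz : z ∈ regularLocus n τ) {j : Fin n}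
    {b : Finset (Fin n)} (hb : b ⊆ univ.erase j) (hb' : b.Nonempty) : ∑ i ∈ b, z i ∉ Lat τ :=
  hz b hb' fun h => notMem_erase j univ (hb (h ▸ mem_univ j))

/-- Summing over subsets of a block according to their size gives the binomial coefficients of the
Leibniz expansion. -/
theorem explicitSum_eq_partitionSum {n : ℕ} {τ : ℂ} (hτ : 0 < τ.im) {z : Fin n → ℂ}
    (hz : z ∈ regularLocus n τ) : explicitSum τ z = partitionSum (EStarHat τ) z := by
  refine sum_congr rfl fun j _ => ?_
  refine partSum_congr fun b hb hb' => ?_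
  have hL := sum_mem_notMem_Lat hz hb hb'
  have h : ∀ s ∈ b.powerset, bellPoly s.card (fun a => EStar τ a (∑ i ∈ b, z i)) *
        anomA τ (∑ i ∈ b, z i) ^ (b \ s).card = (fun m => bellPoly m (fun a => EStar τ a (∑ i ∈ b, z i)) *
        anomA τ (∑ i ∈ b, z i) ^ (b.card - m)) s.card := fun s hs => by
    rw [card_sdiff_of_subset (mem_powerset.1 hs)]
  rw [bellPoly_EStarHat_eq_sum hτ hL, sum_congr rfl h, sum_powerset_apply_card (fun m => bellPoly m
    (fun a => EStar τ a (∑ i ∈ b, z i)) * anomA τ (∑ i ∈ b, z i) ^ (b.card - m)), one_div_mul_eq_div]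
  simp only [nsmul_eq_mul, mul_assoc]

end BellPolynomials

/-! ### Ellipticity of the completed Kronecker function. -/

section Ellipticity

theorem anomA_add_period {τ : ℂ} (hτ : 0 < τ.im) (z : ℂ) (a b : ℤ) :
    anomA τ (z + (2 * Real.pi * I * a + 2 * Real.pi * I * τ * b)) = anomA τ z + b := by
  have h := Complex.two_pi_I_ne_zero
  rw [anomA, anomA, show (z + (2 * Real.pi * I * a + 2 * Real.pi * I * τ * b)) / (2 * Real.pi * I) =
    z / (2 * Real.pi * I) + a + τ * b by field_simp; ring]
  have : (z / (2 * Real.pi * I) + a + τ * b).im = (z / (2 * Real.pi * I)).im + τ.im * b := by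
    simp [mul_im]
  rw [this, add_div, mul_div_cancel_left₀ _ hτ.ne']
  push_cast; rfl

theorem add_mem_Lat_iff {τ l : ℂ} (hl : l ∈ Lat τ) (z : ℂ) : z + l ∈ Lat τ ↔ z ∈ Lat τ := by
  obtain ⟨a, b, rfl⟩ := hl
  constructor
  · rintro ⟨c, d, h⟩
    exact ⟨c - a, d - b, by push_cast; linear_combination h⟩
  · rintro ⟨c, d, rfl⟩
    exact ⟨c + a, d + b, by push_cast; ring⟩

theorem sum_mem_Lat {ι : Type*} {τ : ℂ} {l : ι → ℂ} (hl : ∀ i, l i ∈ Lat τ) (s : Finset ι) :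
    ∑ i ∈ s, l i ∈ Lat τ := by
  classical
  induction s using Finset.induction_on with
  | empty => simpa using zero_mem_Lat τ
  | insert i s hi ih => rw [sum_insert hi]; exact (add_mem_Lat_iff ih _).2 (hl i)

/-- The automorphy factors of `θ(z + t)` and `θ(z)` differ by `e^{-bt}`, while `A` grows by `b`, so
`e^{At}` compensates. -/
theorem kronHat_add_period {τ l : ℂ} (hτ : 0 < τ.im) (z : ℂ) (hl : l ∈ Lat τ) :
    kronHat τ (z + l) = kronHat τ z := by
  obtain ⟨a, b, rfl⟩ := hl
  funext t
  rw [kronHat, kronHat, anomA_add_period hτ, kronMul, kronMul, add_right_comm, theta_add_period,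
    theta_add_period, show Real.pi * I * a - Real.pi * I * b - Real.pi * I * τ * b ^ 2 - b * (z + t) =
      (Real.pi * I * a - Real.pi * I * b - Real.pi * I * τ * b ^ 2 - b * z) + -(b * t) by ring,
    Complex.exp_add, mul_assoc (cexp _) (theta τ z), mul_assoc (cexp _), mul_div_mul_left _ _ (Complex.exp_ne_zero _),
    mul_div_assoc, ← mul_assoc, ← Complex.exp_add]
  congr 2; ring

theorem isElliptic_partitionSum_EStarHat (n : ℕ) :
    IsElliptic fun τ (z : Fin n → ℂ) => partitionSum (EStarHat τ) z := by
  intro τ hτ z hz l hl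
  refine sum_congr rfl fun j _ => ?_
  refine partSum_congr fun b hb hb' => ?_
  have hL := sum_mem_notMem_Lat hz hb hb'
  have hl' := sum_mem_Lat hl b
  simp only [Pi.add_apply, sum_add_distrib]
  rw [bellPoly_EStarHat hτ hL, bellPoly_EStarHat hτ (mt (add_mem_Lat_iff hl' _).1 hL),
    kronHat_add_period hτ _ hl']

end Ellipticity

section Modularity

/-! ### Transformation of theta under the modular group. -/

open Matrix (SpecialLinearGroup)

/-- The automorphy factor `cτ + d`. -/
def autFactor (g : SpecialLinearGroup (Fin 2) ℤ) (τ : ℂ) : ℂ := g 1 0 * τ + g 1 1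

/-- The Moebius transform `(aτ + b) / (cτ + d)`. -/
def moebius (g : SpecialLinearGroup (Fin 2) ℤ) (τ : ℂ) : ℂ := (g 0 0 * τ + g 0 1) / autFactor g τ

theorem det_eq_one (g : SpecialLinearGroup (Fin 2) ℤ) : (g 0 0 * g 1 1 - g 0 1 * g 1 0 : ℂ) = 1 := by
  have h := g.2
  rw [Matrix.det_fin_two] at h
  exact_mod_cast h

theorem autFactor_ne_zero (g : SpecialLinearGroup (Fin 2) ℤ) {τ : ℂ} (hτ : 0 < τ.im) :
    autFactor g τ ≠ 0 := by
  intro h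
  have h1 := congr_arg im h
  have h2 := congr_arg re h
  simp only [autFactor, add_im, mul_im, intCast_re, intCast_im, zero_mul, add_zero, zero_im,
    mul_eq_zero, hτ.ne', or_false] at h1
  simp only [autFactor, add_re, mul_re, intCast_re, intCast_im, zero_mul, sub_zero, zero_re, h1,
    zero_add] at h2
  have h3 := det_eq_one g
  have h4 : (g 1 0 : ℂ) = 0 := by exact_mod_cast h1
  have h5 : (g 1 1 : ℂ) = 0 := by exact_mod_cast h2
  rw [h4, h5] at h3
  simp at h3

theorem im_moebius (g : SpecialLinearGroup (Fin 2) ℤ) {τ : ℂ} (hτ : 0 < τ.im) :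
    (moebius g τ).im = τ.im / normSq (autFactor g τ) := by
  have h0 := autFactor_ne_zero g hτ
  have h1 : normSq (autFactor g τ) ≠ 0 := (map_ne_zero _).2 h0
  have h2 := det_eq_one g
  have h3 : (g 0 0 * g 1 1 - g 0 1 * g 1 0 : ℝ) = 1 := by exact_mod_cast h2
  rw [moebius, div_im]
  field_simp
  simp only [autFactor, add_im, mul_im, intCast_re, intCast_im, zero_mul, add_zero, add_re, mul_re,
    sub_zero]
  linear_combination τ.im * h3

theorem im_moebius_pos (g : SpecialLinearGroup (Fin 2) ℤ) {τ : ℂ} (hτ : 0 < τ.im) :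
    0 < (moebius g τ).im := by
  rw [im_moebius g hτ]
  exact div_pos hτ (normSq_pos.2 (autFactor_ne_zero g hτ))

theorem autFactor_mul (g h : SpecialLinearGroup (Fin 2) ℤ) {τ : ℂ} (hτ : 0 < τ.im) :
    autFactor (g * h) τ = autFactor g (moebius h τ) * autFactor h τ := by
  have h0 := autFactor_ne_zero h hτ
  rw [autFactor, autFactor, moebius, Matrix.SpecialLinearGroup.coe_mul, Matrix.mul_apply, Matrix.mul_apply, Fin.sum_univ_two,
    Fin.sum_univ_two]
  push_cast
  field_simp
  rw [autFactor]
  ring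

theorem moebius_mul (g h : SpecialLinearGroup (Fin 2) ℤ) {τ : ℂ} (hτ : 0 < τ.im) :
    moebius (g * h) τ = moebius g (moebius h τ) := by
  have h0 := autFactor_ne_zero h hτ
  have h1 := autFactor_ne_zero g (im_moebius_pos h hτ)
  have h2 : moebius h τ * autFactor h τ = h 0 0 * τ + h 0 1 := by rw [moebius, div_mul_cancel₀ _ h0]
  have h3 : moebius g (moebius h τ) = (g 0 0 * moebius h τ + g 0 1) / autFactor g (moebius h τ) := rfl
  have h4 : autFactor h τ = h 1 0 * τ + h 1 1 := rfl
  rw [h3, moebius, autFactor_mul g h hτ, div_eq_div_iff (mul_ne_zero h1 h0) h1,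
    Matrix.SpecialLinearGroup.coe_mul, Matrix.mul_apply, Matrix.mul_apply,
    Fin.sum_univ_two, Fin.sum_univ_two]
  push_cast
  linear_combination (-autFactor g (moebius h τ) * g 0 0) * h2 -
    autFactor g (moebius h τ) * g 0 1 * h4

theorem autFactor_one (τ : ℂ) : autFactor 1 τ = 1 := by simp [autFactor]

theorem moebius_one (τ : ℂ) : moebius 1 τ = τ := by simp [moebius, autFactor_one]

/-- The additive cocycle relation for `c/(cτ + d)`: it makes the Gaussian factors of theta compose
correctly. -/
theorem autFactor_cocycle (g h : SpecialLinearGroup (Fin 2) ℤ) {τ : ℂ} (hτ : 0 < τ.im) :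
    ((g * h) 1 0 : ℂ) / autFactor (g * h) τ =
      g 1 0 / (autFactor g (moebius h τ) * autFactor h τ ^ 2) + h 1 0 / autFactor h τ := by
  have h0 := autFactor_ne_zero h hτ
  have h1 := autFactor_ne_zero g (im_moebius_pos h hτ)
  have h2 := det_eq_one h
  have h3 := autFactor_mul g h hτ
  rw [h3, div_add_div _ _ (mul_ne_zero h1 (pow_ne_zero 2 h0)) h0, div_eq_div_iff (mul_ne_zero h1 h0)
    (mul_ne_zero (mul_ne_zero h1 (pow_ne_zero 2 h0)) h0)]
  have h4 : ((g * h) 1 0 : ℂ) = g 1 0 * h 0 0 + g 1 1 * h 1 0 := by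
    rw [Matrix.SpecialLinearGroup.coe_mul, Matrix.mul_apply, Fin.sum_univ_two]; push_cast; rfl
  have h5 : autFactor g (moebius h τ) * autFactor h τ =
      g 1 0 * (h 0 0 * τ + h 0 1) + g 1 1 * autFactor h τ := by
    rw [autFactor, moebius]; field_simp
  have h6 : autFactor h τ = h 1 0 * τ + h 1 1 := rfl
  rw [h4]
  have h7 : (g 1 0 * h 0 0 + g 1 1 * h 1 0 : ℂ) * autFactor h τ =
      g 1 0 + (autFactor g (moebius h τ) * autFactor h τ) * h 1 0 := by
    rw [h5, h6]; linear_combination (g 1 0 : ℂ) * h2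
  linear_combination (autFactor g (moebius h τ) * autFactor h τ ^ 2) * h7

/-- Comparing derivatives at `z = 0` determines `K`, so normalizing by `θ'(0) = 1` removes the
multiplier system and leaves the factor `j⁻¹`. -/
theorem theta_transform_of_thetaSeries {τ τ' j β K : ℂ} (hτ : 0 < τ.im) (hτ' : 0 < τ'.im)
    (hj : j ≠ 0) (hK : K ≠ 0)
    (h : ∀ z, thetaSeries τ' (z / j) = K * cexp (β * z ^ 2) * thetaSeries τ z) (z : ℂ) :
    theta τ' (z / j) = j⁻¹ * cexp (β * z ^ 2) * theta τ z := by
  have h1 : HasDerivAt (fun z => thetaSeries τ' (z / j)) (deriv (thetaSeries τ') 0 * (1 / j)) 0 := by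
    have h2 : HasDerivAt (thetaSeries τ') (deriv (thetaSeries τ') 0) ((0 : ℂ) / j) := by
      rw [zero_div]; exact (differentiable_thetaSeries hτ' 0).hasDerivAt
    exact h2.comp 0 ((hasDerivAt_id (0 : ℂ)).div_const j)
  have h2 : HasDerivAt (fun z => thetaSeries τ' (z / j)) (K * deriv (thetaSeries τ) 0) 0 := by
    rw [funext h]
    have h3 : HasDerivAt (fun z : ℂ => K * cexp (β * z ^ 2)) (deriv (fun z : ℂ => K * cexp (β * z ^ 2)) 0) 0 :=
      DifferentiableAt.hasDerivAt (by fun_prop)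
    have h4 := h3.fun_mul (differentiable_thetaSeries hτ 0).hasDerivAt
    refine h4.congr_deriv ?_
    simp [thetaSeries_zero hτ]
  have h3 := h1.unique h2
  have h4 := deriv_thetaSeries_ne_zero hτ
  have h5 := deriv_thetaSeries_ne_zero hτ'
  rw [theta, theta, h]
  have h6 : deriv (thetaSeries τ') 0 = j * K * deriv (thetaSeries τ) 0 := by
    field_simp at h3
    linear_combination h3
  rw [h6]
  field_simp

/-- `(m + 1/2)² = m(m + 1) + 1/4`, and `m(m + 1)` is even. -/
theorem thetaSeries_add_one (τ z : ℂ) :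
    thetaSeries (τ + 1) z = cexp (Real.pi * I / 4) * thetaSeries τ z := by
  rw [thetaSeries, thetaSeries, ← tsum_mul_left]
  refine tsum_congr fun m => ?_
  rw [← Complex.exp_add, ← Complex.exp_add, ← Complex.exp_add, ← Complex.exp_add,
    ← Complex.exp_add, Complex.exp_eq_exp_iff_exists_int]
  obtain ⟨r, hr⟩ := Int.even_mul_succ_self m
  have hr' : (m : ℂ) * (m + 1) = r + r := by exact_mod_cast hr
  exact ⟨r, by linear_combination (Real.pi * I : ℂ) * hr'⟩

/-- The functional equation of `jacobiTheta₂` at the shifted argument `z/2πi + 1/2 + τ/2`. The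
corresponding shift at `-1/τ` differs by one quasi-period, which `h2` accounts for. -/
theorem exists_thetaSeries_inv {τ : ℂ} (hτ : 0 < τ.im) : ∃ K : ℂ, K ≠ 0 ∧ ∀ z,
    thetaSeries (-1 / τ) (z / τ) = K * cexp (1 / τ / (4 * Real.pi * I) * z ^ 2) *
      thetaSeries τ z := by
  have hτ0 : τ ≠ 0 := fun h => by simp [h] at hτ
  have hp : (Real.pi : ℂ) ≠ 0 := by exact_mod_cast Real.pi_ne_zero
  have hr : (-I * τ) ^ (1 / 2 : ℂ) ≠ 0 := by
    rw [Ne, cpow_eq_zero_iff]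
    simp [hτ0, I_ne_zero]
  refine ⟨(-I * τ) ^ (1 / 2 : ℂ) * cexp (-(Real.pi * I / 2)), mul_ne_zero hr (Complex.exp_ne_zero _), fun z => ?_⟩
  have h1 := jacobiTheta₂_functional_equation (z / (2 * Real.pi * I) + 1 / 2 + τ / 2) τ
  have h2 := jacobiTheta₂_add_left' ((z / (2 * Real.pi * I) + 1 / 2 + τ / 2) / τ) (-1 / τ)
  rw [thetaSeries_eq_jacobiTheta₂, thetaSeries_eq_jacobiTheta₂, h1, show
    z / τ / (2 * Real.pi * I) + 1 / 2 + -1 / τ / 2 =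
      (z / (2 * Real.pi * I) + 1 / 2 + τ / 2) / τ + -1 / τ by field_simp; ring, h2]
  generalize jacobiTheta₂ ((z / (2 * Real.pi * I) + 1 / 2 + τ / 2) / τ) (-1 / τ) = J
  have h3 : ∀ R E₁ E₂ E₃ E₄ E₅ E₆ : ℂ, R ≠ 0 → E₁ * E₂ = E₃ * E₄ * (E₅ * E₆) →
      E₁ * (E₂ * J) = R * E₃ * E₄ * (E₅ * (1 / R * E₆ * J)) := fun R E₁ E₂ E₃ E₄ E₅ E₆ h h' => by
    field_simp
    linear_combination J * h'
  refine h3 _ _ _ _ _ _ _ hr ?_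
  rw [← Complex.exp_add, ← Complex.exp_add, ← Complex.exp_add, ← Complex.exp_add]
  rw [Complex.exp_eq_exp_iff_exists_int]
  refine ⟨0, ?_⟩
  field_simp
  ring_nf

/-- The transformation of the theta function under `SL₂(ℤ)`. -/
theorem theta_moebius (g : SpecialLinearGroup (Fin 2) ℤ) : ∀ {τ : ℂ}, 0 < τ.im → ∀ z : ℂ,
    theta (moebius g τ) (z / autFactor g τ) = (autFactor g τ)⁻¹ *
      cexp (g 1 0 / autFactor g τ / (4 * Real.pi * I) * z ^ 2) * theta τ z := by
  -- It suffices to treat `S` and `T`; the cocycle relations propagate the formula to products and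
  -- inverses.
  have hg : g ∈ Subgroup.closure {ModularGroup.S, ModularGroup.T} := by
    rw [SpecialLinearGroup.SL2Z_generators]; trivial
  induction hg using Subgroup.closure_induction with
  | mem g hg =>
    intro τ hτ z
    obtain ⟨K, hK, h⟩ : ∃ K : ℂ, K ≠ 0 ∧ ∀ z, thetaSeries (moebius g τ) (z / autFactor g τ) =
        K * cexp (g 1 0 / autFactor g τ / (4 * Real.pi * I) * z ^ 2) * thetaSeries τ z := by
      rcases hg with rfl | rfl
      · simpa [moebius, autFactor, ModularGroup.coe_S] using exists_thetaSeries_inv hτ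
      · refine ⟨_, Complex.exp_ne_zero (Real.pi * I / 4), fun z => ?_⟩
        simpa [moebius, autFactor, ModularGroup.coe_T] using thetaSeries_add_one τ z
    exact theta_transform_of_thetaSeries hτ (im_moebius_pos g hτ) (autFactor_ne_zero g hτ) hK h z
  | one => intro τ _ z; simp [autFactor_one, moebius_one]
  | mul g h _ _ hg hh =>
    intro τ hτ z
    have h0 := autFactor_ne_zero h hτ
    have h1 := autFactor_ne_zero g (im_moebius_pos h hτ)
    rw [autFactor_cocycle g h hτ, autFactor_mul g h hτ, moebius_mul g h hτ, mul_comm (autFactor g _),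
      ← div_div, hg (im_moebius_pos h hτ), hh hτ, mul_inv, add_div, add_mul, Complex.exp_add]
    have : (g 1 0 : ℂ) / autFactor g (moebius h τ) / (4 * Real.pi * I) * (z / autFactor h τ) ^ 2 =
      g 1 0 / (autFactor g (moebius h τ) * autFactor h τ ^ 2) / (4 * Real.pi * I) * z ^ 2 := by
      field_simp
    rw [this]; ring
  | inv g _ hg =>
    intro τ hτ z
    have hi := im_moebius_pos g⁻¹ hτ
    have h1 := hg hi (z / autFactor g⁻¹ τ)
    have h2 := autFactor_cocycle g g⁻¹ hτ
    have h3 := autFactor_mul g g⁻¹ hτ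
    have h4 := autFactor_ne_zero g⁻¹ hτ
    have h5 := autFactor_ne_zero g hi
    rw [mul_inv_cancel, autFactor_one] at h3 h2
    rw [← moebius_mul g g⁻¹ hτ, mul_inv_cancel, moebius_one, div_div, mul_comm (autFactor g⁻¹ τ), ← h3,
      div_one] at h1
    rw [h1]
    have h6 : (g 1 0 : ℂ) / autFactor g (moebius g⁻¹ τ) / (4 * Real.pi * I) * (z / autFactor g⁻¹ τ) ^ 2 =
      -((g⁻¹) 1 0 / autFactor g⁻¹ τ / (4 * Real.pi * I) * z ^ 2) := by
      have : (g 1 0 : ℂ) / autFactor g (moebius g⁻¹ τ) / (4 * Real.pi * I) * (z / autFactor g⁻¹ τ) ^ 2 =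
        g 1 0 / (autFactor g (moebius g⁻¹ τ) * autFactor g⁻¹ τ ^ 2) / (4 * Real.pi * I) * z ^ 2 := by
        field_simp
      rw [this, show (g 1 0 : ℂ) / (autFactor g (moebius g⁻¹ τ) * autFactor g⁻¹ τ ^ 2) =
        -((g⁻¹) 1 0 / autFactor g⁻¹ τ) by
          rw [eq_neg_iff_add_eq_zero, ← h2]; simp]
      ring
    rw [h6, Complex.exp_neg]
    have h7 := Complex.exp_ne_zero ((g⁻¹) 1 0 / autFactor g⁻¹ τ / (4 * Real.pi * I) * z ^ 2)
    field_simp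
    linear_combination (-theta (moebius g⁻¹ τ) (z / autFactor g⁻¹ τ)) * h3

end Modularity

/-! ### Modularity of the completed Kronecker function. -/

section Modularity

open Matrix (SpecialLinearGroup)

/-- With `u = z/2πi` and `j = cτ + d`, `Im(u/j) |j|² = Im u · Re j - Re u · Im j`, and `Im j = c ·
Im τ`. -/
theorem anomA_moebius (g : SpecialLinearGroup (Fin 2) ℤ) {τ : ℂ} (hτ : 0 < τ.im) (z : ℂ) :
    anomA (moebius g τ) (z / autFactor g τ) + g 1 0 * (z / (2 * Real.pi * I)) =
      anomA τ z * autFactor g τ := by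
  have h0 := autFactor_ne_zero g hτ
  have h1 : normSq (autFactor g τ) ≠ 0 := (map_ne_zero _).2 h0
  have h2 : z / autFactor g τ / (2 * Real.pi * I) = z / (2 * Real.pi * I) / autFactor g τ := by
    rw [div_right_comm]
  have hre : (autFactor g τ).re = g 1 0 * τ.re + g 1 1 := by simp [autFactor]
  have him : (autFactor g τ).im = g 1 0 * τ.im := by simp [autFactor]
  rw [anomA, anomA, h2, im_moebius g hτ]
  set u := z / (2 * Real.pi * I)
  have h3 : (u / autFactor g τ).im / (τ.im / normSq (autFactor g τ)) =
      (u.im * (autFactor g τ).re - u.re * (autFactor g τ).im) / τ.im := by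
    rw [div_im]; field_simp
  rw [h3]
  apply Complex.ext
  · simp only [add_re, ofReal_re, mul_re, intCast_re, intCast_im, ofReal_im, him]
    field_simp
    ring
  · simp only [add_im, ofReal_re, mul_im, intCast_re, intCast_im, ofReal_im, him]
    field_simp
    ring

theorem div_autFactor_notMem_Lat (g : SpecialLinearGroup (Fin 2) ℤ) {τ : ℂ} (hτ : 0 < τ.im) {z : ℂ}
    (hz : z ∉ Lat τ) : z / autFactor g τ ∉ Lat (moebius g τ) := by
  rw [← theta_eq_zero_iff (im_moebius_pos g hτ), theta_moebius g hτ, mul_eq_zero, mul_eq_zero,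
    theta_eq_zero_iff hτ]
  simp [autFactor_ne_zero g hτ, Complex.exp_ne_zero, hz]

theorem kronHat_eq {τ : ℂ} (hτ : 0 < τ.im) (z : ℂ) {t : ℂ} (ht : t ≠ 0) :
    kronHat τ z t = cexp (anomA τ z * t) * (t * theta τ (z + t) / (theta τ z * theta τ t)) := by
  rw [kronHat, kronMul, ← mul_thetaDiv hτ t, mul_left_comm, mul_div_mul_left _ _ ht]

/-- The Gaussian factors leave the cross term `(z + t)² - z² - t² = 2zt`, which the transformation
of `A` cancels. The powers of `cτ + d` cancel too, thanks to the factor `t`. -/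
theorem kronHat_moebius (g : SpecialLinearGroup (Fin 2) ℤ) {τ : ℂ} (hτ : 0 < τ.im) {z : ℂ}
    (hz : z ∉ Lat τ) (t : ℂ) :
    kronHat (moebius g τ) (z / autFactor g τ) (t / autFactor g τ) = kronHat τ z t := by
  have h0 := autFactor_ne_zero g hτ
  have h1 := im_moebius_pos g hτ
  by_cases ht : t = 0
  · rw [ht, zero_div, kronHat, kronHat, kronMul_zero hτ hz,
      kronMul_zero h1 (div_autFactor_notMem_Lat g hτ hz)]
    simp
  rw [kronHat_eq h1 _ (div_ne_zero ht h0), kronHat_eq hτ _ ht, ← add_div, theta_moebius g hτ,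
    theta_moebius g hτ, theta_moebius g hτ]
  have h2 := anomA_moebius g hτ z
  have hp := Complex.two_pi_I_ne_zero
  have hp4 : (4 * Real.pi * I : ℂ) ≠ 0 := by
    have := mul_ne_zero two_ne_zero hp
    rwa [← mul_assoc, ← mul_assoc, show (2 * 2 : ℂ) = 4 by norm_num] at this
  set j := autFactor g τ
  set c := (g 1 0 : ℂ) / j / (4 * Real.pi * I) with hc
  have h3 : cexp (anomA (moebius g τ) (z / j) * (t / j)) * cexp (c * (z + t) ^ 2) =
      cexp (anomA τ z * t) * (cexp (c * z ^ 2) * cexp (c * t ^ 2)) := by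
    rw [← Complex.exp_add, ← Complex.exp_add, ← Complex.exp_add]
    congr 1
    have h4 : anomA (moebius g τ) (z / j) = anomA τ z * j - g 1 0 * (z / (2 * Real.pi * I)) := by
      linear_combination h2
    rw [h4, hc]
    field_simp
    ring
  have h5 := Complex.exp_ne_zero (c * z ^ 2)
  have h6 := Complex.exp_ne_zero (c * t ^ 2)
  calc _ = (cexp (anomA (moebius g τ) (z / j) * (t / j)) * cexp (c * (z + t) ^ 2)) *
      (t * theta τ (z + t) / (theta τ z * theta τ t)) / (cexp (c * z ^ 2) * cexp (c * t ^ 2)) := by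
        field_simp
    _ = _ := by rw [h3]; field_simp

theorem iteratedDeriv_comp_mul_left (f : ℂ → ℂ) (c : ℂ) (m : ℕ) :
    iteratedDeriv m (fun t => f (c * t)) = fun t => c ^ m * iteratedDeriv m f (c * t) := by
  induction m with
  | zero => simp
  | succ m ih =>
    rw [iteratedDeriv_succ, ih]
    funext t
    rw [deriv_const_mul_field, deriv_comp_mul_left, iteratedDeriv_succ, smul_eq_mul, pow_succ,
      mul_assoc]

theorem iteratedDeriv_kronHat_moebius (g : SpecialLinearGroup (Fin 2) ℤ) {τ : ℂ} (hτ : 0 < τ.im)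
    {z : ℂ} (hz : z ∉ Lat τ) (m : ℕ) :
    iteratedDeriv m (kronHat (moebius g τ) (z / autFactor g τ)) 0 =
      autFactor g τ ^ m * iteratedDeriv m (kronHat τ z) 0 := by
  have h0 := autFactor_ne_zero g hτ
  have h : kronHat (moebius g τ) (z / autFactor g τ) = fun t => kronHat τ z (autFactor g τ * t) :=
    funext fun t => by rw [← kronHat_moebius g hτ hz, mul_div_cancel_left₀ _ h0]
  rw [h, iteratedDeriv_comp_mul_left]
  simp

theorem partSum_pow_card_mul {ι R : Type*} [DecidableEq ι] [CommRing R] (x : R) (f : Finset ι → R)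
    (s : Finset ι) : partSum (fun b => x ^ b.card * f b) s = x ^ s.card * partSum f s := by
  rw [partSum, partSum, mul_sum]
  refine sum_congr rfl fun P _ => ?_
  rw [prod_mul_distrib, prod_pow_eq_pow_sum, P.sum_card_parts]

theorem isModular_partitionSum_EStarHat (n : ℕ) :
    IsModular (n - 1) fun τ (z : Fin n → ℂ) => partitionSum (EStarHat τ) z := by
  intro τ hτ z hz a b c d habcd
  let g : SpecialLinearGroup (Fin 2) ℤ := ⟨!![a, b; c, d], by rw [Matrix.det_fin_two_of]; exact habcd⟩
  have h1 : autFactor g τ = c * τ + d := rfl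
  have h2 : moebius g τ = (a * τ + b) / (c * τ + d) := rfl
  rw [← h2, ← h1]
  simp only [partitionSum]
  rw [mul_sum]
  refine sum_congr rfl fun j _ => ?_
  -- The weights of the blocks add up to the size of `[n] ∖ {j}`.
  have hcard : n - 1 = (univ.erase j).card := by simp
  rw [hcard]
  refine Eq.trans ?_ (partSum_pow_card_mul (autFactor g τ) (fun b => bellPoly b.card
    (fun a => EStarHat τ a (∑ i ∈ b, z i)) / (b.card : ℂ)) (univ.erase j))
  refine partSum_congr fun b hb hb' => ?_
  have hL := sum_mem_notMem_Lat hz hb hb'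
  rw [← sum_div, bellPoly_EStarHat hτ hL,
    bellPoly_EStarHat (im_moebius_pos g hτ) (div_autFactor_notMem_Lat g hτ hL),
    iteratedDeriv_kronHat_moebius g hτ hL, mul_div_assoc]

end Modularity

/-! ### Holomorphy in `τ` and `z` jointly. -/

section JointHolomorphy

/-- The moments `∑_n n^k e^{2πi n z + πi n² τ}` of the two-variable Jacobi theta series. -/
def jacobiMoment (k : ℕ) (p : ℂ × ℂ) : ℂ := ∑' n : ℤ, (n : ℂ) ^ k * jacobiTheta₂_term n p.1 p.2

/-- Near `p` the Gaussian decay in `n` beats the factor `n^k` and the quadratic growth from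
differentiation, uniformly on a strip times a half-plane. -/
theorem differentiableAt_jacobiMoment (k : ℕ) {p : ℂ × ℂ} (hp : 0 < p.2.im) :
    DifferentiableAt ℂ (jacobiMoment k) p := by
  obtain ⟨T, hT, hτ'⟩ := exists_between hp
  obtain ⟨S, hz⟩ := exists_gt |p.1.im|
  let V : Set (ℂ × ℂ) := {u | |im u| < S} ×ˢ {v | T < im v}
  have hVo : IsOpen V := by
    refine ((_root_.continuous_abs.comp continuous_im).isOpen_preimage _ isOpen_Iio).prod ?_
    exact continuous_im.isOpen_preimage _ isOpen_Ioi
  have hVmem : p ∈ V := ⟨hz, hτ'⟩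
  have hVp : IsPreconnected V := by
    refine (Convex.isPreconnected ?_).prod (convex_halfSpace_im_gt T).isPreconnected
    simpa only [abs_lt] using! (convex_halfSpace_im_gt _).inter (convex_halfSpace_im_lt _)
  have hf (n : ℤ) : ∀ p ∈ V, HasFDerivAt
      (fun p : ℂ × ℂ => (n : ℂ) ^ k * jacobiTheta₂_term n p.1 p.2)
      ((n : ℂ) ^ k • jacobiTheta₂_term_fderiv n p.1 p.2) p :=
    fun p _ => (hasFDerivAt_jacobiTheta₂_term n p.1 p.2).const_mul _
  let u : ℤ → ℝ := fun n =>
    3 * Real.pi * (|n| ^ (k + 2) * Real.exp (-Real.pi * (T * n ^ 2 - 2 * S * |n|)))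
  have hn (n : ℤ) : ‖((n : ℂ)) ^ k‖ = ((|n| : ℤ) : ℝ) ^ k := by
    rw [norm_pow, norm_intCast, Int.cast_abs]
  have hu : ∀ (n : ℤ), ∀ x ∈ V, ‖(n : ℂ) ^ k • jacobiTheta₂_term_fderiv n x.1 x.2‖ ≤ u n := by
    intro n x hx
    rw [norm_smul, hn]
    have h1 := norm_jacobiTheta₂_term_fderiv_le n x.1 x.2
    have h2 := norm_jacobiTheta₂_term_le hT (le_of_lt hx.1) (le_of_lt hx.2) n
    calc _ ≤ ((|n| : ℤ) : ℝ) ^ k * (3 * Real.pi * |n| ^ 2 *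
          Real.exp (-Real.pi * (T * n ^ 2 - 2 * S * |n|))) := by
          refine mul_le_mul_of_nonneg_left (h1.trans ?_) (by positivity)
          exact mul_le_mul_of_nonneg_left h2 (by positivity)
      _ = u n := by simp only [u]; ring
  have hu_sum : Summable u := (summable_pow_mul_jacobiTheta₂_term_bound S hT (k + 2)).mul_left _
  have hf_sum : Summable fun n : ℤ => (n : ℂ) ^ k * jacobiTheta₂_term n p.1 p.2 := by
    refine (summable_pow_mul_jacobiTheta₂_term_bound S hT k).of_norm_bounded fun n => ?_
    rw [norm_mul, hn]
    exact mul_le_mul_of_nonneg_left (norm_jacobiTheta₂_term_le hT hz.le hτ'.le n)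
      (pow_nonneg (Int.cast_nonneg (abs_nonneg n)) k)
  exact (hasFDerivAt_tsum_of_isPreconnected hu_sum hVo hVp hf hu hVmem hf_sum hVmem).differentiableAt

theorem iteratedDeriv_jacobiTheta₂ {τ : ℂ} (hτ : 0 < τ.im) (k : ℕ) (z : ℂ) :
    iteratedDeriv k (fun z => jacobiTheta₂ z τ) z =
      (2 * Real.pi * I) ^ k * jacobiMoment k (z, τ) := by
  obtain ⟨S, hz⟩ := exists_gt |z.im|
  set U := {u : ℂ | |im u| < S}
  have hU : IsOpen U := (_root_.continuous_abs.comp continuous_im).isOpen_preimage _ isOpen_Iio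
  have hs := summable_pow_mul_jacobiTheta₂_term_bound S hτ 0
  have hunif : TendstoUniformlyOn (fun (s : Finset ℤ) z => ∑ n ∈ s, jacobiTheta₂_term n z τ)
      (fun z => jacobiTheta₂ z τ) Filter.atTop U :=
    tendstoUniformlyOn_tsum hs fun n z hz => by
      simpa using norm_jacobiTheta₂_term_le hτ (le_of_lt hz) le_rfl n
  have hterm : ∀ n : ℤ, (fun z => jacobiTheta₂_term n z τ) =
      fun z => cexp (Real.pi * I * n ^ 2 * τ) * cexp ((2 * Real.pi * I * n) * z) := fun n =>
    funext fun z => by rw [jacobiTheta₂_term, ← Complex.exp_add, add_comm]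
  have h := hasSum_iteratedDeriv hU (F := fun (n : ℤ) z => jacobiTheta₂_term n z τ)
    (fun n => by simp only [hterm]; fun_prop) hunif.tendstoLocallyUniformlyOn k hz
  rw [← h.tsum_eq, jacobiMoment, ← tsum_mul_left]
  refine tsum_congr fun n => ?_
  rw [hterm, iteratedDeriv_const_mul_field, iteratedDeriv_cexp_const_mul, jacobiTheta₂_term,
    Complex.exp_add]
  ring

theorem iteratedDeriv_comp_mul_add (f : ℂ → ℂ) (c d : ℂ) (m : ℕ) :
    iteratedDeriv m (fun t => f (c * t + d)) = fun t => c ^ m * iteratedDeriv m f (c * t + d) := by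
  have h := iteratedDeriv_comp_mul_left (fun t => f (d + t)) c m
  rw [iteratedDeriv_comp_const_add] at h
  simpa only [add_comm d] using h

/-- Expresses derivatives in `z` alone through functions already known to be holomorphic in both
variables. -/
theorem iteratedDeriv_thetaSeries {τ : ℂ} (hτ : 0 < τ.im) (k : ℕ) (z : ℂ) :
    iteratedDeriv k (thetaSeries τ) z = ∑ i ∈ range (k + 1), (k.choose i : ℂ) *
      ((1 / 2) ^ i * cexp (1 / 2 * z) * cexp (Real.pi * I / 2 + Real.pi * I * τ / 4)) *
        jacobiMoment (k - i) ((2 * Real.pi * I)⁻¹ * z + (1 / 2 + τ / 2), τ) := by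
  set E : ℂ → ℂ := fun z => cexp (Real.pi * I / 2 + Real.pi * I * τ / 4) * cexp (1 / 2 * z) with hE
  set J : ℂ → ℂ := fun z => jacobiTheta₂ ((2 * Real.pi * I)⁻¹ * z + (1 / 2 + τ / 2)) τ with hJ
  have h : thetaSeries τ = E * J := funext fun z => by
    rw [thetaSeries_eq_jacobiTheta₂, Pi.mul_apply, hE, hJ]
    simp only
    rw [← Complex.exp_add]
    congr 2 <;> ring
  have hEd : Differentiable ℂ E := by simp only [hE]; fun_prop
  have hJd : Differentiable ℂ J := fun z => by
    have h1 := differentiableAt_jacobiTheta₂_fst ((2 * Real.pi * I)⁻¹ * z + (1 / 2 + τ / 2)) hτ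
    have h2 : DifferentiableAt ℂ (fun z : ℂ => (2 * Real.pi * I)⁻¹ * z + (1 / 2 + τ / 2)) z := by
      fun_prop
    exact h1.comp z h2
  rw [h, iteratedDeriv_mul hEd.contDiff.contDiffAt hJd.contDiff.contDiffAt]
  refine sum_congr rfl fun i _ => ?_
  have h0 := pow_ne_zero (k - i) Complex.two_pi_I_ne_zero
  rw [hE, hJ, iteratedDeriv_const_mul_field, iteratedDeriv_cexp_const_mul,
    iteratedDeriv_comp_mul_add (fun z => jacobiTheta₂ z τ)]
  beta_reduce
  rw [iteratedDeriv_jacobiTheta₂ hτ, inv_pow, inv_mul_cancel_left₀ h0]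
  ring

theorem differentiableOn_iteratedDeriv_thetaSeries (k : ℕ) :
    DifferentiableOn ℂ (fun p : ℂ × ℂ => iteratedDeriv k (thetaSeries p.1) p.2)
      {p | 0 < p.1.im} := by
  have h : ∀ p ∈ {p : ℂ × ℂ | 0 < p.1.im}, iteratedDeriv k (thetaSeries p.1) p.2 = _ :=
    fun p hp => iteratedDeriv_thetaSeries hp k p.2
  refine DifferentiableOn.congr ?_ h
  refine DifferentiableOn.fun_sum fun i _ => DifferentiableOn.mul (by fun_prop) ?_
  intro p hp
  have h1 : DifferentiableAt ℂ
      (fun p : ℂ × ℂ => ((2 * Real.pi * I)⁻¹ * p.2 + (1 / 2 + p.1 / 2), p.1)) p := by fun_prop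
  exact ((differentiableAt_jacobiMoment (k - i) (p := ((2 * Real.pi * I)⁻¹ * p.2 + (1 / 2 + p.1 / 2), p.1)) hp).comp p h1).differentiableWithinAt

theorem iteratedDeriv_theta (τ : ℂ) (k : ℕ) (z : ℂ) : iteratedDeriv k (theta τ) z =
    iteratedDeriv k (thetaSeries τ) z / iteratedDeriv 1 (thetaSeries τ) 0 := by
  have : theta τ = fun z => (deriv (thetaSeries τ) 0)⁻¹ * thetaSeries τ z :=
    funext fun z => by rw [theta, div_eq_inv_mul]
  rw [this, iteratedDeriv_const_mul_field, iteratedDeriv_one, div_eq_inv_mul]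

/-- The Taylor coefficients of `t / θ(t)`. -/
def thetaInvCoeff (j : ℕ) (τ : ℂ) : ℂ := iteratedDeriv j ((thetaDiv τ)⁻¹) 0

theorem analyticAt_thetaDiv_inv {τ : ℂ} (hτ : 0 < τ.im) : AnalyticAt ℂ ((thetaDiv τ)⁻¹) 0 :=
  ((differentiable_thetaDiv hτ).analyticAt 0).inv (by simp [thetaDiv_zero hτ])

/-- From `(t/θ) · (θ/t) = 1` by Leibniz. The recursion yields holomorphy in `τ` by induction, the
denominators being `ϑ'(0) ≠ 0`. -/
theorem thetaInvCoeff_eq {τ : ℂ} (hτ : 0 < τ.im) (j : ℕ) : thetaInvCoeff j τ =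
    (if j = 0 then 1 else 0) - ∑ i ∈ range j, (j.choose i : ℂ) * thetaInvCoeff i τ *
      (iteratedDeriv (j - i + 1) (thetaSeries τ) 0 / iteratedDeriv 1 (thetaSeries τ) 0 /
        ((j - i + 1 : ℕ) : ℂ)) := by
  have hd := (differentiable_thetaDiv hτ).analyticAt 0
  have hev : (thetaDiv τ)⁻¹ * thetaDiv τ =ᶠ[nhds 0] fun _ => 1 := by
    filter_upwards [hd.continuousAt.eventually_ne
      (by simp [thetaDiv_zero hτ] : thetaDiv τ 0 ≠ 0)] with t ht
    simp [inv_mul_cancel₀ ht]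
  have h := hev.iteratedDeriv_eq j
  rw [iteratedDeriv_mul (analyticAt_thetaDiv_inv hτ).contDiffAt hd.contDiffAt, sum_range_succ,
    iteratedDeriv_const, Nat.choose_self, Nat.sub_self, iteratedDeriv_zero, thetaDiv_zero hτ] at h
  rw [← h]
  have h2 : ∀ i, iteratedDeriv i (thetaDiv τ) 0 = iteratedDeriv (i + 1) (thetaSeries τ) 0 /
      iteratedDeriv 1 (thetaSeries τ) 0 / ((i + 1 : ℕ) : ℂ) := fun i => by
    rw [thetaDiv, iteratedDeriv_dslope_zero ((differentiable_theta hτ).analyticAt 0),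
      iteratedDeriv_theta]
  simp only [h2, thetaInvCoeff, Nat.cast_one, one_mul, mul_one]
  ring

theorem differentiableOn_thetaInvCoeff (j : ℕ) :
    DifferentiableOn ℂ (thetaInvCoeff j) {τ | 0 < τ.im} := by
  induction j using Nat.strong_induction_on with
  | _ j ih =>
  have hd : ∀ k, DifferentiableOn ℂ (fun τ : ℂ => iteratedDeriv k (thetaSeries τ) 0) {τ | 0 < τ.im} := by
    intro k
    have h1 : DifferentiableOn ℂ (fun τ : ℂ => (τ, (0 : ℂ))) {τ | 0 < τ.im} := by fun_prop
    have h2 : Set.MapsTo (fun τ : ℂ => (τ, (0 : ℂ))) {τ | 0 < τ.im} {p : ℂ × ℂ | 0 < p.1.im} :=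
      fun _ h => h
    have h3 := (differentiableOn_iteratedDeriv_thetaSeries k).comp h1 h2
    simpa only [Function.comp_def] using h3
  refine DifferentiableOn.congr ?_ fun τ hτ => thetaInvCoeff_eq hτ j
  refine (differentiableOn_const _).fun_sub (DifferentiableOn.fun_sum fun i hi => ?_)
  have h1 : DifferentiableOn ℂ (fun τ : ℂ => iteratedDeriv (j - i + 1) (thetaSeries τ) 0 /
      iteratedDeriv 1 (thetaSeries τ) 0) {τ | 0 < τ.im} :=
    (hd (j - i + 1)).fun_div (hd 1) fun τ hτ => by
      rw [iteratedDeriv_one]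
      exact deriv_thetaSeries_ne_zero hτ
  exact ((ih i (mem_range.1 hi)).const_mul _).fun_mul (h1.div_const _)

/-- Writes the Taylor coefficient as a quotient of jointly holomorphic functions whose denominator
vanishes only on the polar divisor, as `IsMero` requires. -/
theorem iteratedDeriv_kronMul {τ : ℂ} (hτ : 0 < τ.im) (z : ℂ) (m : ℕ) :
    iteratedDeriv m (kronMul τ z) 0 = (∑ i ∈ range (m + 1), (m.choose i : ℂ) *
      iteratedDeriv i (thetaSeries τ) z * thetaInvCoeff (m - i) τ) / thetaSeries τ z := by
  have h : kronMul τ z = fun t => (theta τ z)⁻¹ * ((fun t => theta τ (z + t)) * (thetaDiv τ)⁻¹) t :=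
    funext fun t => by
      simp only [Pi.mul_apply, Pi.inv_apply]
      rw [kronMul, div_eq_mul_inv, mul_inv]; ring
  have hs : Differentiable ℂ fun t => theta τ (z + t) :=
    (differentiable_theta hτ).comp (differentiable_id.const_add z)
  rw [h, iteratedDeriv_const_mul_field, iteratedDeriv_mul hs.contDiff.contDiffAt
    (analyticAt_thetaDiv_inv hτ).contDiffAt, mul_sum, sum_div]
  refine sum_congr rfl fun i _ => ?_
  rw [iteratedDeriv_comp_const_add]
  simp only [add_zero]
  rw [iteratedDeriv_theta, theta, iteratedDeriv_one, thetaInvCoeff]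
  have := deriv_thetaSeries_ne_zero hτ
  field_simp

end JointHolomorphy

/-! ### Rings of meromorphic and almost meromorphic functions. -/

section Meromorphy

variable {n : ℕ}

theorem isOpen_upperHalf (n : ℕ) : IsOpen {p : ℂ × (Fin n → ℂ) | 0 < p.1.im} :=
  isOpen_lt continuous_const (continuous_im.comp continuous_fst)

theorem isMero_of_div {c g h : ℂ × (Fin n → ℂ) → ℂ}
    (hg : DifferentiableOn ℂ g {p | 0 < p.1.im}) (hh : DifferentiableOn ℂ h {p | 0 < p.1.im})
    (hc : ∀ p : ℂ × (Fin n → ℂ), 0 < p.1.im → p.2 ∈ regularLocus n p.1 → h p ≠ 0 ∧ c p = g p / h p) :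
    IsMero c := fun _ hp =>
  ⟨_, g, h, isOpen_upperHalf n, hp, hg, hh, fun x _ hx hx' => hc x hx hx'⟩

theorem isMero_const (a : ℂ) : IsMero fun _ : ℂ × (Fin n → ℂ) => a :=
  isMero_of_div (g := fun _ => a) (h := fun _ => 1) (differentiableOn_const _)
    (differentiableOn_const _) fun _ _ _ => ⟨one_ne_zero, by simp⟩

theorem IsMero.add {c d : ℂ × (Fin n → ℂ) → ℂ} (hc : IsMero c) (hd : IsMero d) :
    IsMero (c + d) := fun p hp => by
  obtain ⟨V, g, h, hV, hpV, hg, hh, hgh⟩ := hc p hp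
  obtain ⟨V', g', h', hV', hpV', hg', hh', hgh'⟩ := hd p hp
  have h1 : V ∩ V' ⊆ V := Set.inter_subset_left
  have h2 : V ∩ V' ⊆ V' := Set.inter_subset_right
  refine ⟨V ∩ V', fun x => g x * h' x + h x * g' x, fun x => h x * h' x, hV.inter hV', ⟨hpV, hpV'⟩,
    ((hg.mono h1).mul (hh'.mono h2)).add ((hh.mono h1).mul (hg'.mono h2)),
    (hh.mono h1).mul (hh'.mono h2), fun x hx hx1 hx2 => ?_⟩
  obtain ⟨h3, h4⟩ := hgh x hx.1 hx1 hx2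
  obtain ⟨h5, h6⟩ := hgh' x hx.2 hx1 hx2
  exact ⟨mul_ne_zero h3 h5, by rw [Pi.add_apply, h4, h6, div_add_div _ _ h3 h5]⟩

theorem IsMero.mul {c d : ℂ × (Fin n → ℂ) → ℂ} (hc : IsMero c) (hd : IsMero d) :
    IsMero (c * d) := fun p hp => by
  obtain ⟨V, g, h, hV, hpV, hg, hh, hgh⟩ := hc p hp
  obtain ⟨V', g', h', hV', hpV', hg', hh', hgh'⟩ := hd p hp
  have h1 : V ∩ V' ⊆ V := Set.inter_subset_left
  have h2 : V ∩ V' ⊆ V' := Set.inter_subset_right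
  refine ⟨V ∩ V', fun x => g x * g' x, fun x => h x * h' x, hV.inter hV', ⟨hpV, hpV'⟩,
    (hg.mono h1).mul (hg'.mono h2), (hh.mono h1).mul (hh'.mono h2), fun x hx hx1 hx2 => ?_⟩
  obtain ⟨h3, h4⟩ := hgh x hx.1 hx1 hx2
  obtain ⟨h5, h6⟩ := hgh' x hx.2 hx1 hx2
  exact ⟨mul_ne_zero h3 h5, by rw [Pi.mul_apply, h4, h6, div_mul_div_comm]⟩

/-- The ring of meromorphic functions with poles along the divisors `z_S ∈ Λ_τ`. -/
def meroRing (n : ℕ) : Subring (ℂ × (Fin n → ℂ) → ℂ) where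
  carrier := {c | IsMero c}
  mul_mem' := IsMero.mul
  one_mem' := isMero_const 1
  add_mem' := IsMero.add
  zero_mem' := isMero_const 0
  neg_mem' {c} hc := by
    have := (isMero_const (-1)).mul hc
    rwa [show (fun _ : ℂ × (Fin n → ℂ) => (-1 : ℂ)) * c = -c by ext; simp] at this

/-- Evaluation at `p` of a polynomial in `A(z₁), …, A(z_n)` with meromorphic coefficients. -/
def almostEval (p : ℂ × (Fin n → ℂ)) : MvPolynomial (Fin n) (meroRing n) →+* ℂ :=
  MvPolynomial.eval₂Hom ((Pi.evalRingHom _ p).comp (meroRing n).subtype)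
    fun i => anomA p.1 (p.2 i)

/-- Pairs of functions such that the first is a polynomial in the `A(zᵢ)` with meromorphic
coefficients and the second is its constant coefficient. -/
def almostMeroRing (n : ℕ) : Subring (ℂ × (Fin n → ℂ) → ℂ × ℂ) where
  carrier := {F | ∃ P : MvPolynomial (Fin n) (meroRing n), ∀ p : ℂ × (Fin n → ℂ), 0 < p.1.im →
    p.2 ∈ regularLocus n p.1 → F p = (almostEval p P, (MvPolynomial.constantCoeff P).1 p)}
  mul_mem' := by
    rintro F G ⟨P, hP⟩ ⟨Q, hQ⟩
    exact ⟨P * Q, fun p hp hp' => by rw [Pi.mul_apply, hP p hp hp', hQ p hp hp']; simp⟩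
  one_mem' := ⟨1, fun p _ _ => by simp; rfl⟩
  add_mem' := by
    rintro F G ⟨P, hP⟩ ⟨Q, hQ⟩
    exact ⟨P + Q, fun p hp hp' => by rw [Pi.add_apply, hP p hp hp', hQ p hp hp']; simp⟩
  zero_mem' := ⟨0, fun p _ _ => by simp; rfl⟩
  neg_mem' := by
    rintro F ⟨P, hP⟩
    exact ⟨-P, fun p hp hp' => by rw [Pi.neg_apply, hP p hp hp']; simp⟩

theorem mem_almostMeroRing_of_isMero {c : ℂ × (Fin n → ℂ) → ℂ} (hc : IsMero c) :
    (fun p => (c p, c p)) ∈ almostMeroRing n :=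
  ⟨MvPolynomial.C ⟨c, hc⟩, fun p _ _ => by simp [almostEval]⟩

theorem anomA_mem_almostMeroRing (i : Fin n) :
    (fun p => (anomA p.1 (p.2 i), 0)) ∈ almostMeroRing n :=
  ⟨MvPolynomial.X i, fun p _ _ => by simp [almostEval]⟩

end Meromorphy

/-! ### The completed sum is almost meromorphic with constant coefficient `T_n`. -/

section AlmostMeromorphy

variable {n : ℕ}

theorem isMero_bellPoly_EStar {b : Finset (Fin n)} (hb : b.Nonempty) (hb' : b ≠ univ) (m : ℕ) :
    IsMero fun p => bellPoly m fun a => EStar p.1 a (∑ i ∈ b, p.2 i) := by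
  have hθ : ∀ k, DifferentiableOn ℂ (fun p : ℂ × (Fin n → ℂ) =>
      iteratedDeriv k (thetaSeries p.1) (∑ i ∈ b, p.2 i)) {p | 0 < p.1.im} := fun k => by
    have h1 : DifferentiableOn ℂ (fun p : ℂ × (Fin n → ℂ) => (p.1, ∑ i ∈ b, p.2 i))
        {p | 0 < p.1.im} := by fun_prop
    have h2 : Set.MapsTo (fun p : ℂ × (Fin n → ℂ) => (p.1, ∑ i ∈ b, p.2 i)) {p | 0 < p.1.im}
      {p : ℂ × ℂ | 0 < p.1.im} := fun _ h => h
    have h3 := (differentiableOn_iteratedDeriv_thetaSeries k).comp h1 h2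
    simpa only [Function.comp_def] using h3
  have hc : ∀ k, DifferentiableOn ℂ (fun p : ℂ × (Fin n → ℂ) => thetaInvCoeff k p.1)
      {p | 0 < p.1.im} := fun k => by
    have h1 : DifferentiableOn ℂ (fun p : ℂ × (Fin n → ℂ) => p.1) {p | 0 < p.1.im} := by fun_prop
    have h2 : Set.MapsTo (fun p : ℂ × (Fin n → ℂ) => p.1) {p | 0 < p.1.im} {τ : ℂ | 0 < τ.im} :=
      fun _ h => h
    have h3 := (differentiableOn_thetaInvCoeff k).comp h1 h2
    simpa only [Function.comp_def] using h3
  refine isMero_of_div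
    (DifferentiableOn.fun_sum (u := range (m + 1)) fun i _ => ((hθ i).const_mul (m.choose i : ℂ)).fun_mul (hc (m - i)))
    (hθ 0) fun p hp hreg => ?_
  have hL := hreg b hb hb'
  rw [iteratedDeriv_zero]
  exact ⟨mt (thetaSeries_eq_zero_iff hp _).1 hL, by
    rw [bellPoly_EStar hp hL, iteratedDeriv_kronMul hp]⟩

theorem anomA_sum {ι : Type*} (τ : ℂ) (z : ι → ℂ) (s : Finset ι) :
    anomA τ (∑ i ∈ s, z i) = ∑ i ∈ s, anomA τ (z i) := by
  simp only [anomA, sum_div, im_sum, ofReal_sum]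

theorem mem_almostMeroRing_of_eq {F G : ℂ × (Fin n → ℂ) → ℂ × ℂ} (hG : G ∈ almostMeroRing n)
    (h : ∀ p : ℂ × (Fin n → ℂ), 0 < p.1.im → p.2 ∈ regularLocus n p.1 → F p = G p) :
    F ∈ almostMeroRing n := by
  obtain ⟨P, hP⟩ := hG
  exact ⟨P, fun p hp hp' => (h p hp hp').trans (hP p hp hp')⟩

/-- `A` is additive, so `A(z_b)` is a linear form in the `A(z_i)`. In the Leibniz expansion only the
term `i = m` is free of `A`, which identifies the constant coefficient. -/
theorem bellPoly_EStarHat_mem_almostMeroRing {b : Finset (Fin n)} (hb : b.Nonempty)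
    (hb' : b ≠ univ) (m : ℕ) :
    (fun p : ℂ × (Fin n → ℂ) => (bellPoly m fun a => EStarHat p.1 a (∑ i ∈ b, p.2 i),
      bellPoly m fun a => EStar p.1 a (∑ i ∈ b, p.2 i))) ∈ almostMeroRing n := by
  have hG : (∑ i ∈ range (m + 1), (m.choose i : ℂ × (Fin n → ℂ) → ℂ × ℂ) *
      (fun p => (bellPoly i fun a => EStar p.1 a (∑ i ∈ b, p.2 i),
        bellPoly i fun a => EStar p.1 a (∑ i ∈ b, p.2 i))) *
      (∑ i ∈ b, fun p => (anomA p.1 (p.2 i), 0)) ^ (m - i)) ∈ almostMeroRing n :=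
    sum_mem fun i _ => mul_mem (mul_mem (natCast_mem _ _)
      (mem_almostMeroRing_of_isMero (isMero_bellPoly_EStar hb hb' i)))
        (pow_mem (sum_mem fun i _ => anomA_mem_almostMeroRing i) _)
  refine mem_almostMeroRing_of_eq hG fun p hp hreg => ?_
  have hL := hreg b hb hb'
  simp only [Finset.sum_apply, Pi.mul_apply, Pi.pow_apply, Pi.natCast_apply]
  refine Prod.ext ?_ ?_
  · simp only [Prod.fst_sum, Prod.fst_mul, Prod.pow_fst, Prod.fst_natCast]
    rw [bellPoly_EStarHat_eq_sum hp hL, anomA_sum]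
  · simp only [Prod.snd_sum, Prod.snd_mul, Prod.pow_snd, Prod.snd_natCast, sum_const_zero]
    refine ((sum_eq_single_of_mem m (self_mem_range_succ m) fun i hi hne => ?_).trans ?_).symm
    · have : m - i ≠ 0 := by have := mem_range.1 hi; omega
      rw [zero_pow this, mul_zero]
    · simp

theorem partitionSum_mem_almostMeroRing (n : ℕ) :
    (fun p : ℂ × (Fin n → ℂ) => (partitionSum (EStarHat p.1) p.2, partitionSum (EStar p.1) p.2)) ∈
      almostMeroRing n := by
  have hG : (∑ j : Fin n, ∑ P : Finpartition (univ.erase j), ∏ b ∈ P.parts,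
      (fun p : ℂ × (Fin n → ℂ) => (bellPoly b.card fun a => EStarHat p.1 a (∑ i ∈ b, p.2 i),
        bellPoly b.card fun a => EStar p.1 a (∑ i ∈ b, p.2 i))) *
      fun _ => ((b.card : ℂ)⁻¹, (b.card : ℂ)⁻¹)) ∈ almostMeroRing n := by
    refine sum_mem fun j _ => sum_mem fun P _ => prod_mem fun b hb => mul_mem ?_ ?_
    · exact bellPoly_EStarHat_mem_almostMeroRing (P.nonempty_of_mem_parts hb)
        (fun h => notMem_erase j univ (P.le hb (h ▸ mem_univ j))) _
    · exact mem_almostMeroRing_of_isMero (isMero_const _)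
  convert hG using 1
  funext p
  simp only [Finset.sum_apply, Finset.prod_apply, Pi.mul_apply]
  refine Prod.ext ?_ ?_
  · simp only [Prod.fst_sum, Prod.fst_mul, Prod.fst_prod, partitionSum, div_eq_mul_inv]
  · simp only [Prod.snd_sum, Prod.snd_mul, Prod.snd_prod, partitionSum, div_eq_mul_inv]

theorem traceDomain_subset_regularLocus (n : ℕ) (τ : ℂ) : traceDomain n τ ⊆ regularLocus n τ :=
  fun _ hz _ hS _ => notMem_Lat_of_re (re_sum_pos_lt hz hS).1 (re_sum_pos_lt hz hS).2

theorem isAlmostMeroExtension_of_mem {f fhat F : ℂ → (Fin n → ℂ) → ℂ}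
    (hF : (fun p : ℂ × (Fin n → ℂ) => (fhat p.1 p.2, F p.1 p.2)) ∈ almostMeroRing n)
    (hf : ∀ τ : ℂ, 0 < τ.im → ∀ z ∈ traceDomain n τ, F τ z = f τ z) :
    IsAlmostMeroExtension f fhat := by
  classical
  obtain ⟨P, hP⟩ := hF
  let e := (Finsupp.equivFunOnFinite (α := Fin n) (M := ℕ))
  have he0 : e.symm 0 = 0 := by ext; simp [e]
  -- The index `0` is added by hand because the constant coefficient may be zero and so outside the
  -- support.
  refine ⟨insert 0 (P.support.map e.toEmbedding), fun α => (P.coeff (e.symm α)).1,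
    fun α => (P.coeff (e.symm α)).2, mem_insert_self _ _, fun τ hτ z hz => ?_, fun τ hτ z hz => ?_⟩
  · beta_reduce
    rw [← hf τ hτ z hz, he0]
    exact (congr_arg Prod.snd (hP (τ, z) hτ (traceDomain_subset_regularLocus n τ hz))).symm
  · have h1 : fhat τ z = almostEval (τ, z) P := congr_arg Prod.fst (hP (τ, z) hτ hz)
    have h2 : almostEval (τ, z) P = ∑ α ∈ P.support.map e.toEmbedding,
        (P.coeff (e.symm α)).1 (τ, z) * ∏ i, anomA τ (z i) ^ α i := by
      rw [sum_map, almostEval, MvPolynomial.coe_eval₂Hom, MvPolynomial.eval₂_eq']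
      refine sum_congr rfl fun d _ => ?_
      simp [e]
    rw [h1, h2]
    refine (sum_subset (subset_insert _ _) fun α _ hα => ?_)
    have : P.coeff (e.symm α) = 0 := by
      by_contra h
      exact hα (mem_map.2 ⟨e.symm α, MvPolynomial.mem_support_iff.2 h, by simp⟩)
    rw [this]; simp

theorem isCompletion_partitionSum (n : ℕ) :
    IsCompletion (n - 1) gwT fun τ (z : Fin n → ℂ) => partitionSum (EStarHat τ) z where
  extension := isAlmostMeroExtension_of_mem (F := fun τ z => partitionSum (EStar τ) z)
    (partitionSum_mem_almostMeroRing n) fun _ hτ _ hz => (gwT_eq_partitionSum hτ hz).symm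
  elliptic := isElliptic_partitionSum_EStarHat n
  modular := isModular_partitionSum_EStarHat n

end AlmostMeromorphy

/-! ### Uniqueness by analytic continuation from real loci. -/

section Uniqueness

variable {n : ℕ} {τ : ℂ}

theorem isOpen_regularLocus (n : ℕ) (hτ : 0 < τ.im) : IsOpen (regularLocus n τ) := by
  have : regularLocus n τ = ⋂ S : {S : Finset (Fin n) // S.Nonempty ∧ S ≠ univ},
      (fun z : Fin n → ℂ => ∑ i ∈ S.1, z i) ⁻¹' (Lat τ)ᶜ := by
    ext z; simp [regularLocus]
  rw [this]
  exact isOpen_iInter_of_finite fun S => (isOpen_compl_Lat hτ).preimage (by fun_prop)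

theorem isOpen_traceDomain (n : ℕ) (τ : ℂ) : IsOpen (traceDomain n τ) := by
  have : traceDomain n τ = (⋂ i, {z : Fin n → ℂ | 0 < (z i).re}) ∩
      {z | (∑ i, z i).re < 2 * Real.pi * τ.im} := by
    ext z; simp [traceDomain]
  rw [this]
  refine (isOpen_iInter_of_finite fun i => isOpen_lt continuous_const ?_).inter
    (isOpen_lt ?_ continuous_const)
  · exact continuous_re.comp (continuous_apply i)
  · exact continuous_re.comp (by fun_prop)

theorem traceDomain_nonempty (n : ℕ) (hτ : 0 < τ.im) : (traceDomain n τ).Nonempty := by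
  have hp : 0 < Real.pi * τ.im := by positivity
  refine ⟨fun _ => ((Real.pi * τ.im / (n + 1) : ℝ) : ℂ), fun i => ?_, ?_⟩
  · rw [ofReal_re]; positivity
  · rw [sum_const, card_univ, Fintype.card_fin, nsmul_eq_mul, ← ofReal_natCast, ← ofReal_mul,
      ofReal_re]
    have : (n : ℝ) * (Real.pi * τ.im / (n + 1)) ≤ Real.pi * τ.im := by
      rw [mul_div_left_comm]
      exact mul_le_of_le_one_right hp.le (div_le_one_of_le₀ (by linarith) (by positivity))
    linarith

theorem countable_Lat (τ : ℂ) : (Lat τ).Countable := by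
  have : Lat τ = Set.range fun p : ℤ × ℤ =>
      (2 * Real.pi * I * p.1 + 2 * Real.pi * I * τ * p.2 : ℂ) := by
    ext l; simp [Lat, eq_comm]
  rw [this]
  exact Set.countable_range _

theorem IsMero.differentiableOn {c : ℂ × (Fin n → ℂ) → ℂ} (hc : IsMero c) (hτ : 0 < τ.im) :
    DifferentiableOn ℂ (fun z => c (τ, z)) (regularLocus n τ) := by
  intro z hz
  obtain ⟨V, g, h, hV, hpV, hg, hh, hgh⟩ := hc (τ, z) hτ
  have hslice : DifferentiableAt ℂ (fun z : Fin n → ℂ => (τ, z)) z := by fun_prop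
  have hg1 : DifferentiableAt ℂ (fun z => g (τ, z)) z :=
    (hg.differentiableAt (hV.mem_nhds hpV)).comp z hslice
  have hh1 : DifferentiableAt ℂ (fun z => h (τ, z)) z :=
    (hh.differentiableAt (hV.mem_nhds hpV)).comp z hslice
  have h1 := hg1.fun_mul (hh1.fun_inv (hgh (τ, z) hpV hτ hz).1)
  refine (h1.congr_of_eventuallyEq ?_).differentiableWithinAt
  filter_upwards [(isOpen_regularLocus n hτ).mem_nhds hz,
    hslice.continuousAt.preimage_mem_nhds (hV.mem_nhds hpV)] with w hw hwV
  exact (hgh (τ, w) hwV hτ hw).2.trans (div_eq_mul_inv _ _)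

/-- Along the line each `z_S` is affine in `s`. If it is not constant, it meets the countable
lattice countably often; if constant, the regular point `s₀` shows that it avoids the lattice. -/
theorem countable_compl_line (p w : Fin n → ℂ) (hne : ∃ s : ℂ, p + s • w ∈ regularLocus n τ) :
    {s : ℂ | p + s • w ∉ regularLocus n τ}.Countable := by
  obtain ⟨s₀, hs₀⟩ := hne
  have : {s : ℂ | p + s • w ∉ regularLocus n τ} ⊆
      ⋃ S : {S : Finset (Fin n) // S.Nonempty ∧ S ≠ univ},
        {s : ℂ | ∑ i ∈ S.1, p i + s * ∑ i ∈ S.1, w i ∈ Lat τ} := by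
    intro s hs
    simp only [Set.mem_ofPred_eq, regularLocus, not_forall, not_not] at hs
    obtain ⟨S, h1, h2, h3⟩ := hs
    refine Set.mem_iUnion.2 ⟨⟨S, h1, h2⟩, ?_⟩
    simpa [sum_add_distrib, mul_sum] using h3
  refine (Set.countable_iUnion fun S => ?_).mono this
  by_cases hw : ∑ i ∈ S.1, w i = 0
  · refine Set.countable_empty.mono fun s hs => ?_
    have h4 := hs₀ S.1 S.2.1 S.2.2
    simp only [Pi.add_apply, Pi.smul_apply, smul_eq_mul, sum_add_distrib, ← mul_sum, hw, mul_zero] at h4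
    simp only [Set.mem_ofPred_eq, hw, mul_zero] at hs
    exact h4 hs
  · exact (countable_Lat τ).preimage_of_injOn (f := fun s => ∑ i ∈ S.1, p i + s * ∑ i ∈ S.1, w i)
      fun a _ b _ h => mul_right_cancel₀ hw (add_left_cancel h)

/-- The identity theorem on the intersection of a complex line with the regular locus. -/
theorem eq_zero_of_frequently_line (hτ : 0 < τ.im) {p w : Fin n → ℂ} {F : ℂ → ℂ}
    (hF : DifferentiableOn ℂ F {s : ℂ | p + s • w ∈ regularLocus n τ}) {s₁ s₂ : ℂ}
    (h₁ : p + s₁ • w ∈ regularLocus n τ) (h₂ : p + s₂ • w ∈ regularLocus n τ)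
    (h : ∃ᶠ s in nhdsWithin s₁ {s₁}ᶜ, F s = 0) : F s₂ = 0 := by
  set G := {s : ℂ | p + s • w ∈ regularLocus n τ} with hG
  have hGo : IsOpen G := (isOpen_regularLocus n hτ).preimage (by fun_prop)
  -- Removing a countable set from the real plane leaves it connected.
  have hGc : IsPreconnected G := by
    have h1 : G = {s : ℂ | p + s • w ∉ regularLocus n τ}ᶜ := by ext; simp [G]
    rw [h1]
    refine (Set.Countable.isConnected_compl_of_one_lt_rank ?_
      (countable_compl_line p w ⟨s₁, h₁⟩)).isPreconnected
    rw [Complex.rank_real_complex]; norm_num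
  exact (hF.analyticOnNhd hGo).eqOn_zero_of_preconnected_of_frequently_eq_zero hGc h₁ h h₂

/-- A meromorphic function vanishing on the domain of convergence vanishes. -/
theorem eq_zero_of_traceDomain (hτ : 0 < τ.im) {d : (Fin n → ℂ) → ℂ}
    (hd : DifferentiableOn ℂ d (regularLocus n τ)) (h0 : ∀ z ∈ traceDomain n τ, d z = 0)
    {z : Fin n → ℂ} (hz : z ∈ regularLocus n τ) : d z = 0 := by
  obtain ⟨p, hp⟩ := traceDomain_nonempty n hτ
  have hc : Continuous fun s : ℂ => p + s • (z - p) := by fun_prop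
  have hF : DifferentiableOn ℂ (fun s : ℂ => d (p + s • (z - p)))
      {s : ℂ | p + s • (z - p) ∈ regularLocus n τ} := by
    have h1 : DifferentiableOn ℂ (fun s : ℂ => p + s • (z - p))
      {s : ℂ | p + s • (z - p) ∈ regularLocus n τ} := by fun_prop
    exact hd.comp h1 fun _ h => h
  have h := eq_zero_of_frequently_line hτ hF (s₁ := 0) (s₂ := 1)
    (by simpa using traceDomain_subset_regularLocus n τ hp) (by simpa using hz) ?_
  · simpa using h
  · refine Filter.Eventually.frequently ?_
    have h1 : (fun s : ℂ => p + s • (z - p)) ⁻¹' traceDomain n τ ∈ nhds (0 : ℂ) :=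
      hc.continuousAt.preimage_mem_nhds ((isOpen_traceDomain n τ).mem_nhds (by simpa using hp))
    filter_upwards [mem_nhdsWithin_of_mem_nhds h1] with s hs using h0 _ hs

theorem add_mem_regularLocus {z l : Fin n → ℂ} (hz : z ∈ regularLocus n τ)
    (hl : ∀ i, l i ∈ Lat τ) : z + l ∈ regularLocus n τ := fun S h1 h2 => by
  simp only [Pi.add_apply, sum_add_distrib]
  exact mt (add_mem_Lat_iff (sum_mem_Lat hl S) _).1 (hz S h1 h2)

/-- The real point of the line through `z` in the direction where `A` takes the value `x`. -/
theorem anomA_line (hτ : 0 < τ.im) (z : ℂ) (x s : ℝ) :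
    anomA τ (z + (s * I + 1) * (((-(2 * Real.pi * τ.im * x) - z.re : ℝ)) : ℂ)) = x := by
  have h : ∀ w : ℂ, (w / (2 * Real.pi * I)).im = -w.re / (2 * Real.pi) := fun w => by
    have hp := Real.pi_pos
    rw [show w / (2 * Real.pi * I) = -(w * I) / ((2 * Real.pi : ℝ) : ℂ) by
      push_cast
      have : (Real.pi : ℂ) ≠ 0 := by exact_mod_cast hp.ne'
      field_simp
      rw [I_sq]; ring, div_ofReal_im]
    simp
  rw [anomA, h]
  norm_cast
  simp only [add_re, mul_re, ofReal_re, I_re, mul_zero, ofReal_im, I_im, mul_one, sub_self, add_zero,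
    one_re, add_im, mul_im, one_im, zero_add, sub_zero]
  have := Real.pi_pos
  field_simp
  ring_nf

/-- An elliptic polynomial in the `A(zᵢ)` with meromorphic coefficients vanishes if its constant
coefficient vanishes on the domain of convergence. -/
theorem coeff_eq_zero_of_elliptic (hτ : 0 < τ.im) {S : Finset (Fin n → ℕ)}
    {d : (Fin n → ℕ) → (Fin n → ℂ) → ℂ} (hd : ∀ α, DifferentiableOn ℂ (d α) (regularLocus n τ))
    (h0S : 0 ∈ S) (h0 : ∀ z ∈ traceDomain n τ, d 0 z = 0)
    (hell : ∀ z ∈ regularLocus n τ, ∀ l : Fin n → ℂ, (∀ i, l i ∈ Lat τ) →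
      ∑ α ∈ S, d α (z + l) * ∏ i, anomA τ ((z + l) i) ^ α i =
        ∑ α ∈ S, d α z * ∏ i, anomA τ (z i) ^ α i)
    {z : Fin n → ℂ} (hz : z ∈ regularLocus n τ) :
    ∑ α ∈ S, d α z * ∏ i, anomA τ (z i) ^ α i = 0 := by
  -- The line `p + s w` passes through `z` at `s = I`, and for real `s` it lies in the locus `A(z_i)
  -- = -b_i`. Translation by `l = 2πiτ b` moves that locus to `A = 0`, where only the constant
  -- coefficient survives. Ellipticity thus gives `F s = 0` at regular points with `s` real.
  have key : ∀ b : Fin n → ℤ, ∑ α ∈ S, d α z * ∏ i, ((-b i : ℤ) : ℂ) ^ α i = 0 := by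
    intro b
    set l : Fin n → ℂ := fun i => 2 * Real.pi * I * (0 : ℤ) + 2 * Real.pi * I * τ * (b i : ℤ) with hl
    have hlL : ∀ i, l i ∈ Lat τ := fun i => ⟨0, b i, rfl⟩
    set v : Fin n → ℂ := fun i =>
      ((-(2 * Real.pi * τ.im * ((-b i : ℤ) : ℝ)) - (z i).re : ℝ) : ℂ) with hv
    set p := z + v with hp
    set w := I • v with hw
    have hreal : ∀ (s : ℝ) i, anomA τ ((p + (s : ℂ) • w) i) = ((-b i : ℤ) : ℂ) := fun s i => by
      have := anomA_line hτ (z i) ((-b i : ℤ) : ℝ) s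
      rw [show (p + (s : ℂ) • w) i = z i + (s * I + 1) * v i by
        simp only [hp, hw, Pi.add_apply, Pi.smul_apply, smul_eq_mul]; ring, hv, this]
      norm_cast
    have hzI : p + I • w = z := by
      rw [hp, hw, smul_smul, I_mul_I]; simp
    let F : ℂ → ℂ := fun s => ∑ α ∈ S, d α (p + s • w) * ∏ i, ((-b i : ℤ) : ℂ) ^ α i - d 0 (p + s • w + l)
    have hF : DifferentiableOn ℂ F {s : ℂ | p + s • w ∈ regularLocus n τ} := by
      have h1 : DifferentiableOn ℂ (fun s : ℂ => p + s • w)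
        {s : ℂ | p + s • w ∈ regularLocus n τ} := by fun_prop
      have h2 : DifferentiableOn ℂ (fun s : ℂ => p + s • w + l)
        {s : ℂ | p + s • w ∈ regularLocus n τ} := by fun_prop
      refine DifferentiableOn.fun_sub (DifferentiableOn.fun_sum fun α _ => ?_) ?_
      · exact ((hd α).comp h1 fun _ h => h).mul_const _
      · exact (hd 0).comp h2 fun _ h => add_mem_regularLocus h hlL
    have hFreal : ∀ s : ℝ, p + (s : ℂ) • w ∈ regularLocus n τ → F s = 0 := fun s hs => by
      have h1 := hell _ hs l hlL
      have h2 : ∀ i, anomA τ ((p + (s : ℂ) • w + l) i) = 0 := fun i => by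
        rw [Pi.add_apply, hl, anomA_add_period hτ, hreal]; push_cast; ring
      simp only [hreal, h2] at h1
      rw [sum_eq_single_of_mem 0 h0S fun α _ hα => ?_] at h1
      · simp only [F, ← h1]; simp
      · obtain ⟨i, hi⟩ := Function.ne_iff.1 hα
        rw [prod_eq_zero (mem_univ i) (zero_pow hi), mul_zero]
    have hcount := countable_compl_line (τ := τ) p w ⟨I, by rwa [hzI]⟩
    obtain ⟨s₁, hs₁⟩ : ∃ s : ℝ, p + (s : ℂ) • w ∈ regularLocus n τ := by
      by_contra! h
      have h1 : (Set.univ : Set ℝ).Countable :=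
        (hcount.preimage_of_injOn ofReal_injective.injOn).mono fun s _ => h s
      exact Set.not_countable_univ h1
    have hfreq : ∃ᶠ s in nhdsWithin (s₁ : ℂ) {(s₁ : ℂ)}ᶜ, F s = 0 := by
      have hc : Continuous fun s : ℝ => p + (s : ℂ) • w := by fun_prop
      have h1 : ∀ᶠ s in nhdsWithin s₁ {s₁}ᶜ, F ((s : ℝ) : ℂ) = 0 := by
        filter_upwards [mem_nhdsWithin_of_mem_nhds (hc.continuousAt.preimage_mem_nhds
          ((isOpen_regularLocus n hτ).mem_nhds hs₁))] with s hs using hFreal s hs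
      have h2 : Filter.Tendsto (fun s : ℝ => (s : ℂ)) (nhdsWithin s₁ {s₁}ᶜ)
          (nhdsWithin (s₁ : ℂ) {(s₁ : ℂ)}ᶜ) :=
        continuous_ofReal.continuousAt.continuousWithinAt.tendsto_nhdsWithin fun s hs h =>
          hs (ofReal_injective h)
      exact h2.frequently h1.frequently
    -- `F` no longer contains `A`, so it is holomorphic in `s` and its vanishing for real `s`
    -- carries over to `s = I`.
    have h3 := eq_zero_of_frequently_line hτ hF hs₁ (s₂ := I) (by rwa [hzI]) hfreq
    simp only [F, hzI] at h3
    rwa [eq_zero_of_traceDomain hτ (hd 0) h0 (add_mem_regularLocus hz hlL), sub_zero] at h3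
  let Q : MvPolynomial (Fin n) ℂ :=
    ∑ α ∈ S, MvPolynomial.monomial (Finsupp.equivFunOnFinite.symm α) (d α z)
  have hQ : ∀ x : Fin n → ℂ, MvPolynomial.eval x Q = ∑ α ∈ S, d α z * ∏ i, x i ^ α i := fun x => by
    simp only [Q, map_sum, MvPolynomial.eval_monomial]
    refine sum_congr rfl fun α _ => ?_
    rw [Finsupp.prod_fintype _ _ fun i => pow_zero _]
    simp
  -- By `key` the polynomial with coefficients `d α z` vanishes on all integer points, a product of
  -- infinite sets.
  have hQ0 : Q = 0 := by
    refine MvPolynomial.funext_set (fun _ => Set.range ((↑) : ℤ → ℂ))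
      (fun _ => Set.infinite_range_of_injective Int.cast_injective) fun x hx => ?_
    choose b hb using fun i => hx i (Set.mem_univ i)
    rw [hQ, map_zero, ← key (-b)]
    simp [hb]
  rw [← hQ, hQ0, map_zero]

/-- The difference of two completions is an elliptic polynomial in the `A(z_i)` with zero constant
coefficient on the domain of convergence. Both index sets are extended by zero to their union. -/
theorem IsCompletion.eqOn {w w' : ℕ} {f fhat fhat' : ℂ → (Fin n → ℂ) → ℂ}
    (h : IsCompletion w f fhat) (h' : IsCompletion w' f fhat') (hτ : 0 < τ.im) {z : Fin n → ℂ}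
    (hz : z ∈ regularLocus n τ) : fhat τ z = fhat' τ z := by
  classical
  obtain ⟨s, c, hc, hs, hf, hsum⟩ := h.extension
  obtain ⟨s', c', hc', hs', hf', hsum'⟩ := h'.extension
  let d : (Fin n → ℕ) → (Fin n → ℂ) → ℂ := fun α z =>
    (if α ∈ s then c α (τ, z) else 0) - if α ∈ s' then c' α (τ, z) else 0
  have hsumd : ∀ z ∈ regularLocus n τ,
      ∑ α ∈ s ∪ s', d α z * ∏ i, anomA τ (z i) ^ α i = fhat τ z - fhat' τ z := fun z hz => by
    simp only [d, sub_mul, sum_sub_distrib, ite_mul, zero_mul]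
    rw [sum_ite_mem, sum_ite_mem, union_inter_cancel_left, union_inter_cancel_right,
      hsum τ hτ z hz, hsum' τ hτ z hz]
  refine sub_eq_zero.1 ((hsumd z hz).symm.trans (coeff_eq_zero_of_elliptic hτ (fun α => ?_)
    (mem_union_left _ hs) (fun z hz => ?_) (fun z hz l hl => ?_) hz))
  · refine DifferentiableOn.fun_sub ?_ ?_ <;> split_ifs
    · exact (hc α).differentiableOn hτ
    · exact differentiableOn_const _
    · exact (hc' α).differentiableOn hτ
    · exact differentiableOn_const _
  · simp only [d, if_pos hs, if_pos hs', hf τ hτ z hz, hf' τ hτ z hz, sub_self]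
  · rw [hsumd z hz, hsumd _ (add_mem_regularLocus hz hl), h.elliptic τ hτ z hz l hl,
      h'.elliptic τ hτ z hz l hl]

end Uniqueness

/-! ### Characterization of the completion. -/

section Completion

variable {n : ℕ}

theorem im_moebius_pos_of_det {τ : ℂ} (hτ : 0 < τ.im) {a b c d : ℤ} (h : a * d - b * c = 1) :
    0 < ((a * τ + b) / (c * τ + d)).im :=
  im_moebius_pos ⟨!![a, b; c, d], by rw [Matrix.det_fin_two_of]; exact h⟩ hτ

theorem div_mem_regularLocus {τ : ℂ} (hτ : 0 < τ.im) {a b c d : ℤ} (h : a * d - b * c = 1)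
    {z : Fin n → ℂ} (hz : z ∈ regularLocus n τ) :
    (fun i => z i / (c * τ + d)) ∈ regularLocus n ((a * τ + b) / (c * τ + d)) := fun S h1 h2 => by
  rw [← sum_div]
  exact div_autFactor_notMem_Lat ⟨!![a, b; c, d], by rw [Matrix.det_fin_two_of]; exact h⟩ hτ
    (hz S h1 h2)

theorem IsCompletion.congr {w : ℕ} {f fhat fhat' : ℂ → (Fin n → ℂ) → ℂ}
    (h : IsCompletion w f fhat)
    (heq : ∀ τ : ℂ, 0 < τ.im → ∀ z ∈ regularLocus n τ, fhat' τ z = fhat τ z) :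
    IsCompletion w f fhat' where
  extension := by
    obtain ⟨s, c, hc, hs, hf, hsum⟩ := h.extension
    exact ⟨s, c, hc, hs, hf, fun τ hτ z hz => (heq τ hτ z hz).trans (hsum τ hτ z hz)⟩
  elliptic τ hτ z hz l hl := by
    rw [heq τ hτ z hz, heq τ hτ _ (add_mem_regularLocus hz hl), h.elliptic τ hτ z hz l hl]
  modular τ hτ z hz a b c d hdet := by
    rw [heq τ hτ z hz, heq _ (im_moebius_pos_of_det hτ hdet) _ (div_mem_regularLocus hτ hdet hz),
      h.modular τ hτ z hz a b c d hdet]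

/-- The unique elliptic and modular completion is given by the completed partition sum. -/
theorem isCompletion_iff {That : ℂ → (Fin n → ℂ) → ℂ} : IsCompletion (n - 1) gwT That ↔
    ∀ τ : ℂ, 0 < τ.im → ∀ z ∈ regularLocus n τ, That τ z = partitionSum (EStarHat τ) z :=
  ⟨fun h _ hτ _ hz => h.eqOn (isCompletion_partitionSum n) hτ hz,
    fun h => (isCompletion_partitionSum n).congr h⟩

end Completion

end EllipticGW

end


theorem mainTheorem8 (n : ℕ) (hn : 1 ≤ n) :
    (∀ τ : ℂ, 0 < τ.im → ∀ z ∈ EllipticGW.traceDomain n τ,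
      EllipticGW.gwT τ z = EllipticGW.partitionSum (EllipticGW.EStar τ) z) ∧
    (∀ That : ℂ → (Fin n → ℂ) → ℂ,
      EllipticGW.IsCompletion (n - 1) EllipticGW.gwT That ↔
        ∀ τ : ℂ, 0 < τ.im → ∀ z ∈ EllipticGW.regularLocus n τ,
          That τ z = EllipticGW.partitionSum (EllipticGW.EStarHat τ) z) ∧
    (∀ That : ℂ → (Fin n → ℂ) → ℂ,
      EllipticGW.IsCompletion (n - 1) EllipticGW.gwT That ↔
        ∀ τ : ℂ, 0 < τ.im → ∀ z ∈ EllipticGW.regularLocus n τ,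
          That τ z = EllipticGW.explicitSum τ z) := by
  have key := fun That : ℂ → (Fin n → ℂ) → ℂ => EllipticGW.isCompletion_iff (That := That)
  refine ⟨fun τ hτ z hz => EllipticGW.gwT_eq_partitionSum hτ hz, key, fun That =>
    (key That).trans (forall₂_congr fun τ hτ => forall₂_congr fun z hz => ?_)⟩
  rw [EllipticGW.explicitSum_eq_partitionSum hτ hz]
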